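/- **Market.** Let $(\mathcal N,\mathcal E)$ be a finite directed graph (self-loops allowed); its arcs are called lanes. Each lane $(i,j)$ has a demand function $d_{ij}(\cdot)\ge 0$, strictly decreasing on a set of admissible shipper prices, with inverse $r_{ij}(\cdot)$; a carrier arrival rate $\lambda_{ij}>0$; a penalty $b_{ij}\ge 0$ per load that is not transported; and a probability $q_{ij}\ge 0$, with $\sum_{j}q_{ij}\le 1$ for each $i$. The opportunity costs of carriers on lane $(i,j)$ are i.i.d. with distribution function $F_{ij}$ and a density $f_{ij}$ that is positive exactly on an open interval $I_{ij}\subseteq[0,\infty)$, on which the virtual cost $\psi_{ij}(c)=c+F_{ij}(c)/f_{ij}(c)$ is strictly increasing. Put $\psi_{ij}^{-1}(b)=\sup\{c\in I_{ij}:\psi_{ij}(c)\le b\}$ (and $0$ if this set is empty), and let $F_{ij}^{-1}(0)=\inf I_{ij}$. In each period, with $S_{ij}$ carriers and $D_{ij}$ loads on each lane, a mechanism selects which carriers transport a load and pays them; let $Y_{ij}$ be the number of loads transported and $P_{ij}$ the total payment on lane $(i,j)$. With shipper prices $r$, the expected profit of the period is $\mathrm E\big[\sum_{(i,j)\in\mathcal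 E} r_{ij}d_{ij}(r_{ij})-b_{ij}(D_{ij}-Y_{ij})-P_{ij}\,\big|\,\mathbf S,\mathbf D\big]$. Each carrier who has delivered at node $i$ independently goes on with lane $(i,j)$ with probability $q_{ij}$ and leaves with probability $1-\sum_j q_{ij}$; all other carriers leave. The carriers of the next period on lane $(i,j)$ are those who go on with it and an independent Poisson($\lambda_{ij}$) number of new ones; the loads of the next period are independent Poisson($d_{ij}(r_{ij})$). The long-run average profit $\gamma$ of a mechanism is the limit, as $T\to\infty$, of the expected profit per period over the first $T$ periods. **Fluid problem.** Let $\gamma^{\mathsf{FA}}$ be the optimal value of: maximize $\sum_{(i,j)\in\mathcal E} r_{ij}(d_{ij})d_{ij}-F_{ij}^{-1}(\bar y_{ij}/\bar\lambda_{ij})\,\bar y_{ij}-b_{ij}(d_{ij}-\bar y_{ij})$ subject to $\sum_{k:(k,i)\in\mathcal E}q_{ij}\bar y_{ki}+\lambda_{ij}=\bar\lambda_{ij}$, $0\le\bar y_{ij}\le d_{ij}$, $\bar y_{ij}\le\bar\lambda_{ij}$ for all $(i,j)\in\mathcal E$, over points at which $r_{ij}(d_{ij})$ and $F_{ij}^{-1}(\bar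 y_{ij}/\bar\lambda_{ij})$ are defined. Let $(d^*,\bar y^*,\bar\lambda^*)$ be an optimal solution, $r^*_{ij}=r_{ij}(d^*_{ij})$, $p^*_{ij}=F_{ij}^{-1}(\bar y^*_{ij}/\bar\lambda^*_{ij})$ and $\xi^*_{ij}=\max\{\psi_{ij}^{-1}(b_{ij}),p^*_{ij}\}$. **Mechanisms.** All three charge shippers $r^*$ and treat lanes and periods separately; carriers bid their true costs. On a lane with $D$ loads: $\mathsf{SP}$ offers the price $p^*$, and the carriers with cost at most $p^*$ book the loads in order of arrival while loads remain. $\mathsf{AUC}$ is the uniform price auction with reserve price $\xi^*$: the $D$ lowest bids not exceeding $\xi^*$ win, and carrier $s$, bidding $C^s$ and receiving $A^s\in\{0,1\}$ loads, is paid $C^sA^s+\mathcal J(\mathbf C^{-s})-\mathcal J(\mathbf C)$, where $\mathcal J(\mathbf C)$ is the minimum of $\sum_s C^sa^s+\xi^*y^0$ over $0\le a^s\le1$, $y^0\ge0$, $\sum_s a^s+y^0=D$. $\mathsf{HYB}$ uses the allocation and the payments of $\mathsf{SP}$ if more than $D$ carriers bid at most $p^*$, and those of $\mathsf{AUC}$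 otherwise. **Theorem 5.** The long-run average profits of $\mathsf{SP}$, $\mathsf{HYB}$ and $\mathsf{AUC}$ exist and do not depend on the initial state, and $\gamma^{\mathsf{HYB}}\le\gamma^{\mathsf{AUC}}$. If moreover $p^*_{ij}\le b_{ij}$ on every lane with $\bar y^*_{ij}>0$, then $$\gamma^{\mathsf{SP}}\le\gamma^{\mathsf{HYB}},$$ and $\mathsf{HYB}$ is asymptotically optimal: if, for $\theta=1,2,\dots$, the demand functions and the arrival rates are multiplied by $\theta$, and $\gamma^{\mathsf{FA}}(\theta)$ and $\gamma^{\mathsf{HYB}}(\theta)$ denote the fluid optimum and the long-run average profit of $\mathsf{HYB}$ (with the same $r^*,p^*,\xi^*$) in the scaled market, then $\gamma^{\mathsf{FA}}(\theta)-\gamma^{\mathsf{HYB}}(\theta)\le K\sqrt\theta$ for a constant $K$ independent of $\theta$, and, if $\gamma^{\mathsf{FA}}>0$, $\gamma^{\mathsf{HYB}}(\theta)/\gamma^{\mathsf{FA}}(\theta)\to1$ as $\theta\to\infty$. -/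

import Mathlib

open MeasureTheory ProbabilityTheory Filter Topology
open scoped ENNReal NNReal

namespace Freight

/-! ## Carrier costs -/

/-- The law on the real line with density `f`. -/
noncomputable def lawOf (f : ℝ → ℝ) : Measure ℝ :=
  volume.withDensity (fun c => ENNReal.ofReal (f c))

/-- The distribution function of the law with density `f`. -/
noncomputable def cdfOf (f : ℝ → ℝ) (c : ℝ) : ℝ := (lawOf f).real (Set.Iic c)

/-- A regular distribution of a carrier's opportunity cost: a law with a density that is positive
exactly on an open interval `range` of non-negative reals (bounded or not), for which the virtual
cost `c + F c / f c` is strictly increasing on `range`. -/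
structure CostDistribution where
  density : ℝ → ℝ
  range : Set ℝ
  isOpen_range : IsOpen range
  ordConnected_range : range.OrdConnected
  nonempty_range : range.Nonempty
  range_nonneg : range ⊆ Set.Ici 0
  measurable_density : Measurable density
  density_pos : ∀ c ∈ range, 0 < density c
  density_zero : ∀ c ∉ range, density c = 0
  lintegral_density : ∫⁻ c, ENNReal.ofReal (density c) = 1
  regular : StrictMonoOn (fun c => c + cdfOf density c / density c) range

namespace CostDistribution

variable (G : CostDistribution)

/-- The law of a carrier's opportunity cost. -/
noncomputable def law : Measure ℝ := lawOf G.density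

instance : IsProbabilityMeasure G.law :=
  ⟨by simp [law, lawOf, G.lintegral_density]⟩

/-- The distribution function `F`. -/
noncomputable def F (c : ℝ) : ℝ := cdfOf G.density c

/-- The inverse of `F`: on `(0, 1)` it is the unique solution of `F c = x`; at `0` it is the lower
end of the range of costs, and at `1` the upper end, if that is finite. -/
noncomputable def Finv (x : ℝ) : ℝ := sInf {c | c ∈ closure G.range ∧ x ≤ G.F c}

/-- The virtual cost function `ψ`. -/
noncomputable def virtualCost (c : ℝ) : ℝ := c + G.F c / G.density c

/-- The inverse of `ψ`. For `b` between the extreme values of `ψ` on the range of costs this is the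
generalized inverse of the increasing function `ψ`; above them it is the upper end of the range;
below them it is `0`, a price that no carrier accepts. -/
noncomputable def virtualCostInv (b : ℝ) : ℝ := sSup {c | c ∈ G.range ∧ G.virtualCost c ≤ b}

end CostDistribution

/-! ## Mechanisms on a single lane in a single period

There are `n` carriers, numbered in their order of arrival, `D` loads, and `c : Fin n → ℝ` is the
vector of bids. -/

/-- A direct mechanism for one lane: the set of carriers that receive a load, and the payment to
each carrier, as functions of the number of carriers, the number of loads and the bids. -/
structure LaneMechanism where
  alloc : (n : ℕ) → ℕ → (Fin n → ℝ) → Finset (Fin n)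
  pay : (n : ℕ) → ℕ → (Fin n → ℝ) → Fin n → ℝ

/-- The carriers who accept the price `p`. -/
noncomputable def accepting (p : ℝ) {n : ℕ} (c : Fin n → ℝ) : Finset (Fin n) :=
  {s | c s ≤ p}

/-- Posted price `p`: carriers who accept the price book the remaining loads in order of arrival. -/
noncomputable def spAlloc (p : ℝ) {n : ℕ} (D : ℕ) (c : Fin n → ℝ) : Finset (Fin n) :=
  {s | c s ≤ p ∧ ((accepting p c).filter (fun s' => s' < s)).card < D}

/-- The static posted price mechanism with price `p`. -/
noncomputable def spMechanism (p : ℝ) : LaneMechanism where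
  alloc _ D c := spAlloc p D c
  pay _ D c s := if s ∈ spAlloc p D c then p else 0

/-- The optimal value of the allocation problem with reserve price `ξ` among the carriers in `T`:
minimize `∑ c s * a s + ξ * y0` subject to `0 ≤ a s ≤ 1`, `∑ a s + y0 = D` and `0 ≤ y0`. -/
noncomputable def assignmentValue (ξ : ℝ) {n : ℕ} (D : ℕ) (c : Fin n → ℝ)
    (T : Finset (Fin n)) : ℝ :=
  sInf {v | ∃ (a : Fin n → ℝ) (y0 : ℝ), (∀ s ∈ T, 0 ≤ a s ∧ a s ≤ 1) ∧ 0 ≤ y0 ∧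
    ∑ s ∈ T, a s + y0 = D ∧ v = ∑ s ∈ T, c s * a s + ξ * y0}

/-- The allocation of the uniform price auction with reserve price `ξ`: the `D` lowest among the
bids that do not exceed `ξ` win (equal bids, which have probability zero, in order of arrival). -/
noncomputable def aucAlloc (ξ : ℝ) {n : ℕ} (D : ℕ) (c : Fin n → ℝ) : Finset (Fin n) :=
  {s | c s ≤ ξ ∧
    (Finset.univ.filter (fun s' => c s' < c s ∨ (c s' = c s ∧ s' < s))).card < D}

/-- The payment of the uniform price auction with reserve price `ξ`. -/
noncomputable def aucPay (ξ : ℝ) {n : ℕ} (D : ℕ) (c : Fin n → ℝ) (s : Fin n) : ℝ :=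
  (if s ∈ aucAlloc ξ D c then c s else 0)
    + assignmentValue ξ D c (Finset.univ.erase s) - assignmentValue ξ D c Finset.univ

/-- The uniform price auction with reserve price `ξ`. -/
noncomputable def aucMechanism (ξ : ℝ) : LaneMechanism where
  alloc _ D c := aucAlloc ξ D c
  pay _ D c s := aucPay ξ D c s

/-- The hybrid mechanism with posted price `p` and reserve price `ξ`: the posted price outcome if
more carriers accept `p` than there are loads, and the auction outcome otherwise. -/
noncomputable def hybMechanism (p ξ : ℝ) : LaneMechanism where
  alloc _ D c := if D < (accepting p c).card then spAlloc p D c else aucAlloc ξ D c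
  pay _ D c s :=
    if D < (accepting p c).card then (if s ∈ spAlloc p D c then p else 0) else aucPay ξ D c s

/-! ## The market -/

variable {N : Type*} [Fintype N] [DecidableEq N]

/-- The primitives of a freight market on the directed graph with node set `N` and set of lanes
`E` (self-loops allowed). -/
structure Market (N : Type*) [Fintype N] [DecidableEq N] (E : Finset (N × N)) where
  /-- admissible shipper prices -/
  prices : E → Set ℝ
  /-- demand rate as a function of the shipper price -/
  demand : E → ℝ → ℝ
  demand_nonneg : ∀ e, ∀ r ∈ prices e, 0 ≤ demand e r
  demand_strictAnti : ∀ e, StrictAntiOn (demand e) (prices e)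
  /-- rate of exogenous carrier arrivals -/
  arrival : E → ℝ
  arrival_pos : ∀ e, 0 < arrival e
  /-- penalty for a load that is not transported -/
  penalty : E → ℝ
  penalty_nonneg : ∀ e, 0 ≤ penalty e
  /-- `stay e` is the probability that a carrier who has just delivered at the origin of `e`
  goes on with lane `e` -/
  stay : E → ℝ
  stay_nonneg : ∀ e, 0 ≤ stay e
  stay_sum : ∀ i, ∑ e : E with e.1.1 = i, stay e ≤ 1
  /-- law of the carriers' opportunity costs -/
  cost : E → CostDistribution

/-- What a carrier does after a delivery: leave the market, or go on with the lane `e`. -/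
inductive NextMove (E : Type*)
  | leave : NextMove E
  | take : E → NextMove E

instance (E : Type*) : MeasurableSpace (NextMove E) := ⊤

/-- State at the beginning of a period: numbers of carriers and of loads on each lane. -/
abbrev State (E : Finset (N × N)) : Type _ := (E → ℕ) × (E → ℕ)

/-- The randomness of one period: costs of the carriers on each lane, next moves of the carriers
who deliver at each node, loads and exogenous carrier arrivals for the next period. -/
abbrev Noise (E : Finset (N × N)) : Type _ :=
  (E → ℕ → ℝ) × (N → ℕ → NextMove E) × (E → ℕ) × (E → ℕ)

/-- A static policy: a shipper price and a carrier-side mechanism for each lane. -/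
structure Policy (E : Finset (N × N)) where
  shipperPrice : E → ℝ
  carrier : E → LaneMechanism

namespace Market

variable {E : Finset (N × N)} (M : Market N E)

/-- The inverse demand function. -/
noncomputable def invDemand (e : E) (d : ℝ) : ℝ := Function.invFunOn (M.demand e) (M.prices e) d

/-- The market whose demand rates and carrier arrival rates are multiplied by `θ`. -/
noncomputable def scale (θ : ℕ+) : Market N E where
  prices := M.prices
  demand e r := θ * M.demand e r
  demand_nonneg e r hr := mul_nonneg (by positivity) (M.demand_nonneg e r hr)
  demand_strictAnti e _ ha _ hb hab :=
    mul_lt_mul_of_pos_left (M.demand_strictAnti e ha hb hab) (by exact_mod_cast θ.pos)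
  arrival e := θ * M.arrival e
  arrival_pos e := mul_pos (by exact_mod_cast θ.pos) (M.arrival_pos e)
  penalty := M.penalty
  penalty_nonneg := M.penalty_nonneg
  stay := M.stay
  stay_nonneg := M.stay_nonneg
  stay_sum := M.stay_sum
  cost := M.cost

/-! ### Dynamics -/

/-- The law of the next move of a carrier who has just delivered at node `i`. -/
noncomputable def moveLaw (i : N) : Measure (NextMove E) :=
  ∑ e : E with e.1.1 = i, ENNReal.ofReal (M.stay e) • Measure.dirac (NextMove.take e)
    + ENNReal.ofReal (1 - ∑ e : E with e.1.1 = i, M.stay e) • Measure.dirac NextMove.leave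

instance (i : N) : IsProbabilityMeasure (M.moveLaw i) := by
  constructor
  have h0 : 0 ≤ ∑ e : E with e.1.1 = i, M.stay e := Finset.sum_nonneg fun e _ => M.stay_nonneg e
  simp only [moveLaw, Measure.coe_add, Pi.add_apply, Measure.coe_finsetSum, Finset.sum_apply,
    Measure.smul_apply, measure_univ, smul_eq_mul, mul_one]
  rw [← ENNReal.ofReal_sum_of_nonneg (fun e _ => M.stay_nonneg e),
    ← ENNReal.ofReal_add h0 (sub_nonneg.2 (M.stay_sum i))]
  simp

/-- The law of the randomness of one period when the shipper prices are `r`: everything is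
independent, the numbers of new loads and of new carriers are Poisson. -/
noncomputable def noise (r : E → ℝ) : Measure (Noise E) :=
  (Measure.infinitePi fun e => Measure.infinitePi fun _ : ℕ => (M.cost e).law).prod
    ((Measure.infinitePi fun i => Measure.infinitePi fun _ : ℕ => M.moveLaw i).prod
      ((Measure.infinitePi fun e => poissonMeasure (M.demand e (r e)).toNNReal).prod
        (Measure.infinitePi fun e => poissonMeasure (M.arrival e).toNNReal)))

end Market

section Dynamics

variable {E : Finset (N × N)}

/-- The costs of the `x.1 e` carriers present on lane `e`. -/
def costVec (x : State E) (ω : Noise E) (e : E) : Fin (x.1 e) → ℝ := fun s => ω.1 e s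

/-- The number of loads transported on lane `e` (carriers bid their true costs). -/
def Policy.served (π : Policy E) (x : State E) (ω : Noise E) (e : E) : ℕ :=
  ((π.carrier e).alloc (x.1 e) (x.2 e) (costVec x ω e)).card

/-- The total payment to the carriers on lane `e`. -/
noncomputable def Policy.payment (π : Policy E) (x : State E) (ω : Noise E) (e : E) : ℝ :=
  ∑ s, (π.carrier e).pay (x.1 e) (x.2 e) (costVec x ω e) s

open Classical in
/-- The number of carriers who go on with lane `e` after a delivery at its origin. -/
noncomputable def Policy.staying (π : Policy E) (x : State E) (ω : Noise E) (e : E) : ℕ :=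
  ((Finset.range (∑ e' : E with e'.1.2 = e.1.1, π.served x ω e')).filter
    (fun m => ω.2.1 e.1.1 m = NextMove.take e)).card

/-- The state of the next period. -/
noncomputable def Policy.step (π : Policy E) (x : State E) (ω : Noise E) : State E :=
  (fun e => π.staying x ω e + ω.2.2.2 e, ω.2.2.1)

end Dynamics

namespace Market

variable {E : Finset (N × N)} (M : Market N E)

/-- The law of the state after `t` periods, under the policy `π` and from the state `x₀`: a Markov
chain that moves from `x` to `π.step x ω`, with `ω` fresh noise. -/
noncomputable def stateLaw (π : Policy E) (x₀ : State E) (t : ℕ) : Measure (State E) :=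
  Nat.rec (Measure.dirac x₀)
    (fun _ ν => (ν.prod (M.noise π.shipperPrice)).map fun z => π.step z.1 z.2) t

/-- The expected profit of one period that begins in the state `x`. -/
noncomputable def stageProfit (π : Policy E) (x : State E) : ℝ :=
  ∫ ω, ∑ e, (π.shipperPrice e * M.demand e (π.shipperPrice e)
    - M.penalty e * ((x.2 e : ℝ) - π.served x ω e) - π.payment x ω e) ∂M.noise π.shipperPrice

/-- `γ` is the long-run average profit per period of the policy `π`, from every initial state. -/
def IsLongRunProfit (π : Policy E) (γ : ℝ) : Prop :=
  ∀ x₀ : State E, Tendsto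
    (fun T : ℕ => (∑ t ∈ Finset.range T, ∫ x, M.stageProfit π x ∂M.stateLaw π x₀ t) / T)
    atTop (𝓝 γ)

/-! ### The fluid problem and the three mechanisms -/

end Market

/-- Variables of the fluid problem: demand rates, rates of transported loads, rates of available
carriers. -/
structure FluidPoint (E : Finset (N × N)) where
  d : E → ℝ
  y : E → ℝ
  lam : E → ℝ

namespace Market

variable {E : Finset (N × N)} (M : Market N E)

/-- Feasibility in the fluid problem; the last two conditions say that `d e` is in the domain of
the inverse demand function and `y e / lam e` in the domain of the inverse of `F`. -/
structure FluidFeasible (z : FluidPoint E) : Prop where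
  flow : ∀ e : E, ∑ e' : E with e'.1.2 = e.1.1, M.stay e * z.y e' + M.arrival e = z.lam e
  y_le_d : ∀ e, z.y e ≤ z.d e
  y_le_lam : ∀ e, z.y e ≤ z.lam e
  y_nonneg : ∀ e, 0 ≤ z.y e
  lam_nonneg : ∀ e, 0 ≤ z.lam e
  d_nonneg : ∀ e, 0 ≤ z.d e
  d_mem : ∀ e, z.d e ∈ M.demand e '' M.prices e
  x_mem : ∀ e, z.y e / z.lam e ∈ Set.range (M.cost e).F

/-- The objective of the fluid problem. -/
noncomputable def fluidObjective (z : FluidPoint E) : ℝ :=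
  ∑ e, (M.invDemand e (z.d e) * z.d e - (M.cost e).Finv (z.y e / z.lam e) * z.y e
    - M.penalty e * (z.d e - z.y e))

/-- Optimal solutions of the fluid problem. -/
def IsFluidOptimal (z : FluidPoint E) : Prop :=
  M.FluidFeasible z ∧ ∀ z', M.FluidFeasible z' → M.fluidObjective z' ≤ M.fluidObjective z

/-- The optimal value of the fluid problem. -/
noncomputable def fluidValue : ℝ := sSup (M.fluidObjective '' {z | M.FluidFeasible z})

/-- The shipper prices `r*` of a solution of the fluid problem. -/
noncomputable def shipperPrice (z : FluidPoint E) (e : E) : ℝ := M.invDemand e (z.d e)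

/-- The carrier prices `p*` of a solution of the fluid problem. -/
noncomputable def carrierPrice (z : FluidPoint E) (e : E) : ℝ :=
  (M.cost e).Finv (z.y e / z.lam e)

/-- The reserve prices `ξ* = max (ψ⁻¹ b) p*`. -/
noncomputable def reservePrice (z : FluidPoint E) (e : E) : ℝ :=
  max ((M.cost e).virtualCostInv (M.penalty e)) (M.carrierPrice z e)

/-- The static posted price mechanism SP. -/
noncomputable def SP (z : FluidPoint E) : Policy E where
  shipperPrice := M.shipperPrice z
  carrier e := spMechanism (M.carrierPrice z e)

/-- The auction mechanism AUC. -/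
noncomputable def AUC (z : FluidPoint E) : Policy E where
  shipperPrice := M.shipperPrice z
  carrier e := aucMechanism (M.reservePrice z e)

/-- The hybrid mechanism HYB. -/
noncomputable def HYB (z : FluidPoint E) : Policy E where
  shipperPrice := M.shipperPrice z
  carrier e := hybMechanism (M.carrierPrice z e) (M.reservePrice z e)

end Market

end Freight

set_option linter.unusedSectionVars false

/-! One lane in one period. By linear programming duality, any load price `τ ≤ ξ` bounds the value
of the assignment problem from below. Hence a winner of the auction is paid the threshold price `τ`
below which the carrier wins against the other bids (`IsThreshold.aucPay_eq`). Redrawing the cost of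
one carrier while the others stay fixed turns the expected payment, less `m` per load won, into `(τ
- m) * F τ`. Regularity of the costs makes the surplus `(m - τ) * F τ` increase as long as the
virtual cost is below `m` and decrease afterwards. Two facts follow. Raising the price from `p`
towards the reserve does not hurt a buyer with value `b` (`surplus_le_of_le_reserve`), so HYB earns
at least as much as SP in each state (`integral_sp_le_integral_hyb`). The expected payment has
supporting lines as a function of the acceptance probability (`exists_supporting_slope`), so the
auction pays at least a linear function of carriers and served loads (`le_integral_aucPay`).

Dynamics. New loads are independent of the past, so the numbers of carriers form a Markov chain,
with transition operator `push`. With positive probability a period has no loads, and the chain then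
forgets its state. Therefore iterates of `push` on a bounded function converge geometrically to a
constant (`exists_abs_iterate_push_sub_le`), and the long-run profit is such a limit. No stationary
law is constructed.

Comparisons. HYB and AUC serve the same number of loads, hence drive the same chain, and AUC pays
less. HYB serves at least as many loads as SP, hence has at least as many carriers later; more
carriers are good for SP when `p* ≤ b` on the lanes in use. A coupling with common noise gives `γSP
≤ γHYB`.

Asymptotics. The limiting averages of AUC form a feasible fluid point, whose objective is at least
`γAUC` by the supporting lines (`le_fluidObjective_of_tendsto`). For SP, the shortfall of served
loads below the fluid solution obeys a linear recursion. It contracts because every lane has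
exogenous arrivals, and its noise is of order `√θ` (`iterate_push_shortfall_le`). So SP loses at
most `K * √θ`, and HYB lies between SP and AUC. -/

namespace Freight
-- The distribution function of a cost, its inverse, and the surplus at a price.
namespace CostDistribution

variable (G : CostDistribution)

lemma density_nonneg (c : ℝ) : 0 ≤ G.density c := by
  by_cases h : c ∈ G.range
  · exact (G.density_pos c h).le
  · exact (G.density_zero c h).ge

lemma law_apply {s : Set ℝ} (hs : MeasurableSet s) :
    G.law s = ∫⁻ c in s, ENNReal.ofReal (G.density c) :=
  withDensity_apply _ hs

instance : NullSingletonClass G.law := by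
  constructor
  intro c
  rw [G.law_apply (measurableSet_singleton c)]
  exact setLIntegral_measure_zero _ _ (by simp)

lemma integrable_density : Integrable G.density := by
  refine ⟨G.measurable_density.aestronglyMeasurable, ?_⟩
  rw [hasFiniteIntegral_iff_ofReal (Eventually.of_forall G.density_nonneg), G.lintegral_density]
  simp

lemma law_real {s : Set ℝ} (hs : MeasurableSet s) : G.law.real s = ∫ c in s, G.density c := by
  rw [measureReal_def, G.law_apply hs,
    integral_eq_lintegral_of_nonneg_ae (Eventually.of_forall G.density_nonneg)
      G.measurable_density.aestronglyMeasurable]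

lemma F_eq (c : ℝ) : G.F c = G.law.real (Set.Iic c) := rfl

lemma F_nonneg (c : ℝ) : 0 ≤ G.F c := measureReal_nonneg

lemma F_le_one (c : ℝ) : G.F c ≤ 1 :=
  measureReal_le_one (μ := G.law)

lemma F_mono : Monotone G.F := fun _ _ h =>
  measureReal_mono (μ := G.law) (Set.Iic_subset_Iic.2 h)

lemma F_sub {u v : ℝ} (h : u ≤ v) : G.F v - G.F u = ∫ c in u..v, G.density c := by
  rw [intervalIntegral.integral_of_le h, ← G.law_real measurableSet_Ioc, F_eq, F_eq,
    ← Set.Iic_union_Ioc_eq_Iic h, measureReal_union (Set.Iic_disjoint_Ioc le_rfl) measurableSet_Ioc]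
  ring

lemma F_eq_add (u v : ℝ) : G.F v = G.F u + ∫ c in u..v, G.density c := by
  rcases le_total u v with h | h
  · rw [← G.F_sub h]; ring
  · rw [intervalIntegral.integral_symm, ← G.F_sub h]; ring

lemma F_continuous : Continuous G.F := by
  have h : G.F = fun v => G.F 0 + ∫ c in (0 : ℝ)..v, G.density c := funext fun v => G.F_eq_add 0 v
  rw [h]
  exact continuous_const.add
    (intervalIntegral.continuous_primitive (fun _ _ => G.integrable_density.intervalIntegrable) 0)

lemma law_compl_range : G.law G.rangeᶜ = 0 := by
  rw [G.law_apply G.isOpen_range.measurableSet.compl]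
  refine (setLIntegral_congr_fun G.isOpen_range.measurableSet.compl
    (fun c hc => ?_)).trans (lintegral_zero)
  simp [G.density_zero c hc]

lemma ae_mem_range : ∀ᵐ c ∂G.law, c ∈ G.range := G.law_compl_range

lemma ae_nonneg : ∀ᵐ c ∂G.law, 0 ≤ c := by
  filter_upwards [G.ae_mem_range] with c hc using G.range_nonneg hc

/-- Prices below all possible costs are never accepted. -/
lemma F_eq_zero_of_forall {c : ℝ} (h : ∀ r ∈ G.range, c ≤ r) : G.F c = 0 := by
  have h1 : G.law (Set.Iio c) = 0 := by
    refine measure_mono_null (t := G.rangeᶜ) (fun x hx hr => ?_) G.law_compl_range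
    exact absurd (h x hr) (not_le.2 hx)
  rw [F_eq, measureReal_def, ← Set.Iio_union_right, measure_union_null h1 (measure_singleton c)]
  simp

/-- Prices above all possible costs are always accepted. -/
lemma F_eq_one_of_forall {c : ℝ} (h : ∀ r ∈ G.range, r ≤ c) : G.F c = 1 := by
  have h1 : G.law (Set.Iic c)ᶜ = 0 :=
    measure_mono_null (fun x hx hr => hx (h x hr)) G.law_compl_range
  rw [F_eq, measureReal_def, (prob_compl_eq_zero_iff measurableSet_Iic).1 h1]
  simp

lemma F_eq_zero_of_nonpos {c : ℝ} (h : c ≤ 0) : G.F c = 0 :=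
  G.F_eq_zero_of_forall fun _ hr => h.trans (G.range_nonneg hr)

lemma tendsto_F_atTop : Tendsto G.F atTop (𝓝 1) := by
  have h := tendsto_measure_Iic_atTop G.law
  rw [measure_univ] at h
  exact (ENNReal.tendsto_toReal ENNReal.one_ne_top).comp h

lemma mem_range_F {x : ℝ} (h0 : 0 ≤ x) (h1 : x < 1) : x ∈ Set.range G.F := by
  obtain ⟨v, hv⟩ := (G.tendsto_F_atTop.eventually (lt_mem_nhds h1)).exists
  exact mem_range_of_exists_le_of_exists_ge G.F_continuous
    ⟨0, by rw [G.F_eq_zero_of_nonpos le_rfl]; exact h0⟩ ⟨v, hv.le⟩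

lemma isClosed_Finv_set (x : ℝ) : IsClosed {c | c ∈ closure G.range ∧ x ≤ G.F c} :=
  isClosed_closure.inter (isClosed_Ici.preimage G.F_continuous)

lemma closure_range_nonneg : closure G.range ⊆ Set.Ici 0 :=
  closure_minimal G.range_nonneg isClosed_Ici

lemma Finv_set_bddBelow (x : ℝ) : BddBelow {c | c ∈ closure G.range ∧ x ≤ G.F c} :=
  ⟨0, fun _ hc => G.closure_range_nonneg hc.1⟩

lemma Finv_set_nonempty {x : ℝ} (hx : x ∈ Set.range G.F) :
    {c | c ∈ closure G.range ∧ x ≤ G.F c}.Nonempty := by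
  obtain ⟨c, rfl⟩ := hx
  by_cases h : ∃ r ∈ G.range, c ≤ r
  · obtain ⟨r, hr, hcr⟩ := h
    exact ⟨r, subset_closure hr, G.F_mono hcr⟩
  · push Not at h
    have hb : BddAbove G.range := ⟨c, fun r hr => (h r hr).le⟩
    refine ⟨sSup G.range, csSup_mem_closure G.nonempty_range hb, ?_⟩
    rw [G.F_eq_one_of_forall fun r hr => le_csSup hb hr]
    exact G.F_le_one c

lemma Finv_mem {x : ℝ} (hx : x ∈ Set.range G.F) :
    G.Finv x ∈ closure G.range ∧ x ≤ G.F (G.Finv x) :=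
  (G.isClosed_Finv_set x).csInf_mem (G.Finv_set_nonempty hx) (G.Finv_set_bddBelow x)

lemma Finv_nonneg (x : ℝ) : 0 ≤ G.Finv x :=
  Real.sInf_nonneg fun _ hc => G.closure_range_nonneg hc.1

lemma F_Finv {x : ℝ} (hx : x ∈ Set.range G.F) : G.F (G.Finv x) = x := by
  refine le_antisymm ?_ (G.Finv_mem hx).2
  obtain ⟨c, rfl⟩ := hx
  rcases le_or_gt (G.Finv (G.F c)) c with h | h
  · exact G.F_mono h
  -- The infimum exceeds `c` only across a gap: a point of `G.range` in between would belong to the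
  -- set defining `Finv`. So `F` is constant there.
  · have h2 : ∫ t in c..G.Finv (G.F c), G.density t = 0 := by
      rw [intervalIntegral.integral_of_le h.le, ← integral_Ico_eq_integral_Ioc]
      refine setIntegral_eq_zero_of_forall_eq_zero fun t ht => ?_
      refine G.density_zero t fun htr => ?_
      exact absurd (csInf_le (G.Finv_set_bddBelow _) ⟨subset_closure htr, G.F_mono ht.1⟩)
        (not_le.2 ht.2)
    rw [G.F_eq_add c, h2, add_zero]

/-! ### Monopsony prices -/

/-- The density is merely measurable, so `F` is differentiable only almost everywhere; absolute
continuity is what justifies integration by parts in `surplus_sub`. -/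
lemma F_absolutelyContinuous (u v : ℝ) : AbsolutelyContinuousOnInterval G.F u v := by
  have h : G.F = (fun _ => G.F u) + fun v => ∫ c in u..v, G.density c :=
    funext fun v => G.F_eq_add u v
  rw [h]
  refine AbsolutelyContinuousOnInterval.add ?_
    (G.integrable_density.intervalIntegrable.absolutelyContinuousOnInterval_intervalIntegral
      (by simp))
  exact contDiff_const.contDiffOn.absolutelyContinuousOnInterval

lemma ae_deriv_F (u v : ℝ) : ∀ᵐ c, c ∈ Set.uIcc u v → deriv G.F c = G.density c := by
  have h : G.F = fun v => G.F u + ∫ c in u..v, G.density c := funext fun v => G.F_eq_add u v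
  have h2 := (G.integrable_density.intervalIntegrable (a := u) (b := v)).ae_hasDerivAt_integral
  filter_upwards [h2] with c hc hcu
  rw [h]
  exact ((hc hcu u (by simp)).const_add (G.F u)).deriv

/-- The integrand is the almost everywhere derivative of `(m - c) * F c`. On `G.range` its sign is
that of `m - ψ c`, which is how the monotone virtual cost controls the surplus. -/
lemma surplus_sub (m u v : ℝ) :
    (m - v) * G.F v - (m - u) * G.F u = ∫ c in u..v, ((m - c) * G.density c - G.F c) := by
  have h1 : AbsolutelyContinuousOnInterval (fun c : ℝ => m - c) u v :=
    (contDiff_const.sub contDiff_id).contDiffOn.absolutelyContinuousOnInterval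
  rw [← h1.integral_deriv_mul_eq_sub (G.F_absolutelyContinuous u v)]
  refine intervalIntegral.integral_congr_ae ?_
  filter_upwards [G.ae_deriv_F u v] with c hc hcu
  rw [hc (Set.uIoc_subset_uIcc hcu)]
  have : deriv (fun c : ℝ => m - c) c = -1 := by
    rw [deriv_const_sub]; simp
  rw [this]; ring

lemma surplus_le {m u v : ℝ} (huv : u ≤ v)
    (h : ∀ c ∈ Set.Ioo u v, G.F c ≤ (m - c) * G.density c) :
    (m - u) * G.F u ≤ (m - v) * G.F v := by
  rw [← sub_nonneg, G.surplus_sub, intervalIntegral.integral_of_le huv,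
    integral_Ioc_eq_integral_Ioo]
  exact setIntegral_nonneg measurableSet_Ioo fun c hc => sub_nonneg.2 (h c hc)

lemma surplus_ge {m u v : ℝ} (huv : u ≤ v)
    (h : ∀ c ∈ Set.Ioo u v, (m - c) * G.density c ≤ G.F c) :
    (m - v) * G.F v ≤ (m - u) * G.F u := by
  rw [← sub_nonpos, G.surplus_sub, intervalIntegral.integral_of_le huv,
    integral_Ioc_eq_integral_Ioo]
  exact setIntegral_nonpos measurableSet_Ioo fun c hc => sub_nonpos.2 (h c hc)

lemma virtualCost_le_iff {c m : ℝ} (hc : c ∈ G.range) :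
    G.virtualCost c ≤ m ↔ G.F c ≤ (m - c) * G.density c := by
  rw [virtualCost, ← le_sub_iff_add_le', div_le_iff₀ (G.density_pos c hc)]

lemma le_virtualCost_iff {c m : ℝ} (hc : c ∈ G.range) :
    m ≤ G.virtualCost c ↔ (m - c) * G.density c ≤ G.F c := by
  rw [virtualCost, ← sub_le_iff_le_add', le_div_iff₀ (G.density_pos c hc)]

lemma le_virtualCost {c : ℝ} (hc : c ∈ G.range) : c ≤ G.virtualCost c :=
  le_add_of_nonneg_right (div_nonneg (G.F_nonneg c) (G.density_pos c hc).le)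

lemma virtualCost_strictMonoOn : StrictMonoOn G.virtualCost G.range := G.regular

/-- Below a cost `c'` whose virtual cost is at most `m`, the surplus `(m - u) * F u` increases. -/
lemma F_le_of_lt {m c c' : ℝ} (hc' : c' ∈ G.range) (hm : G.virtualCost c' ≤ m) (h : c < c') :
    G.F c ≤ (m - c) * G.density c := by
  by_cases hc : c ∈ G.range
  · exact (G.virtualCost_le_iff hc).1 ((G.virtualCost_strictMonoOn hc hc' h).le.trans hm)
  · rw [G.density_zero c hc, mul_zero, G.F_eq_zero_of_forall fun r hr => ?_]
    by_contra! hlt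
    exact hc (G.ordConnected_range.out hr hc' ⟨hlt.le, h.le⟩)

/-- Raising the price up to the reserve price `max (ψ⁻¹ b) p` does not reduce the expected
surplus. -/
lemma surplus_le_of_le_reserve {b p τ : ℝ} (hpτ : p ≤ τ)
    (hτ : τ ≤ max (G.virtualCostInv b) p) : (b - p) * G.F p ≤ (b - τ) * G.F τ := by
  rcases hpτ.eq_or_lt with rfl | hlt
  · rfl
  have hτ' : τ ≤ G.virtualCostInv b := (le_max_iff.1 hτ).resolve_right (not_le.2 hlt)
  rcases Set.eq_empty_or_nonempty {c | c ∈ G.range ∧ G.virtualCost c ≤ b} with he | hne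
  -- Here `virtualCostInv b` is the default `0`, so neither price is ever accepted.
  · rw [virtualCostInv, he, Real.sSup_empty] at hτ'
    rw [G.F_eq_zero_of_nonpos hτ', G.F_eq_zero_of_nonpos (hpτ.trans hτ')]
    simp
  · refine G.surplus_le hpτ fun c hc => ?_
    obtain ⟨c', hc', hcc⟩ := exists_lt_of_lt_csSup hne (hc.2.trans_le hτ')
    exact G.F_le_of_lt hc'.1 hc'.2 hcc

/-- The expected payment `p * F p`, as a function of the acceptance probability `F p`, has a
supporting line with slope `m` at each acceptance probability `x < 1`. -/
lemma exists_supporting_slope {x : ℝ} (h0 : 0 ≤ x) (h1 : x < 1) :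
    ∃ m : ℝ, (G.Finv x - m) * x ≤ 0 ∧ ∀ τ, (G.Finv x - m) * x ≤ (τ - m) * G.F τ := by
  have hx := G.mem_range_F h0 h1
  have hF := G.F_Finv hx
  rcases h0.eq_or_lt with rfl | hpos
  -- At acceptance probability `0` the price may be an endpoint outside `G.range`, where the virtual
  -- cost is of no use; slope `0` works because payments are non-negative.
  · refine ⟨0, by simp, fun τ => ?_⟩
    rw [mul_zero, sub_zero]
    rcases le_total τ 0 with h | h
    · rw [G.F_eq_zero_of_nonpos h, mul_zero]
    · exact mul_nonneg h (G.F_nonneg τ)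
  set p := G.Finv x with hp
  have hpr : p ∈ G.range := by
    have hl : ∃ r ∈ G.range, r ≤ p := by
      by_contra! hcon
      rw [G.F_eq_zero_of_forall fun r hr => (hcon r hr).le] at hF
      exact hpos.ne hF
    have hu : ∃ r ∈ G.range, p ≤ r := by
      by_contra! hcon
      rw [G.F_eq_one_of_forall fun r hr => (hcon r hr).le] at hF
      exact h1.ne hF.symm
    obtain ⟨r, hr, hrp⟩ := hl
    obtain ⟨r', hr', hpr'⟩ := hu
    exact G.ordConnected_range.out hr hr' ⟨hrp, hpr'⟩
  -- The virtual cost is the derivative of `p * F p` with respect to `F p`. With this `m` the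
  -- surplus `(m - τ) * F τ` rises up to `τ = p` and falls afterwards.
  refine ⟨G.virtualCost p, mul_nonpos_of_nonpos_of_nonneg
    (sub_nonpos.2 (G.le_virtualCost hpr)) h0, fun τ => ?_⟩
  have key : (G.virtualCost p - τ) * G.F τ ≤ (G.virtualCost p - p) * G.F p := by
    rcases le_total τ p with h | h
    · exact G.surplus_le h fun c hc => G.F_le_of_lt hpr le_rfl hc.2
    · refine G.surplus_ge h fun c hc => ?_
      by_cases hcr : c ∈ G.range
      · exact (G.le_virtualCost_iff hcr).1 (G.virtualCost_strictMonoOn hpr hcr hc.1).le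
      · rw [G.density_zero c hcr, mul_zero]
        exact G.F_nonneg c
  rw [hF] at key
  linarith

end CostDistribution
end Freight

/-! ### Allocations and payments on one lane for fixed bids. -/

namespace Freight

/-! ### Ranks -/

/-- Adding an element with the largest key leaves the other ranks unchanged, and its own rank is the
number of the others. -/
lemma card_filter_rank_lt {ι α : Type*} [LinearOrder α] [DecidableEq ι] {f : ι → α}
    (hf : Function.Injective f) (A : Finset ι) (D : ℕ) :
    (A.filter fun s => (A.filter fun s' => f s' < f s).card < D).card = min D A.card := by
  induction A using Finset.induction_on_max_value f with
  | empty => simp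
  | insert a A ha hmax ih =>
    have hlt : ∀ s ∈ A, f s < f a := fun s hs =>
      lt_of_le_of_ne (hmax s hs) fun h => ha (hf h ▸ hs)
    have h1 : ((insert a A).filter fun s' => f s' < f a) = A := by
      ext s
      simp only [Finset.mem_filter, Finset.mem_insert]
      constructor
      · rintro ⟨rfl | h, h'⟩
        · exact absurd h' (lt_irrefl _)
        · exact h
      · exact fun h => ⟨Or.inr h, hlt s h⟩
    have h2 : ∀ s ∈ A, ((insert a A).filter fun s' => f s' < f s) =
        A.filter fun s' => f s' < f s := by
      intro s hs
      rw [Finset.filter_insert, if_neg (not_lt.2 (hlt s hs).le)]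
    rw [Finset.filter_insert, h1, Finset.filter_congr fun s hs => by rw [h2 s hs],
      Finset.card_insert_of_notMem ha]
    split_ifs with h
    · rw [Finset.card_insert_of_notMem (by simp [ha]), ih]; omega
    · rw [ih]; omega

/-! ### Allocations -/

section Allocation

variable {n : ℕ} {D : ℕ} {p ξ : ℝ} {c : Fin n → ℝ} {s : Fin n}

lemma mem_accepting : s ∈ accepting p c ↔ c s ≤ p := by simp [accepting]

lemma accepting_mono {q : ℝ} (h : p ≤ q) (c : Fin n → ℝ) : accepting p c ⊆ accepting q c :=
  fun _ hs => mem_accepting.2 ((mem_accepting.1 hs).trans h)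

lemma card_accepting (p : ℝ) (c : Fin n → ℝ) :
    (accepting p c).card = ∑ s, if c s ≤ p then 1 else 0 := by
  rw [accepting, Finset.card_filter]

lemma card_spAlloc (p : ℝ) (D : ℕ) (c : Fin n → ℝ) :
    (spAlloc p D c).card = min D (accepting p c).card := by
  rw [← card_filter_rank_lt Function.injective_id (accepting p c) D]
  congr 1
  ext s
  rw [Finset.mem_filter, mem_accepting]
  simp only [spAlloc, Finset.mem_filter, Finset.mem_univ, true_and, id]

/-- The bids that are served before the bid of carrier `s` in the auction. -/
noncomputable def lowerBids (c : Fin n → ℝ) (s : Fin n) : Finset (Fin n) :=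
  Finset.univ.filter (fun s' => c s' < c s ∨ (c s' = c s ∧ s' < s))

lemma mem_lowerBids {s' : Fin n} :
    s' ∈ lowerBids c s ↔ c s' < c s ∨ (c s' = c s ∧ s' < s) := by simp [lowerBids]

lemma le_of_mem_lowerBids {s' : Fin n} (h : s' ∈ lowerBids c s) : c s' ≤ c s := by
  rcases mem_lowerBids.1 h with h | h
  exacts [h.le, h.1.le]

lemma notMem_lowerBids_self : s ∉ lowerBids c s := by simp [mem_lowerBids]

lemma mem_aucAlloc : s ∈ aucAlloc ξ D c ↔ c s ≤ ξ ∧ (lowerBids c s).card < D := by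
  simp [aucAlloc, lowerBids]

lemma lowerBids_subset {s' : Fin n} (h : c s' < c s) : lowerBids c s' ⊆ lowerBids c s :=
  fun _ ht => mem_lowerBids.2 (Or.inl ((le_of_mem_lowerBids ht).trans_lt h))

/-- The order of service is lexicographic in bid and index. Every bid served before an admissible
bid is admissible, so ranks among all bids and among the admissible ones agree. -/
lemma card_aucAlloc (ξ : ℝ) (D : ℕ) (c : Fin n → ℝ) :
    (aucAlloc ξ D c).card = min D (accepting ξ c).card := by
  have hinj : Function.Injective fun s : Fin n => toLex (c s, s) := fun a b h => by
    simpa using congrArg (fun z => (ofLex z).2) h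
  rw [← card_filter_rank_lt hinj (accepting ξ c) D]
  congr 1
  ext s
  rw [mem_aucAlloc, Finset.mem_filter, mem_accepting]
  refine and_congr_right fun hs => ?_
  rw [show lowerBids c s = (accepting ξ c).filter fun s' => toLex (c s', s') < toLex (c s, s) from ?_]
  ext s'
  rw [Finset.mem_filter, mem_accepting, Prod.Lex.toLex_lt_toLex, ← mem_lowerBids]
  exact ⟨fun h => ⟨(le_of_mem_lowerBids h).trans hs, h⟩, fun h => h.2⟩

lemma aucAlloc_subset_accepting : aucAlloc ξ D c ⊆ accepting ξ c :=
  fun _ hs => mem_accepting.2 (mem_aucAlloc.1 hs).1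

lemma card_aucAlloc_le : (aucAlloc ξ D c).card ≤ D := by
  rw [card_aucAlloc]; exact min_le_left _ _

lemma aucAlloc_eq_accepting (h : (aucAlloc ξ D c).card < D) : aucAlloc ξ D c = accepting ξ c := by
  refine Finset.eq_of_subset_of_card_le aucAlloc_subset_accepting ?_
  rw [card_aucAlloc] at h ⊢
  omega

/-- When more than `D` carriers accept `p`, posted price and auction both serve all `D` loads. So
HYB always serves as many loads as AUC, if not the same carriers. -/
lemma card_hybAlloc (h : p ≤ ξ) (D : ℕ) (c : Fin n → ℝ) :
    ((hybMechanism p ξ).alloc n D c).card = min D (accepting ξ c).card := by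
  have h1 := Finset.card_le_card (accepting_mono h c)
  simp only [hybMechanism]
  split_ifs with h2
  · rw [card_spAlloc]; omega
  · exact card_aucAlloc ξ D c

lemma card_filter_sum_pay (p : ℝ) (D : ℕ) (c : Fin n → ℝ) :
    (∑ s, if s ∈ spAlloc p D c then p else 0) = p * (spAlloc p D c).card := by
  rw [← Finset.sum_filter, Finset.sum_const, nsmul_eq_mul, mul_comm]
  simp

end Allocation

/-! ### The assignment problem -/

section Assignment

variable {n : ℕ} {D : ℕ} {ξ : ℝ} {c : Fin n → ℝ} {s : Fin n}

/-- `τ` is the dual variable of the constraint that all loads are covered, `τ ≤ ξ` is dual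
feasibility for `y0`, and `max (τ - c s) 0` is the rent of carrier `s`. -/
lemma weak_duality {τ y0 : ℝ} (hτ : τ ≤ ξ) {T : Finset (Fin n)} {a : Fin n → ℝ}
    (ha : ∀ s ∈ T, 0 ≤ a s ∧ a s ≤ 1) (hy : 0 ≤ y0) (hsum : ∑ s ∈ T, a s + y0 = D) :
    τ * D - ∑ s ∈ T, max (τ - c s) 0 ≤ ∑ s ∈ T, c s * a s + ξ * y0 := by
  have h1 : ∑ s ∈ T, (τ - c s) * a s ≤ ∑ s ∈ T, max (τ - c s) 0 :=
    Finset.sum_le_sum fun s hs => by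
      have := ha s hs
      rcases le_total (τ - c s) 0 with h | h
      · exact (mul_nonpos_of_nonpos_of_nonneg h this.1).trans (le_max_right _ _)
      · exact (mul_le_of_le_one_right h this.2).trans (le_max_left _ _)
  have h2 : ∑ s ∈ T, (τ - c s) * a s = τ * ∑ s ∈ T, a s - ∑ s ∈ T, c s * a s := by
    rw [Finset.mul_sum, ← Finset.sum_sub_distrib]
    exact Finset.sum_congr rfl fun s _ => by ring
  have h3 : τ * y0 ≤ ξ * y0 := mul_le_mul_of_nonneg_right hτ hy
  have h4 : τ * ∑ s ∈ T, a s + τ * y0 = τ * D := by rw [← mul_add, hsum]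
  linarith

lemma assignment_bddBelow (ξ : ℝ) (D : ℕ) (c : Fin n → ℝ) (T : Finset (Fin n)) :
    BddBelow {v | ∃ (a : Fin n → ℝ) (y0 : ℝ), (∀ s ∈ T, 0 ≤ a s ∧ a s ≤ 1) ∧ 0 ≤ y0 ∧
      ∑ s ∈ T, a s + y0 = D ∧ v = ∑ s ∈ T, c s * a s + ξ * y0} := by
  refine ⟨ξ * D - ∑ s ∈ T, max (ξ - c s) 0, ?_⟩
  rintro v ⟨a, y0, ha, hy, hsum, rfl⟩
  exact weak_duality le_rfl ha hy hsum

lemma le_assignmentValue {τ : ℝ} (hτ : τ ≤ ξ) (T : Finset (Fin n)) :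
    τ * D - ∑ s ∈ T, max (τ - c s) 0 ≤ assignmentValue ξ D c T := by
  refine le_csInf ⟨ξ * D, 0, D, by simp, by simp, by simp, by simp⟩ ?_
  rintro v ⟨a, y0, ha, hy, hsum, rfl⟩
  exact weak_duality hτ ha hy hsum

lemma assignmentValue_le {T W : Finset (Fin n)} (hW : W ⊆ T) (hD : W.card ≤ D) :
    assignmentValue ξ D c T ≤ ∑ s ∈ W, c s + ξ * (D - W.card) := by
  refine csInf_le (assignment_bddBelow ξ D c T)
    ⟨fun s => if s ∈ W then 1 else 0, D - W.card, fun s _ => ?_, ?_, ?_, ?_⟩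
  · dsimp only
    split_ifs <;> simp
  · exact sub_nonneg.2 (by exact_mod_cast hD)
  · rw [Finset.sum_ite_mem, Finset.inter_eq_right.2 hW]; simp
  · simp only [mul_ite, mul_one, mul_zero]
    rw [Finset.sum_ite_mem, Finset.inter_eq_right.2 hW]

lemma sum_max_eq {τ : ℝ} {T W : Finset (Fin n)} (hWT : W ⊆ T) (hW : ∀ s ∈ W, c s ≤ τ)
    (hT : ∀ s ∈ T, s ∉ W → τ ≤ c s) :
    ∑ s ∈ T, max (τ - c s) 0 = τ * W.card - ∑ s ∈ W, c s := by
  rw [← Finset.sum_subset hWT fun s hs hsW => max_eq_right (sub_nonpos.2 (hT s hs hsW)),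
    Finset.sum_congr rfl fun s hs => max_eq_left (sub_nonneg.2 (hW s hs)), Finset.sum_sub_distrib]
  simp [mul_comm]

/-- The matching dual price is `ξ` if loads are left over, and the highest winning bid if all loads
are served. With `D = 0` there is no winning bid, and the program has only the zero solution. -/
lemma assignmentValue_univ :
    assignmentValue ξ D c Finset.univ =
      ∑ s ∈ aucAlloc ξ D c, c s + ξ * (D - (aucAlloc ξ D c).card) := by
  refine le_antisymm (assignmentValue_le (Finset.subset_univ _) card_aucAlloc_le) ?_
  set W := aucAlloc ξ D c with hWdef
  rcases (card_aucAlloc_le (ξ := ξ) (D := D) (c := c)).lt_or_eq with hlt | heq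
  · have hW := aucAlloc_eq_accepting hlt
    refine le_trans (le_of_eq ?_) (le_assignmentValue le_rfl _)
    rw [sum_max_eq (Finset.subset_univ W) (fun s hs => (mem_aucAlloc.1 hs).1) fun s _ hs => ?_]
    · ring
    · rw [hWdef, hW, mem_accepting] at hs
      exact (not_le.1 hs).le
  · rw [← hWdef] at heq
    rcases W.eq_empty_or_nonempty with hE | hne
    · have hD : D = 0 := by rw [← heq, hE, Finset.card_empty]
      rw [hE, hD]
      refine le_csInf ⟨0, 0, 0, by simp, le_rfl, by simp, by simp⟩ ?_
      rintro v ⟨a, y0, ha, hy, hsum, rfl⟩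
      have h0 : 0 ≤ ∑ s, a s := Finset.sum_nonneg fun s hs => (ha s hs).1
      have hy0 : y0 = 0 := by push_cast at hsum; linarith
      have hs0 : ∑ s, a s = 0 := by push_cast at hsum; linarith
      have hz := (Finset.sum_eq_zero_iff_of_nonneg fun s hs => (ha s hs).1).1 hs0
      rw [hy0, Finset.sum_eq_zero (s := Finset.univ) fun s hs => by rw [hz s hs, mul_zero]]
      simp
    · obtain ⟨w, hw, hmax⟩ := Finset.exists_max_image W c hne
      have hwξ := (mem_aucAlloc.1 hw).1
      refine le_trans (le_of_eq ?_) (le_assignmentValue hwξ _)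
      rw [sum_max_eq (Finset.subset_univ W) hmax fun s _ hs => ?_, heq]
      · ring
      · by_contra! hlt
        refine hs (mem_aucAlloc.2 ⟨hlt.le.trans hwξ, ?_⟩)
        exact (Finset.card_le_card (lowerBids_subset hlt)).trans_lt (mem_aucAlloc.1 hw).2

lemma assignmentValue_univ_le_erase (s : Fin n) :
    assignmentValue ξ D c Finset.univ ≤ assignmentValue ξ D c (Finset.univ.erase s) := by
  refine le_csInf ⟨ξ * D, 0, D, by simp, by simp, by simp, by simp⟩ ?_
  rintro v ⟨a, y0, ha, hy, hsum, rfl⟩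
  refine csInf_le (assignment_bddBelow ξ D c _)
    ⟨Function.update a s 0, y0, fun t _ => ?_, hy, ?_, ?_⟩
  · by_cases hts : t = s
    · subst hts; simp
    · rw [Function.update_of_ne hts]; exact ha t (by simp [hts])
  · rw [← Finset.add_sum_erase _ _ (Finset.mem_univ s), Function.update_self, zero_add,
      Finset.sum_congr rfl fun t ht => Function.update_of_ne (Finset.ne_of_mem_erase ht) _ _, hsum]
  · rw [← Finset.add_sum_erase Finset.univ _ (Finset.mem_univ s), Function.update_self, mul_zero,
      zero_add]
    congr 1
    exact Finset.sum_congr rfl fun t ht => by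
      rw [Function.update_of_ne (Finset.ne_of_mem_erase ht)]

/-- The feasible set does not depend on the bids, so the value is an infimum of continuous functions
of the bids, hence upper semicontinuous. -/
lemma measurable_assignmentValue (ξ : ℝ) (D : ℕ) (T : Finset (Fin n)) :
    Measurable fun c : Fin n → ℝ => assignmentValue ξ D c T := by
  let Q := {q : (Fin n → ℝ) × ℝ // (∀ s ∈ T, 0 ≤ q.1 s ∧ q.1 s ≤ 1) ∧ 0 ≤ q.2 ∧
    ∑ s ∈ T, q.1 s + q.2 = D}
  have h : (fun c : Fin n → ℝ => assignmentValue ξ D c T) =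
      fun c => ⨅ q : Q, (∑ s ∈ T, c s * q.1.1 s + ξ * q.1.2) := by
    funext c
    rw [assignmentValue, iInf]
    congr 1
    ext v
    constructor
    · rintro ⟨a, y0, h1, h2, h3, rfl⟩
      exact ⟨⟨(a, y0), h1, h2, h3⟩, rfl⟩
    · rintro ⟨⟨⟨a, y0⟩, h1, h2, h3⟩, rfl⟩
      exact ⟨a, y0, h1, h2, h3, rfl⟩
  rw [h]
  refine UpperSemicontinuous.measurable (upperSemicontinuous_ciInf (fun c => ?_) fun q => ?_)
  · refine (assignment_bddBelow ξ D c T).mono ?_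
    rintro _ ⟨⟨⟨a, y0⟩, h1, h2, h3⟩, rfl⟩
    exact ⟨a, y0, h1, h2, h3, rfl⟩
  · exact Continuous.upperSemicontinuous (by fun_prop)

end Assignment

/-! ### Payments of the auction -/

section Payments

variable {n : ℕ} {D : ℕ} {p ξ : ℝ} {c : Fin n → ℝ} {s : Fin n}

/-- The winning set remains available without a loser, so removing a loser does not change the
optimal value. -/
lemma aucPay_eq_zero (hs : s ∉ aucAlloc ξ D c) : aucPay ξ D c s = 0 := by
  rw [aucPay, if_neg hs, zero_add, sub_eq_zero]
  refine le_antisymm ?_ (assignmentValue_univ_le_erase s)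
  rw [assignmentValue_univ]
  exact assignmentValue_le (fun t ht => Finset.mem_erase.2 ⟨fun h => hs (h ▸ ht), Finset.mem_univ t⟩)
    card_aucAlloc_le

lemma aucPay_nonneg (hs : 0 ≤ c s) : 0 ≤ aucPay ξ D c s := by
  by_cases h : s ∈ aucAlloc ξ D c
  · have := assignmentValue_univ_le_erase (ξ := ξ) (D := D) (c := c) s
    rw [aucPay, if_pos h]
    linarith
  · exact (aucPay_eq_zero h).ge

lemma aucPay_of_mem (hs : s ∈ aucAlloc ξ D c) :
    aucPay ξ D c s = assignmentValue ξ D c (Finset.univ.erase s)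
      - ∑ t ∈ (aucAlloc ξ D c).erase s, c t - ξ * (D - (aucAlloc ξ D c).card) := by
  rw [aucPay, if_pos hs, assignmentValue_univ, ← Finset.add_sum_erase _ _ hs]
  ring

lemma card_erase_aucAlloc (hs : s ∈ aucAlloc ξ D c) :
    (((aucAlloc ξ D c).erase s).card : ℝ) = (aucAlloc ξ D c).card - 1 := by
  rw [Finset.cast_card_erase_of_mem hs]

lemma aucPay_le_reserve (hs : s ∈ aucAlloc ξ D c) : aucPay ξ D c s ≤ ξ := by
  have h := assignmentValue_le (ξ := ξ) (D := D) (c := c) (T := Finset.univ.erase s)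
    (W := (aucAlloc ξ D c).erase s) (Finset.erase_subset_erase s (Finset.subset_univ _))
    ((Finset.card_erase_le).trans card_aucAlloc_le)
  rw [card_erase_aucAlloc hs] at h
  rw [aucPay_of_mem hs]
  linarith

/-- A winner is paid at most the bid of any loser. -/
lemma aucPay_le_of_notMem {r : Fin n} (hs : s ∈ aucAlloc ξ D c) (hr : r ∉ aucAlloc ξ D c) :
    aucPay ξ D c s ≤ c r := by
  have hrs : r ≠ s := fun h => hr (h ▸ hs)
  have hr' : r ∉ (aucAlloc ξ D c).erase s := fun h => hr (Finset.mem_of_mem_erase h)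
  have hcard : (insert r ((aucAlloc ξ D c).erase s)).card = (aucAlloc ξ D c).card := by
    rw [Finset.card_insert_of_notMem hr', Finset.card_erase_add_one hs]
  -- Without `s`, the loser `r` can take over the load of `s`.
  have h := assignmentValue_le (ξ := ξ) (D := D) (c := c) (T := Finset.univ.erase s)
    (W := insert r ((aucAlloc ξ D c).erase s))
    (Finset.insert_subset (by simp [hrs])
      (Finset.erase_subset_erase s (Finset.subset_univ _)))
    (hcard.trans_le card_aucAlloc_le)
  rw [hcard, Finset.sum_insert hr'] at h
  rw [aucPay_of_mem hs]
  linarith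

lemma aucPay_le : aucPay ξ D c s ≤ if s ∈ aucAlloc ξ D c then ξ else 0 := by
  split_ifs with h
  · exact aucPay_le_reserve h
  · exact (aucPay_eq_zero h).le

lemma measurableSet_lowerBids_lt (s : Fin n) (D : ℕ) :
    MeasurableSet {c : Fin n → ℝ | (lowerBids c s).card < D} := by
  have h : Measurable fun c : Fin n → ℝ => (lowerBids c s).card := by
    simp only [lowerBids, Finset.card_filter]
    refine Finset.measurable_sum _ fun t _ => Measurable.ite ?_ measurable_const measurable_const
    exact (measurableSet_lt (measurable_pi_apply t) (measurable_pi_apply s)).union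
      ((measurableSet_eq_fun (measurable_pi_apply t) (measurable_pi_apply s)).inter
        (MeasurableSet.const _))
  exact h measurableSet_Iio

lemma measurableSet_mem_aucAlloc (ξ : ℝ) (D : ℕ) (s : Fin n) :
    MeasurableSet {c : Fin n → ℝ | s ∈ aucAlloc ξ D c} := by
  simp only [mem_aucAlloc]
  exact (measurableSet_le (measurable_pi_apply s) measurable_const).inter
    (measurableSet_lowerBids_lt s D)

lemma measurable_aucPay (ξ : ℝ) (D : ℕ) (s : Fin n) :
    Measurable fun c : Fin n → ℝ => aucPay ξ D c s :=
  ((Measurable.ite (measurableSet_mem_aucAlloc ξ D s) (measurable_pi_apply s)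
    measurable_const).add (measurable_assignmentValue ξ D _)).sub (measurable_assignmentValue ξ D _)

lemma measurable_card_accepting (p : ℝ) :
    Measurable fun c : Fin n → ℝ => (accepting p c).card := by
  simp only [card_accepting]
  exact Finset.measurable_sum _ fun t _ =>
    Measurable.ite (measurableSet_le (measurable_pi_apply t) measurable_const)
      measurable_const measurable_const

lemma measurableSet_mem_spAlloc (p : ℝ) (D : ℕ) (s : Fin n) :
    MeasurableSet {c : Fin n → ℝ | s ∈ spAlloc p D c} := by
  have h : Measurable fun c : Fin n → ℝ => ((accepting p c).filter fun s' => s' < s).card := by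
    simp only [accepting, Finset.filter_filter, Finset.card_filter]
    exact Finset.measurable_sum _ fun t _ => Measurable.ite
      ((measurableSet_le (measurable_pi_apply t) measurable_const).inter (MeasurableSet.const _))
      measurable_const measurable_const
  simp only [spAlloc, Finset.mem_filter, Finset.mem_univ, true_and]
  exact (measurableSet_le (measurable_pi_apply s) measurable_const).inter (h measurableSet_Iio)

/-! ### Threshold prices -/

/-- `τ` is the price below which carrier `s` wins in the auction, given the bids of the others. -/
structure IsThreshold (ξ : ℝ) (D : ℕ) (c : Fin n → ℝ) (s : Fin n) (τ : ℝ) : Prop where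
  le_reserve : τ ≤ ξ
  card_lt : ∀ v < τ, ((accepting v c).erase s).card < D
  le_card : τ < ξ → D ≤ ((accepting τ c).erase s).card

lemma erase_accepting_update (v u : ℝ) :
    (accepting v (Function.update c s u)).erase s = (accepting v c).erase s := by
  ext t
  simp only [Finset.mem_erase, mem_accepting]
  refine and_congr_right fun h => ?_
  rw [Function.update_of_ne h]

lemma IsThreshold.update {τ : ℝ} (h : IsThreshold ξ D c s τ) (u : ℝ) :
    IsThreshold ξ D (Function.update c s u) s τ :=
  ⟨h.le_reserve, fun v hv => by rw [erase_accepting_update]; exact h.card_lt v hv,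
    fun hv => by rw [erase_accepting_update]; exact h.le_card hv⟩

/-- The threshold is the lowest bid below `ξ` that at least `D` carriers other than `s` do not
exceed, or `ξ` if there is none. If `D` others bid at most some smaller `v`, the highest bid among
those would have qualified already. -/
lemma exists_isThreshold (ξ : ℝ) (hD : 0 < D) (c : Fin n → ℝ) (s : Fin n) :
    ∃ τ, IsThreshold ξ D c s τ := by
  by_cases hex : ∃ r, c r < ξ ∧ D ≤ ((accepting (c r) c).erase s).card
  · obtain ⟨r, hr, hmin⟩ := Finset.exists_min_image
      (Finset.univ.filter fun r => c r < ξ ∧ D ≤ ((accepting (c r) c).erase s).card) c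
      (by obtain ⟨r, hr⟩ := hex; exact ⟨r, by simpa using hr⟩)
    simp only [Finset.mem_filter, Finset.mem_univ, true_and] at hr hmin
    refine ⟨c r, hr.1.le, fun v hv => ?_, fun _ => hr.2⟩
    by_contra! hcon
    obtain ⟨t, ht, htmax⟩ := Finset.exists_max_image ((accepting v c).erase s) c
      (Finset.card_pos.1 (hD.trans_le hcon))
    have htv := mem_accepting.1 (Finset.mem_of_mem_erase ht)
    refine absurd (hmin t ⟨(htv.trans_lt hv).trans hr.1, hcon.trans (Finset.card_le_card ?_)⟩)
      (not_le.2 (htv.trans_lt hv))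
    exact fun x hx => Finset.mem_erase.2
      ⟨Finset.ne_of_mem_erase hx, mem_accepting.2 (htmax x hx)⟩
  · push Not at hex
    refine ⟨ξ, le_rfl, fun v hv => ?_, fun h => absurd h (lt_irrefl _)⟩
    by_contra! hcon
    obtain ⟨t, ht, htmax⟩ := Finset.exists_max_image ((accepting v c).erase s) c
      (Finset.card_pos.1 (hD.trans_le hcon))
    have htv := mem_accepting.1 (Finset.mem_of_mem_erase ht)
    refine absurd (hex t (htv.trans_lt hv)) (not_lt.2 (hcon.trans (Finset.card_le_card ?_)))
    exact fun x hx => Finset.mem_erase.2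
      ⟨Finset.ne_of_mem_erase hx, mem_accepting.2 (htmax x hx)⟩

namespace IsThreshold

variable {τ : ℝ}

lemma price_le (h : IsThreshold ξ D c s τ) (hp : p ≤ ξ) (hcard : ((accepting p c).erase s).card < D) : p ≤ τ := by
  by_contra! hlt
  have h1 := h.le_card (hlt.trans_le hp)
  have h2 := Finset.card_le_card (Finset.erase_subset_erase s (accepting_mono hlt.le c))
  omega

lemma mem_aucAlloc (h : IsThreshold ξ D c s τ) (hs : c s < τ) : s ∈ aucAlloc ξ D c := by
  refine Freight.mem_aucAlloc.2 ⟨hs.le.trans h.le_reserve,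
    (Finset.card_le_card fun t ht => ?_).trans_lt (h.card_lt _ hs)⟩
  exact Finset.mem_erase.2 ⟨fun hts => notMem_lowerBids_self (hts ▸ ht),
    mem_accepting.2 (le_of_mem_lowerBids ht)⟩

lemma notMem_aucAlloc (h : IsThreshold ξ D c s τ) (hs : τ < c s) : s ∉ aucAlloc ξ D c := by
  intro hmem
  obtain ⟨h1, h2⟩ := Freight.mem_aucAlloc.1 hmem
  have h3 := h.le_card (hs.trans_le h1)
  refine absurd (h3.trans (Finset.card_le_card fun t ht => ?_)) (not_le.2 h2)
  exact mem_lowerBids.2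
    (Or.inl ((mem_accepting.1 (Finset.mem_of_mem_erase ht)).trans_lt hs))

lemma le_of_mem_aucAlloc (h : IsThreshold ξ D c s τ) {w : Fin n} (hw : w ∈ aucAlloc ξ D c) : c w ≤ τ := by
  by_contra! hlt
  obtain ⟨h1, h2⟩ := Freight.mem_aucAlloc.1 hw
  have h3 := h.le_card (hlt.trans_le h1)
  refine absurd (h3.trans (Finset.card_le_card fun t ht => ?_)) (not_le.2 h2)
  exact mem_lowerBids.2
    (Or.inl ((mem_accepting.1 (Finset.mem_of_mem_erase ht)).trans_lt hlt))

lemma mem_aucAlloc_of_lt (h : IsThreshold ξ D c s τ) {w : Fin n} (hw : c w < τ) (hws : w ≠ s) : w ∈ aucAlloc ξ D c := by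
  refine Freight.mem_aucAlloc.2 ⟨hw.le.trans h.le_reserve, ?_⟩
  have hwm : w ∈ (accepting (c w) c).erase s := Finset.mem_erase.2 ⟨hws, mem_accepting.2 le_rfl⟩
  -- Carrier `s` may come before `w`, but `w` does not precede itself, so the rank of `w` is at most
  -- the number of others bidding at most `c w`, which is below `D`.
  have hsub : lowerBids c w ⊆ insert s (((accepting (c w) c).erase s).erase w) := by
    intro t ht
    have h1 : t ≠ w := fun htw => notMem_lowerBids_self (htw ▸ ht)
    have h2 := le_of_mem_lowerBids ht
    by_cases hts : t = s
    · simp [hts]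
    · simp [hts, h1, mem_accepting, h2]
  have h1 := Finset.card_le_card hsub
  have h2 := Finset.card_insert_le s (((accepting (c w) c).erase s).erase w)
  have h3 := Finset.card_erase_add_one hwm
  have h4 := h.card_lt _ hw
  omega

lemma card_aucAlloc (h : IsThreshold ξ D c s τ) (hτ : τ < ξ) : (aucAlloc ξ D c).card = D := by
  have h1 := h.le_card hτ
  have h2 := Finset.card_le_card ((Finset.erase_subset s _).trans (accepting_mono hτ.le c))
  rw [Freight.card_aucAlloc]
  omega

/-- A carrier who wins below the threshold price is paid the threshold price. -/
lemma aucPay_eq (h : IsThreshold ξ D c s τ) (hs : c s < τ) : aucPay ξ D c s = τ := by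
  have hmem := h.mem_aucAlloc hs
  refine le_antisymm ?_ ?_
  · rcases h.le_reserve.eq_or_lt with heq | hlt
    · exact heq.symm ▸ aucPay_le_reserve hmem
    -- At least `D` others bid at most `τ` while only `D - 1` of them win, so some loser bids at
    -- most `τ` and bounds the payment.
    · have h1 := h.le_card hlt
      have h2 : ((aucAlloc ξ D c).erase s).card < ((accepting τ c).erase s).card := by
        have := Finset.card_erase_add_one hmem
        have := h.card_aucAlloc hlt
        omega
      obtain ⟨r, hr, hrn⟩ := Finset.exists_mem_notMem_of_card_lt_card h2
      have hrs := Finset.ne_of_mem_erase hr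
      exact (aucPay_le_of_notMem hmem fun hr' => hrn (Finset.mem_erase.2 ⟨hrs, hr'⟩)).trans
        (mem_accepting.1 (Finset.mem_of_mem_erase hr))
  -- Conversely, `τ` is a dual price in the problem without `s`, and it separates the other winners
  -- from the other losers.
  · have h1 := le_assignmentValue (D := D) (c := c) h.le_reserve (Finset.univ.erase s)
    rw [sum_max_eq (W := (aucAlloc ξ D c).erase s)
      (Finset.erase_subset_erase s (Finset.subset_univ _))
      (fun t ht => h.le_of_mem_aucAlloc (Finset.mem_of_mem_erase ht))
      fun t ht htW => ?_, card_erase_aucAlloc hmem] at h1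
    · rw [aucPay_of_mem hmem]
      rcases h.le_reserve.eq_or_lt with heq | hlt
      · rw [heq] at h1 ⊢
        linarith
      · rw [h.card_aucAlloc hlt] at h1 ⊢
        linarith
    · by_contra! hlt
      have hts := Finset.ne_of_mem_erase ht
      exact htW (Finset.mem_erase.2 ⟨hts, h.mem_aucAlloc_of_lt hlt hts⟩)

end IsThreshold

end Payments

end Freight

/-! ### Moment bounds for Poisson and binomial counts, and resampling. -/

namespace Freight

/-! ### First absolute moments -/

/-- This is `|f| ≤ (a + f ^ 2 / a) / 2`, integrated. Unlike the square root of the variance, the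
bound is linear in `v`, so it can be averaged over a random number of trials; taking `a = √θ` later
yields the order `√θ`. -/
lemma integral_abs_le_of_integral_sq {α : Type*} [MeasurableSpace α] {μ : Measure α}
    [IsProbabilityMeasure μ] {f : α → ℝ} {a v : ℝ} (ha : 0 < a) (hf : AEStronglyMeasurable f μ)
    (hf2 : Integrable (fun x => f x ^ 2) μ) (hv : ∫ x, f x ^ 2 ∂μ ≤ v) :
    Integrable f μ ∧ ∫ x, |f x| ∂μ ≤ (a + v / a) / 2 := by
  have hpt : ∀ x, |f x| ≤ (a + f x ^ 2 / a) / 2 := fun x => by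
    have h : (a + f x ^ 2 / a) / 2 - |f x| = (a - |f x|) ^ 2 / (2 * a) := by
      rw [← sq_abs (f x)]; field_simp; ring
    have : 0 ≤ (a - |f x|) ^ 2 / (2 * a) := by positivity
    linarith
  have hg : Integrable (fun x => (a + f x ^ 2 / a) / 2) μ :=
    ((integrable_const a).add (hf2.div_const a)).div_const 2
  have hi : Integrable f μ := hg.mono' hf (Eventually.of_forall hpt)
  refine ⟨hi, (integral_mono hi.abs hg hpt).trans ?_⟩
  rw [integral_div, integral_add (integrable_const a) (hf2.div_const a), integral_div]
  simp only [integral_const, probReal_univ, one_smul]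
  gcongr

/-- The Poisson identity `E[X f(X)] = r E[f(X + 1)]`, which yields the first two moments. -/
lemma hasSum_poisson_mul {r : ℝ} {f : ℕ → ℝ} {S : ℝ}
    (h : HasSum (fun n : ℕ => Real.exp (-r) * r ^ n / (n.factorial : ℝ) * f (n + 1)) S) :
    HasSum (fun n : ℕ => Real.exp (-r) * r ^ n / (n.factorial : ℝ) * (n * f n)) (r * S) := by
  rw [← hasSum_nat_add_iff' 1]
  simp only [Finset.range_one, Finset.sum_singleton, Nat.cast_zero, zero_mul, mul_zero, sub_zero]
  refine (h.mul_left r).congr_fun ?_ |> fun h => h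
  intro n
  rw [Nat.factorial_succ]
  have h1 : (n.factorial : ℝ) ≠ 0 := by positivity
  have h2 : ((n : ℝ) + 1) ≠ 0 := by positivity
  push_cast
  field_simp
  ring

lemma hasSum_poisson_id (r : ℝ≥0) :
    HasSum (fun n : ℕ => Real.exp (-r) * (r : ℝ) ^ n / (n.factorial : ℝ) * n) r := by
  have h := hasSum_poisson_mul (r := r) (f := fun _ => 1) (S := 1)
    (by simpa using hasSum_one_poissonMeasure r)
  simpa using h

lemma hasSum_poisson_sq (r : ℝ≥0) :
    HasSum (fun n : ℕ => Real.exp (-r) * (r : ℝ) ^ n / (n.factorial : ℝ) * (n : ℝ) ^ 2)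
      (r * (r + 1)) := by
  have h := hasSum_poisson_mul (r := r) (f := fun n => n) (S := r + 1) (by
    have := (hasSum_poisson_id r).add (hasSum_one_poissonMeasure r)
    refine this.congr_fun fun n => ?_
    push_cast; ring)
  refine h.congr_fun fun n => ?_
  ring

lemma integrable_poisson_id (r : ℝ≥0) : Integrable (fun n : ℕ => (n : ℝ)) (poissonMeasure r) := by
  rw [integrable_poissonMeasure_iff]
  simpa using (hasSum_poisson_id r).summable

lemma integrable_poisson_sq (r : ℝ≥0) :
    Integrable (fun n : ℕ => (n : ℝ) ^ 2) (poissonMeasure r) := by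
  rw [integrable_poissonMeasure_iff]
  simpa using (hasSum_poisson_sq r).summable

lemma integral_poisson_id (r : ℝ≥0) : ∫ n, (n : ℝ) ∂poissonMeasure r = r := by
  rw [integral_poissonMeasure]
  simpa using (hasSum_poisson_id r).tsum_eq

lemma integral_poisson_sq (r : ℝ≥0) : ∫ n, (n : ℝ) ^ 2 ∂poissonMeasure r = r * (r + 1) := by
  rw [integral_poissonMeasure]
  simpa using (hasSum_poisson_sq r).tsum_eq

lemma integral_abs_poisson_sub_le (r : ℝ≥0) {a : ℝ} (ha : 0 < a) :
    ∫ n, |(n : ℝ) - r| ∂poissonMeasure r ≤ (a + r / a) / 2 := by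
  have hm : Measurable fun n : ℕ => (n : ℝ) := measurable_from_top
  have hL : MemLp (fun n : ℕ => (n : ℝ)) 2 (poissonMeasure r) :=
    (memLp_two_iff_integrable_sq hm.aestronglyMeasurable).2 (integrable_poisson_sq r)
  have hv : ∫ n, ((n : ℝ) - r) ^ 2 ∂poissonMeasure r = r := by
    have h := variance_eq_sub hL
    rw [variance_eq_integral hm.aemeasurable] at h
    simp only [Pi.pow_apply, integral_poisson_id, integral_poisson_sq] at h
    rw [h]; ring
  exact (integral_abs_le_of_integral_sq ha (hm.sub_const _).aestronglyMeasurable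
    (hL.sub (memLp_const (r : ℝ))).integrable_sq hv.le).2

/-! ### Counting successes in independent trials -/

section Trials

variable {α : Type*}

open Classical in
/-- The number of the first `n` coordinates that lie in `B`. -/
noncomputable def successes (B : Set α) (n : ℕ) (c : ℕ → α) : ℕ :=
  ((Finset.range n).filter fun m => c m ∈ B).card

lemma successes_eq_sum (B : Set α) (n : ℕ) (c : ℕ → α) :
    (successes B n c : ℝ) = ∑ m ∈ Finset.range n, B.indicator (fun _ => (1 : ℝ)) (c m) := by
  classical
  rw [successes, Finset.card_filter]
  push_cast
  exact Finset.sum_congr rfl fun m _ => by simp [Set.indicator_apply]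

lemma successes_le (B : Set α) (n : ℕ) (c : ℕ → α) : successes B n c ≤ n := by
  classical
  exact (Finset.card_filter_le _ _).trans (by simp)

lemma successes_mono (B : Set α) (c : ℕ → α) {m n : ℕ} (h : m ≤ n) :
    successes B m c ≤ successes B n c := by
  classical
  exact Finset.card_le_card (Finset.filter_subset_filter _ (Finset.range_subset_range.2 h))

variable [MeasurableSpace α]

lemma measurable_successes {B : Set α} (hB : MeasurableSet B) (n : ℕ) :
    Measurable fun c : ℕ → α => successes B n c := by
  classical
  simp only [successes, Finset.card_filter]
  exact Finset.measurable_sum _ fun m _ =>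
    Measurable.ite (measurable_pi_apply m hB) measurable_const measurable_const

lemma integral_comp_of_measurePreserving {β γ : Type*} [MeasurableSpace β] [MeasurableSpace γ]
    {μ : Measure β} {ν : Measure γ} {f : β → γ} (hf : MeasurePreserving f μ ν) {g : γ → ℝ}
    (hg : AEStronglyMeasurable g ν) : ∫ x, g (f x) ∂μ = ∫ y, g y ∂ν := by
  rw [← hf.map_eq] at hg ⊢
  exact (integral_map hf.aemeasurable hg).symm

variable (μ : Measure α) [IsProbabilityMeasure μ]

lemma integral_indicator_coord {B : Set α} (hB : MeasurableSet B) (m : ℕ) :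
    ∫ c, B.indicator (fun _ => (1 : ℝ)) (c m) ∂Measure.infinitePi (fun _ : ℕ => μ) = μ.real B := by
  rw [integral_comp_of_measurePreserving (measurePreserving_eval_infinitePi (fun _ : ℕ => μ) m)
    (g := B.indicator fun _ => (1 : ℝ))
    (measurable_const.indicator hB).aestronglyMeasurable, integral_indicator_const _ hB]
  simp

lemma integral_successes {B : Set α} (hB : MeasurableSet B) (n : ℕ) :
    ∫ c, (successes B n c : ℝ) ∂Measure.infinitePi (fun _ : ℕ => μ) = n * μ.real B := by
  simp only [successes_eq_sum]
  rw [integral_finsetSum, Finset.sum_congr rfl fun m _ => integral_indicator_coord μ hB m]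
  · simp
  · refine fun m _ => Integrable.of_bound ((measurable_const.indicator hB).comp
      (measurable_pi_apply m)).aestronglyMeasurable 1 (Eventually.of_forall fun c => ?_)
    by_cases h : c m ∈ B <;> simp [h]

lemma integral_abs_successes_sub_le {B : Set α} (hB : MeasurableSet B) (n : ℕ) {a : ℝ}
    (ha : 0 < a) :
    ∫ c, |(successes B n c : ℝ) - n * μ.real B| ∂Measure.infinitePi (fun _ : ℕ => μ)
      ≤ (a + n / a) / 2 := by
  set P := Measure.infinitePi fun _ : ℕ => μ
  let X : ℕ → (ℕ → α) → ℝ := fun m c => B.indicator (fun _ => (1 : ℝ)) (c m)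
  have hXm : ∀ m, Measurable (X m) := fun m =>
    (measurable_const.indicator hB).comp (measurable_pi_apply m)
  have hX01 : ∀ m c, X m c ∈ Set.Icc (0 : ℝ) 1 := fun m c => by
    by_cases h : c m ∈ B <;> simp [X, h]
  have hXL : ∀ m, MemLp (X m) 2 P := fun m =>
    MemLp.of_bound (hXm m).aestronglyMeasurable 1 (Eventually.of_forall fun c => by
      rw [Real.norm_eq_abs, abs_of_nonneg (hX01 m c).1]; exact (hX01 m c).2)
  have hind : iIndepFun X P :=
    iIndepFun_infinitePi (P := fun _ : ℕ => μ) (X := fun _ => B.indicator fun _ => (1 : ℝ))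
      fun _ => measurable_const.indicator hB
  have hsum : (fun c => (successes B n c : ℝ)) = ∑ m ∈ Finset.range n, X m := by
    funext c
    rw [successes_eq_sum, Finset.sum_apply]
  have hL : MemLp (fun c => (successes B n c : ℝ)) 2 P := by
    rw [hsum]; exact memLp_finsetSum' _ fun m _ => hXL m
  have hvar : Var[fun c => (successes B n c : ℝ); P] ≤ n := by
    rw [hsum, IndepFun.variance_sum (fun m _ => hXL m) fun i _ j _ hij => hind.indepFun hij]
    refine (Finset.sum_le_card_nsmul _ _ 1 fun m _ => ?_).trans (by simp)
    refine (variance_le_sq_of_bounded (Eventually.of_forall (hX01 m)) (hXm m).aemeasurable).trans ?_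
    norm_num
  have hm : Measurable fun c : ℕ → α => (successes B n c : ℝ) :=
    measurable_from_top.comp (measurable_successes hB n)
  rw [variance_eq_integral hm.aemeasurable, integral_successes μ hB n] at hvar
  refine (integral_abs_le_of_integral_sq ha (hm.sub_const _).aestronglyMeasurable ?_ hvar).2
  exact (hL.sub (memLp_const (n * μ.real B))).integrable_sq

/-! ### Resampling one coordinate -/

/-- Through this, expectations over all bids are computed by first integrating over the bid of one
carrier against fixed competitors. -/
lemma measurePreserving_update {ι : Type*} [DecidableEq ι] (i : ι) :
    MeasurePreserving (fun z : (ι → α) × α => Function.update z.1 i z.2)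
      ((Measure.infinitePi fun _ : ι => μ).prod μ) (Measure.infinitePi fun _ : ι => μ) := by
  have hmeas : Measurable fun z : (ι → α) × α => Function.update z.1 i z.2 := by
    refine measurable_pi_iff.2 fun j => ?_
    by_cases h : j = i
    · subst h; simpa using measurable_snd
    · simpa [Function.update_of_ne h, Function.comp_def] using
        (measurable_pi_apply j).comp measurable_fst
  refine ⟨hmeas, Measure.eq_infinitePi _ fun s t ht => ?_⟩
  rw [Measure.map_apply hmeas (MeasurableSet.pi s.countable_toSet fun j _ => ht j)]
  have hpre : (fun z : (ι → α) × α => Function.update z.1 i z.2) ⁻¹' Set.pi s t =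
      Set.pi (s.erase i : Finset ι) t ×ˢ (if i ∈ s then t i else Set.univ) := by
    ext z
    simp only [Set.mem_preimage, Set.mem_pi, Set.mem_prod, Finset.mem_coe, Finset.mem_erase]
    constructor
    · refine fun h => ⟨fun j hj => by simpa [Function.update_of_ne hj.1] using h j hj.2, ?_⟩
      split_ifs with hi
      · simpa using h i hi
      · trivial
    · rintro ⟨h1, h2⟩ j hj
      by_cases hji : j = i
      · subst hji; simpa [hj] using h2
      · simpa [Function.update_of_ne hji] using h1 j ⟨hji, hj⟩
  rw [hpre, Measure.prod_prod, Measure.infinitePi_pi _ fun j _ => ht j]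
  split_ifs with hi
  · exact Finset.prod_erase_mul _ _ hi
  · rw [measure_univ, mul_one, Finset.erase_eq_of_notMem hi]

end Trials
end Freight

/-! ### Expected outcomes of the mechanisms on one lane. -/

namespace Freight

/-! ### Mechanisms with bounded payments -/

/-- A mechanism that never serves more loads than there are, with measurable outcomes, and whose
payments per load are bounded. -/
structure LaneMechanism.IsRegular (m : LaneMechanism) : Prop where
  card_le : ∀ n D c, (m.alloc n D c).card ≤ D
  measurable_card : ∀ n D, Measurable fun c : Fin n → ℝ => (m.alloc n D c).card
  measurable_pay : ∀ n D, Measurable fun c : Fin n → ℝ => ∑ s, m.pay n D c s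
  bound : ∃ B : ℝ, 0 ≤ B ∧ ∀ n D c, (∀ s, 0 ≤ c s) → |∑ s, m.pay n D c s| ≤ B * D

lemma isRegular_spMechanism {p : ℝ} (hp : 0 ≤ p) : (spMechanism p).IsRegular where
  card_le n D c := by
    rw [spMechanism, card_spAlloc]; exact min_le_left _ _
  measurable_card n D := by
    simp only [spMechanism, card_spAlloc]
    exact measurable_const.min (measurable_card_accepting p)
  measurable_pay n D := by
    simp only [spMechanism]
    exact Finset.measurable_sum _ fun s _ =>
      Measurable.ite (measurableSet_mem_spAlloc p D s) measurable_const measurable_const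
  bound := by
    refine ⟨p, hp, fun n D c _ => ?_⟩
    simp only [spMechanism]
    rw [card_filter_sum_pay, card_spAlloc, abs_of_nonneg (by positivity)]
    gcongr
    exact min_le_left _ _

lemma sum_aucPay_nonneg {n : ℕ} (ξ : ℝ) (D : ℕ) {c : Fin n → ℝ} (hc : ∀ s, 0 ≤ c s) :
    0 ≤ ∑ s, aucPay ξ D c s :=
  Finset.sum_nonneg fun s _ => aucPay_nonneg (hc s)

lemma sum_aucPay_le {n : ℕ} {ξ : ℝ} (hξ : 0 ≤ ξ) (D : ℕ) (c : Fin n → ℝ) :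
    ∑ s, aucPay ξ D c s ≤ ξ * D := by
  calc ∑ s, aucPay ξ D c s ≤ ∑ s, if s ∈ aucAlloc ξ D c then ξ else 0 :=
        Finset.sum_le_sum fun s _ => aucPay_le
    _ = ξ * (aucAlloc ξ D c).card := by
        rw [← Finset.sum_filter, Finset.sum_const, nsmul_eq_mul, mul_comm]; simp
    _ ≤ ξ * D := by
        gcongr
        exact card_aucAlloc_le

lemma isRegular_aucMechanism {ξ : ℝ} (hξ : 0 ≤ ξ) : (aucMechanism ξ).IsRegular where
  card_le n D c := card_aucAlloc_le
  measurable_card n D := by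
    simp only [aucMechanism, card_aucAlloc]
    exact measurable_const.min (measurable_card_accepting ξ)
  measurable_pay n D := Finset.measurable_sum _ fun s _ => measurable_aucPay ξ D s
  bound := by
    refine ⟨ξ, hξ, fun n D c hc => ?_⟩
    simp only [aucMechanism]
    rw [abs_of_nonneg (sum_aucPay_nonneg ξ D hc)]
    exact sum_aucPay_le hξ D c

lemma sum_hybPay {p ξ : ℝ} {n : ℕ} (D : ℕ) (c : Fin n → ℝ) :
    ∑ s, (hybMechanism p ξ).pay n D c s =
      if D < (accepting p c).card then p * D else ∑ s, aucPay ξ D c s := by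
  simp only [hybMechanism]
  split_ifs with h
  · rw [card_filter_sum_pay, card_spAlloc, min_eq_left h.le]
  · rfl

lemma isRegular_hybMechanism {p ξ : ℝ} (hp : 0 ≤ p) (hpξ : p ≤ ξ) :
    (hybMechanism p ξ).IsRegular where
  card_le n D c := by
    rw [card_hybAlloc hpξ]; exact min_le_left _ _
  measurable_card n D := by
    simp only [card_hybAlloc hpξ]
    exact measurable_const.min (measurable_card_accepting ξ)
  measurable_pay n D := by
    simp only [sum_hybPay]
    exact Measurable.ite (measurable_card_accepting p measurableSet_Ioi) measurable_const
      (Finset.measurable_sum _ fun s _ => measurable_aucPay ξ D s)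
  bound := by
    refine ⟨ξ, hp.trans hpξ, fun n D c hc => ?_⟩
    rw [sum_hybPay]
    split_ifs with h
    · rw [abs_of_nonneg (by positivity)]
      gcongr
    · rw [abs_of_nonneg (sum_aucPay_nonneg ξ D hc)]
      exact sum_aucPay_le (hp.trans hpξ) D c

/-- If more than `D` carriers accept `p`, one of them loses the auction, and its bid, at most `p`,
bounds every payment of the auction. -/
lemma sum_aucPay_le_sum_hybPay {p ξ : ℝ} (hpξ : p ≤ ξ) {n : ℕ} (D : ℕ) (c : Fin n → ℝ) :
    ∑ s, aucPay ξ D c s ≤ ∑ s, (hybMechanism p ξ).pay n D c s := by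
  rw [sum_hybPay]
  split_ifs with h
  · obtain ⟨r, hr, hrn⟩ := Finset.exists_mem_notMem_of_card_lt_card
      ((card_aucAlloc_le (ξ := ξ) (D := D) (c := c)).trans_lt h)
    have hcard : (aucAlloc ξ D c).card = D := by
      have := Finset.card_le_card (accepting_mono hpξ c)
      rw [card_aucAlloc]; omega
    calc ∑ s, aucPay ξ D c s ≤ ∑ s, if s ∈ aucAlloc ξ D c then p else 0 :=
          Finset.sum_le_sum fun s _ => by
            split_ifs with hs
            · exact (aucPay_le_of_notMem hs hrn).trans (mem_accepting.1 hr)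
            · exact (aucPay_eq_zero hs).le
      _ = p * D := by
          rw [← Finset.sum_filter, Finset.sum_const, nsmul_eq_mul, mul_comm]; simp [hcard]
  · exact le_rfl

/-! ### Expected payments -/

/-- The first `n` costs of a sequence. -/
def head (n : ℕ) (c : ℕ → ℝ) : Fin n → ℝ := fun s => c s

lemma measurable_head (n : ℕ) : Measurable (head n) :=
  measurable_pi_iff.2 fun s => measurable_pi_apply (s : ℕ)

lemma head_update (n : ℕ) (c : ℕ → ℝ) (s : Fin n) (u : ℝ) :
    head n (Function.update c s u) = Function.update (head n c) s u :=
  Function.update_comp_eq_of_injective c Fin.val_injective s u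

namespace CostDistribution

variable (G : CostDistribution)

/-- The law of a sequence of independent costs. -/
noncomputable def costLaw : Measure (ℕ → ℝ) := Measure.infinitePi fun _ : ℕ => G.law

instance : IsProbabilityMeasure G.costLaw := by rw [costLaw]; infer_instance

lemma ae_costLaw_nonneg : ∀ᵐ c ∂G.costLaw, ∀ s, 0 ≤ c s :=
  ae_all_iff.2 fun s => (measurePreserving_eval_infinitePi (fun _ : ℕ => G.law) s).quasiMeasurePreserving.ae
    G.ae_nonneg

lemma integral_nonneg_of_update {n : ℕ} (s : Fin n) {Φ : (Fin n → ℝ) → ℝ}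
    (hΦ : Integrable (fun c => Φ (head n c)) G.costLaw)
    (h : ∀ c, 0 ≤ ∫ u, Φ (Function.update c s u) ∂G.law) :
    0 ≤ ∫ c, Φ (head n c) ∂G.costLaw := by
  have hmp := measurePreserving_update G.law (s : ℕ)
  rw [costLaw, ← integral_comp_of_measurePreserving hmp (g := fun c => Φ (head n c))
    hΦ.aestronglyMeasurable]
  have hint : Integrable (fun z : (ℕ → ℝ) × ℝ => Φ (head n (Function.update z.1 s z.2)))
      ((Measure.infinitePi fun _ : ℕ => G.law).prod G.law) :=
    hmp.integrable_comp_of_integrable (g := fun c => Φ (head n c)) hΦ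
  rw [integral_prod _ hint]
  refine integral_nonneg fun c => ?_
  simp only [head_update]
  exact h (head n c)

lemma ae_ne (τ : ℝ) : ∀ᵐ u ∂G.law, u ≠ τ := compl_mem_ae_iff.2 (measure_singleton τ)

lemma integral_ite_le (k τ : ℝ) : ∫ u, (if u ≤ τ then k else 0) ∂G.law = k * G.F τ := by
  have h : (fun u : ℝ => if u ≤ τ then k else 0) = (Set.Iic τ).indicator fun _ => k := by
    funext u; simp [Set.indicator_apply]
  rw [h, integral_indicator_const _ measurableSet_Iic, smul_eq_mul, mul_comm, F_eq]

lemma integrable_ite_le (k τ : ℝ) : Integrable (fun u => if u ≤ τ then k else 0) G.law := by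
  have h : (fun u : ℝ => if u ≤ τ then k else 0) = (Set.Iic τ).indicator fun _ => k := by
    funext u; simp [Set.indicator_apply]
  rw [h]
  exact (integrable_const k).indicator measurableSet_Iic

/-- The indicator that carrier `s` wins in the auction. -/
lemma integrable_indicator_alloc {n : ℕ} {A : (Fin n → ℝ) → Finset (Fin n)} (s : Fin n)
    (hA : MeasurableSet {c | s ∈ A c}) (k : ℝ) :
    Integrable (fun c => if s ∈ A (head n c) then k else 0) G.costLaw := by
  refine Integrable.of_bound (Measurable.ite (measurable_head n hA) measurable_const
    measurable_const).aestronglyMeasurable |k| (Eventually.of_forall fun c => ?_)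
  split_ifs <;> simp

lemma integrable_aucPay {ξ : ℝ} (hξ : 0 ≤ ξ) {n : ℕ} (D : ℕ) (s : Fin n) :
    Integrable (fun c => aucPay ξ D (head n c) s) G.costLaw := by
  refine Integrable.of_bound ((measurable_aucPay ξ D s).comp (measurable_head n)).aestronglyMeasurable
    ξ ?_
  filter_upwards [G.ae_costLaw_nonneg] with c hc
  rw [Real.norm_eq_abs, abs_of_nonneg (aucPay_nonneg (hc s))]
  exact aucPay_le.trans (by split_ifs; exacts [le_rfl, hξ])

/-- The threshold depends only on the other bids, so against them carrier `s` faces a posted price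
`τ`. A tie at `τ` is a null event, as costs have a density. -/
lemma aucPay_update_ae {ξ : ℝ} {n D : ℕ} {c : Fin n → ℝ} {s : Fin n} {τ : ℝ}
    (h : IsThreshold ξ D c s τ) (k : ℝ) :
    (fun u => aucPay ξ D (Function.update c s u) s
      - if s ∈ aucAlloc ξ D (Function.update c s u) then k else 0)
      =ᵐ[G.law] fun u => if u ≤ τ then τ - k else 0 := by
  filter_upwards [G.ae_ne τ] with u hu
  have h' := h.update u
  rcases lt_or_gt_of_ne hu with hlt | hgt
  · have hc : Function.update c s u s < τ := by simpa using hlt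
    rw [h'.aucPay_eq hc, if_pos (h'.mem_aucAlloc hc), if_pos hlt.le]
  · have hc : τ < Function.update c s u s := by simpa using hgt
    have hn := h'.notMem_aucAlloc hc
    rw [aucPay_eq_zero hn, if_neg hn, if_neg (not_le.2 hgt), sub_zero]

/-- A lower bound on the expected payment of the auction that is linear in the number of carriers
and in the expected number of served loads. -/
lemma le_integral_aucPay {ξ κ m : ℝ} (hξ : 0 ≤ ξ) (hκ : κ ≤ 0)
    (hm : ∀ τ, κ ≤ (τ - m) * G.F τ) (n D : ℕ) :
    κ * n + m * ∫ c, ((aucAlloc ξ D (head n c)).card : ℝ) ∂G.costLaw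
      ≤ ∫ c, ∑ s, aucPay ξ D (head n c) s ∂G.costLaw := by
  have hi1 := fun s : Fin n => G.integrable_aucPay hξ D s
  have hi2 := fun (s : Fin n) (k : ℝ) =>
    G.integrable_indicator_alloc (A := aucAlloc ξ D) s (measurableSet_mem_aucAlloc ξ D s) k
  -- Given the other bids, the mean payment to `s` less `m` per load won is `(τ - m) * F τ`, hence
  -- at least `κ`.
  have key : ∀ s : Fin n, 0 ≤ ∫ c, (aucPay ξ D (head n c) s
      - (if s ∈ aucAlloc ξ D (head n c) then m else 0) - κ) ∂G.costLaw := by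
    intro s
    refine G.integral_nonneg_of_update s
      (Φ := fun c => aucPay ξ D c s - (if s ∈ aucAlloc ξ D c then m else 0) - κ)
      (((hi1 s).sub (hi2 s m)).sub (integrable_const κ)) fun c => ?_
    rcases D.eq_zero_or_pos with rfl | hD
    · have hn : ∀ u, s ∉ aucAlloc ξ 0 (Function.update c s u) := fun u h =>
        absurd (mem_aucAlloc.1 h).2 (Nat.not_lt_zero _)
      simp [aucPay_eq_zero (hn _), hn, hκ]
    · obtain ⟨τ, hτ⟩ := exists_isThreshold ξ hD c s
      have hae := G.aucPay_update_ae hτ m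
      rw [integral_sub ((G.integrable_ite_le (τ - m) τ).congr hae.symm) (integrable_const κ),
        integral_congr_ae hae, integral_ite_le]
      simpa using hm τ
  have key' : ∀ s : Fin n, 0 ≤ ∫ c, aucPay ξ D (head n c) s ∂G.costLaw
      - ∫ c, (if s ∈ aucAlloc ξ D (head n c) then m else 0) ∂G.costLaw - κ := fun s => by
    have h := key s
    rw [integral_sub (f := fun c => aucPay ξ D (head n c) s
        - if s ∈ aucAlloc ξ D (head n c) then m else 0)
        ((hi1 s).sub (hi2 s m)) (integrable_const κ),
      integral_sub (hi1 s) (hi2 s m)] at h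
    simpa using h
  have hsum := Finset.sum_nonneg fun s (_ : s ∈ Finset.univ) => key' s
  have hcard : ∀ c : ℕ → ℝ, m * ((aucAlloc ξ D (head n c)).card : ℝ) =
      ∑ s, if s ∈ aucAlloc ξ D (head n c) then m else 0 := fun c => by
    rw [← Finset.sum_filter, Finset.sum_const, nsmul_eq_mul, mul_comm]; simp
  rw [← integral_const_mul, integral_congr_ae (Eventually.of_forall hcard),
    integral_finsetSum _ fun s _ => hi2 s m, integral_finsetSum _ fun s _ => hi1 s]
  simp only [Finset.sum_sub_distrib, Finset.sum_const, Finset.card_univ, Fintype.card_fin,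
    nsmul_eq_mul] at hsum
  linarith

section Comparison

variable {b p ξ : ℝ} {n D : ℕ} {c : Fin n → ℝ} {s : Fin n}

lemma spAlloc_eq_of_card_lt (h : ((accepting p c).erase s).card < D) :
    s ∈ spAlloc p D c ↔ c s ≤ p := by
  simp only [spAlloc, Finset.mem_filter, Finset.mem_univ, true_and, and_iff_left_iff_imp]
  intro _
  refine (Finset.card_le_card fun t ht => ?_).trans_lt h
  rw [Finset.mem_filter] at ht
  exact Finset.mem_erase.2 ⟨ht.2.ne, ht.1⟩

/-- The contribution of carrier `s` to the profit of a mechanism, when a transported load is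
worth `b`. -/
noncomputable def contribution (m : LaneMechanism) (b : ℝ) (D : ℕ) (s : Fin n)
    (c : Fin n → ℝ) : ℝ :=
  (if s ∈ m.alloc n D c then b else 0) - m.pay n D c s

/-- If `s` accepts `p` as well, HYB uses the posted price. If not, `s` wins neither at the posted
price nor in the auction, where at least `D` lower bids come first. -/
lemma contribution_hyb_of_le_card (h : D ≤ ((accepting p c).erase s).card) :
    contribution (hybMechanism p ξ) b D s c = contribution (spMechanism p) b D s c := by
  by_cases hD : D < (accepting p c).card
  · simp only [contribution, hybMechanism, spMechanism, hD, if_true]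
    congr
  · have hs : s ∉ accepting p c := fun hs => by
      have := Finset.card_erase_add_one hs
      omega
    have hps : p < c s := not_le.1 fun h => hs (mem_accepting.2 h)
    have h1 : s ∉ spAlloc p D c := fun h => hs (by simpa [accepting] using
      (Finset.mem_filter.1 h).2.1)
    have h2 : s ∉ aucAlloc ξ D c := fun h' => by
      refine absurd (h.trans (Finset.card_le_card fun t ht => ?_))
        (not_le.2 (mem_aucAlloc.1 h').2)
      exact mem_lowerBids.2 (Or.inl
        ((mem_accepting.1 (Finset.mem_of_mem_erase ht)).trans_lt hps))
    simp [contribution, hybMechanism, spMechanism, hD, h1, h2, aucPay_eq_zero h2]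

lemma contribution_hyb_of_card_lt (h : ((accepting p c).erase s).card < D) :
    contribution (hybMechanism p ξ) b D s c =
      (if s ∈ aucAlloc ξ D c then b else 0) - aucPay ξ D c s := by
  have hD : ¬ D < (accepting p c).card := by
    have := Finset.pred_card_le_card_erase (s := accepting p c) (a := s)
    omega
  simp [contribution, hybMechanism, hD]

lemma contribution_sp_of_card_lt (h : ((accepting p c).erase s).card < D) :
    contribution (spMechanism p) b D s c = if c s ≤ p then b - p else 0 := by
  simp only [contribution, spMechanism, spAlloc_eq_of_card_lt h]
  split_ifs <;> simp

/-- The other bids decide between two cases. If `D` of them accept `p`, the contributions agree.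
Otherwise HYB runs the auction whatever `s` bids, so `s` faces a threshold `τ` with `p ≤ τ ≤ ξ`
instead of `p`, and the surplus is no smaller there. -/
lemma integral_contribution_nonneg (hξ : ξ = max (G.virtualCostInv b) p) :
    0 ≤ ∫ u, (contribution (hybMechanism p ξ) b D s (Function.update c s u)
      - contribution (spMechanism p) b D s (Function.update c s u)) ∂G.law := by
  have hpξ : p ≤ ξ := hξ ▸ le_max_right _ _
  rcases le_or_gt D ((accepting p c).erase s).card with h | h
  · refine integral_nonneg fun u => ?_
    rw [contribution_hyb_of_le_card (by rwa [erase_accepting_update]), sub_self]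
    rfl
  · obtain ⟨τ, hτ⟩ := exists_isThreshold ξ (pos_of_gt h) c s
    have hae := G.aucPay_update_ae hτ b
    have hae' : (fun u => contribution (hybMechanism p ξ) b D s (Function.update c s u)
        - contribution (spMechanism p) b D s (Function.update c s u)) =ᵐ[G.law]
        fun u => (if u ≤ τ then b - τ else 0) - (if u ≤ p then b - p else 0) := by
      filter_upwards [hae] with u hu
      rw [contribution_hyb_of_card_lt (by rwa [erase_accepting_update]),
        contribution_sp_of_card_lt (by rwa [erase_accepting_update]), Function.update_self]
      congr 1
      rw [← neg_sub, hu]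
      split_ifs <;> simp
    rw [integral_congr_ae hae', integral_sub (G.integrable_ite_le _ _) (G.integrable_ite_le _ _),
      integral_ite_le, integral_ite_le, sub_nonneg]
    exact G.surplus_le_of_le_reserve (hτ.price_le hpξ h) (hξ ▸ hτ.le_reserve)

lemma sum_contribution (m : LaneMechanism) (b : ℝ) (D : ℕ) (c : Fin n → ℝ) :
    ∑ s, contribution m b D s c = b * (m.alloc n D c).card - ∑ s, m.pay n D c s := by
  simp only [contribution, Finset.sum_sub_distrib]
  rw [← Finset.sum_filter, Finset.sum_const, nsmul_eq_mul, mul_comm]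
  simp

lemma integrable_contribution_sp (s : Fin n) :
    Integrable (fun c => contribution (spMechanism p) b D s (head n c)) G.costLaw :=
  (G.integrable_indicator_alloc (A := spAlloc p D) s (measurableSet_mem_spAlloc p D s) b).sub
    (G.integrable_indicator_alloc (A := spAlloc p D) s (measurableSet_mem_spAlloc p D s) p)

lemma integrable_contribution_hyb (hξ : 0 ≤ ξ) (s : Fin n) :
    Integrable (fun c => contribution (hybMechanism p ξ) b D s (head n c)) G.costLaw := by
  have h1 : (fun c => contribution (hybMechanism p ξ) b D s (head n c)) =
      fun c => if D < (accepting p (head n c)).card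
        then contribution (spMechanism p) b D s (head n c)
        else (if s ∈ aucAlloc ξ D (head n c) then b else 0) - aucPay ξ D (head n c) s := by
    funext c
    by_cases hD : D < (accepting p (head n c)).card
    · simp only [contribution, hybMechanism, spMechanism, hD, if_true]
      congr
    · simp [contribution, hybMechanism, hD]
  have hset : MeasurableSet {c : ℕ → ℝ | D < (accepting p (head n c)).card} :=
    ((measurable_card_accepting p).comp (measurable_head n)) measurableSet_Ioi
  have h2 := (G.integrable_contribution_sp (b := b) (p := p) (D := D) s).indicator hset
  have h3 := ((G.integrable_indicator_alloc (A := aucAlloc ξ D) s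
    (measurableSet_mem_aucAlloc ξ D s) b).sub (G.integrable_aucPay hξ D s)).indicator hset.compl
  rw [h1]
  refine (h2.add h3).congr (Eventually.of_forall fun c => ?_)
  by_cases hD : D < (accepting p (head n c)).card <;> simp [hD]

/-- With a given number of carriers and loads, the hybrid mechanism earns at least as much as the
posted price. -/
lemma integral_sp_le_integral_hyb (hp : 0 ≤ p) (hξ : ξ = max (G.virtualCostInv b) p) (n D : ℕ) :
    ∫ c, (b * ((spMechanism p).alloc n D (head n c)).card
        - ∑ s, (spMechanism p).pay n D (head n c) s) ∂G.costLaw ≤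
      ∫ c, (b * ((hybMechanism p ξ).alloc n D (head n c)).card
        - ∑ s, (hybMechanism p ξ).pay n D (head n c) s) ∂G.costLaw := by
  have hξ0 : 0 ≤ ξ := hp.trans (hξ ▸ le_max_right _ _)
  have hi1 := fun s : Fin n => G.integrable_contribution_sp (b := b) (p := p) (D := D) s
  have hi2 := fun s : Fin n => G.integrable_contribution_hyb (b := b) (p := p) (D := D) hξ0 s
  simp only [← sum_contribution]
  rw [integral_finsetSum _ fun s _ => hi1 s, integral_finsetSum _ fun s _ => hi2 s]
  refine Finset.sum_le_sum fun s _ => ?_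
  rw [← sub_nonneg, ← integral_sub (hi2 s) (hi1 s)]
  exact G.integral_nonneg_of_update s
    (Φ := fun c => contribution (hybMechanism p ξ) b D s c - contribution (spMechanism p) b D s c)
    ((hi2 s).sub (hi1 s)) fun c => G.integral_contribution_nonneg hξ

end Comparison

end CostDistribution

end Freight

/-! ### The chain of carrier numbers and its geometric convergence. -/

namespace Freight

variable {N : Type*} [Fintype N] [DecidableEq N] {E : Finset (N × N)}

/-! ### Measurability of the dynamics -/

/-- A policy that uses a regular mechanism on each lane. -/
def Policy.IsRegular (π : Policy E) : Prop := ∀ e, (π.carrier e).IsRegular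

lemma measurable_cost (e : E) : Measurable fun ω : Noise E => ω.1 e :=
  (measurable_pi_apply e).comp measurable_fst

namespace Policy

variable {π : Policy E}

lemma staying_eq (π : Policy E) (x : State E) (ω : Noise E) (e : E) :
    π.staying x ω e =
      successes {NextMove.take e} (∑ e' : E with e'.1.2 = e.1.1, π.served x ω e') (ω.2.1 e.1.1) :=
  rfl

lemma staying_le (π : Policy E) (x : State E) (ω : Noise E) (e : E) :
    π.staying x ω e ≤ ∑ e' : E with e'.1.2 = e.1.1, π.served x ω e' := by
  rw [staying_eq]; exact successes_le _ _ _

lemma measurable_served (hπ : π.IsRegular) (x : State E) (e : E) :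
    Measurable fun ω => π.served x ω e :=
  ((hπ e).measurable_card _ _).comp ((measurable_head _).comp (measurable_cost e))

lemma measurable_payment (hπ : π.IsRegular) (x : State E) (e : E) :
    Measurable fun ω => π.payment x ω e :=
  ((hπ e).measurable_pay _ _).comp ((measurable_head _).comp (measurable_cost e))

lemma served_le (hπ : π.IsRegular) (x : State E) (ω : Noise E) (e : E) :
    π.served x ω e ≤ x.2 e := (hπ e).card_le _ _ _

lemma measurable_staying (hπ : π.IsRegular) (x : State E) (e : E) :
    Measurable fun ω => π.staying x ω e := by
  have h1 : Measurable fun z : ℕ × (ℕ → NextMove E) => successes {NextMove.take e} z.1 z.2 :=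
    measurable_from_prod_countable_right fun n =>
      measurable_successes (MeasurableSpace.measurableSet_top) n
  have h2 : Measurable fun ω : Noise E => ∑ e' : E with e'.1.2 = e.1.1, π.served x ω e' :=
    Finset.measurable_sum _ fun e' _ => measurable_served hπ x e'
  have h3 : Measurable fun ω : Noise E => ω.2.1 e.1.1 :=
    (measurable_pi_apply _).comp (measurable_fst.comp measurable_snd)
  exact h1.comp (h2.prodMk h3)

lemma measurable_step (hπ : π.IsRegular) :
    Measurable fun z : State E × Noise E => π.step z.1 z.2 := by
  refine measurable_from_prod_countable_right fun x => ?_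
  refine Measurable.prodMk (measurable_pi_iff.2 fun e => ?_) ?_
  · exact (measurable_staying hπ x e).add
      ((measurable_pi_apply e).comp (measurable_snd.comp (measurable_snd.comp measurable_snd)))
  · exact measurable_fst.comp (measurable_snd.comp measurable_snd)

end Policy

namespace Market

variable (M : Market N E)

/-! ### The law of the loads -/

/-- The law of the loads of one period. -/
noncomputable def loadLaw (r : E → ℝ) : Measure (E → ℕ) :=
  Measure.infinitePi fun e => poissonMeasure (M.demand e (r e)).toNNReal

/-- The law of the exogenous carrier arrivals of one period. -/
noncomputable def arrivalLaw : Measure (E → ℕ) :=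
  Measure.infinitePi fun e => poissonMeasure (M.arrival e).toNNReal

/-- The law of the carriers' moves. -/
noncomputable def movesLaw : Measure (N → ℕ → NextMove E) :=
  Measure.infinitePi fun i => Measure.infinitePi fun _ : ℕ => M.moveLaw i

/-- The law of the carriers' costs. -/
noncomputable def costsLaw : Measure (E → ℕ → ℝ) :=
  Measure.infinitePi fun e => (M.cost e).costLaw

instance (r : E → ℝ) : IsProbabilityMeasure (M.loadLaw r) := by rw [loadLaw]; infer_instance
instance : IsProbabilityMeasure M.arrivalLaw := by rw [arrivalLaw]; infer_instance
instance : IsProbabilityMeasure M.movesLaw := by rw [movesLaw]; infer_instance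
instance : IsProbabilityMeasure M.costsLaw := by rw [costsLaw]; infer_instance

lemma noise_eq (r : E → ℝ) :
    M.noise r = M.costsLaw.prod (M.movesLaw.prod ((M.loadLaw r).prod M.arrivalLaw)) := rfl

instance (r : E → ℝ) : IsProbabilityMeasure (M.noise r) := by rw [noise_eq]; infer_instance

/-- The law of the loads of a period and of the randomness of that period. -/
noncomputable def periodLaw (r : E → ℝ) : Measure ((E → ℕ) × Noise E) :=
  (M.loadLaw r).prod (M.noise r)

instance (r : E → ℝ) : IsProbabilityMeasure (M.periodLaw r) := by rw [periodLaw]; infer_instance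

lemma measurePreserving_cost (r : E → ℝ) (e : E) :
    MeasurePreserving (fun ω : Noise E => ω.1 e) (M.noise r) (M.cost e).costLaw :=
  (measurePreserving_eval_infinitePi (fun e => (M.cost e).costLaw) e).comp measurePreserving_fst

lemma measurePreserving_load (r : E → ℝ) (e : E) :
    MeasurePreserving (fun D : E → ℕ => D e) (M.loadLaw r)
      (poissonMeasure (M.demand e (r e)).toNNReal) :=
  measurePreserving_eval_infinitePi (fun e => poissonMeasure (M.demand e (r e)).toNNReal) e

lemma measurePreserving_arrival (e : E) :
    MeasurePreserving (fun A : E → ℕ => A e) M.arrivalLaw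
      (poissonMeasure (M.arrival e).toNNReal) :=
  measurePreserving_eval_infinitePi (fun e => poissonMeasure (M.arrival e).toNNReal) e

lemma integrable_load (r : E → ℝ) (e : E) : Integrable (fun D : E → ℕ => (D e : ℝ)) (M.loadLaw r) :=
  (M.measurePreserving_load r e).integrable_comp_of_integrable (integrable_poisson_id _)

lemma integral_load {r : E → ℝ} {e : E} (hd : 0 ≤ M.demand e (r e)) :
    ∫ D, (D e : ℝ) ∂M.loadLaw r = M.demand e (r e) := by
  rw [integral_comp_of_measurePreserving (M.measurePreserving_load r e) (g := fun n : ℕ => (n : ℝ))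
    Measurable.of_discrete.aestronglyMeasurable, integral_poisson_id, Real.coe_toNNReal _ hd]

/-- This probability is the regeneration constant of the chain. -/
lemma loadLaw_zero_pos (r : E → ℝ) : 0 < (M.loadLaw r).real {0} := by
  rw [loadLaw, measureReal_def, Measure.infinitePi_singleton_of_fintype, ENNReal.toReal_prod]
  refine Finset.prod_pos fun e _ => ?_
  have h := poissonMeasure_real_singleton (M.demand e (r e)).toNNReal 0
  rw [measureReal_def] at h
  simp only [Pi.zero_apply]
  rw [h]
  positivity

/-! ### The transition operator on functions of the numbers of carriers -/

/-- The numbers of carriers in the next period. -/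
noncomputable def next (π : Policy E) (S : E → ℕ) (w : (E → ℕ) × Noise E) : E → ℕ :=
  (π.step (S, w.1) w.2).1

/-- The expected value of `h` in the next period, as a function of the current numbers of
carriers. -/
noncomputable def push (π : Policy E) (h : (E → ℕ) → ℝ) (S : E → ℕ) : ℝ :=
  ∫ w, h (next π S w) ∂M.periodLaw π.shipperPrice

variable {π : Policy E}

lemma measurable_of_state {β : Type*} [MeasurableSpace β]
    {f : State E → Noise E → β} (hf : ∀ x, Measurable (f x)) (S : E → ℕ) :
    Measurable fun w : (E → ℕ) × Noise E => f (S, w.1) w.2 :=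
  measurable_from_prod_countable_right fun D => hf (S, D)

lemma measurable_next (hπ : π.IsRegular) (S : E → ℕ) : Measurable (next π S) :=
  measurable_of_state (f := fun x ω => (π.step x ω).1)
    (fun _ => ((Policy.measurable_step hπ).comp measurable_prodMk_left).fst) S

lemma integrable_comp_next (hπ : π.IsRegular) {h : (E → ℕ) → ℝ} {C : ℝ} (hC : ∀ S, |h S| ≤ C)
    (S : E → ℕ) : Integrable (fun w => h (next π S w)) (M.periodLaw π.shipperPrice) :=
  Integrable.of_bound (Measurable.of_discrete.comp (measurable_next hπ S)).aestronglyMeasurable C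
    (Eventually.of_forall fun _ => hC _)

lemma abs_push_sub_le (hπ : π.IsRegular) {h : (E → ℕ) → ℝ} {C c L : ℝ} (hC : ∀ S, |h S| ≤ C)
    (hL : ∀ S, |h S - c| ≤ L) (S : E → ℕ) : |M.push π h S - c| ≤ L := by
  have h1 : M.push π h S - c = ∫ w, (h (next π S w) - c) ∂M.periodLaw π.shipperPrice := by
    rw [integral_sub (M.integrable_comp_next hπ hC S) (integrable_const c)]
    simp [push]
  rw [h1, ← Real.norm_eq_abs]
  refine (norm_integral_le_of_norm_le_const (C := L) (Eventually.of_forall fun w => hL _)).trans ?_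
  simp

lemma abs_push_le (hπ : π.IsRegular) {h : (E → ℕ) → ℝ} {C : ℝ} (hC : ∀ S, |h S| ≤ C)
    (S : E → ℕ) : |M.push π h S| ≤ C := by
  simpa using M.abs_push_sub_le hπ (c := 0) hC (by simpa using hC) S

lemma abs_iterate_push_le (hπ : π.IsRegular) {h : (E → ℕ) → ℝ} {C : ℝ} (hC : ∀ S, |h S| ≤ C)
    (t : ℕ) (S : E → ℕ) : |(M.push π)^[t] h S| ≤ C := by
  induction t generalizing S with
  | zero => exact hC S
  | succ t ih =>
    rw [Function.iterate_succ_apply']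
    exact M.abs_push_le hπ ih S

lemma next_zero (hπ : π.IsRegular) (S : E → ℕ) (ω : Noise E) : next π S (0, ω) = ω.2.2.2 := by
  funext e
  have h : π.staying (S, 0) ω e = 0 := by
    refine Nat.le_zero.1 ((π.staying_le _ ω e).trans (le_of_eq (Finset.sum_eq_zero fun e' _ => ?_)))
    exact Nat.le_zero.1 (Policy.served_le hπ (S, 0) ω e')
  simp [next, Policy.step, h]

/-- In a period without loads the past is forgotten, hence the oscillation contracts. -/
lemma abs_push_sub_push_le (hπ : π.IsRegular) {h : (E → ℕ) → ℝ} {C L : ℝ} (hC : ∀ S, |h S| ≤ C)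
    (hL : ∀ S S', |h S - h S'| ≤ L) (S S' : E → ℕ) :
    |M.push π h S - M.push π h S'| ≤ (1 - (M.loadLaw π.shipperPrice).real {0}) * L := by
  have hi := fun S => M.integrable_comp_next hπ hC S
  have hset : MeasurableSet ((fun w : (E → ℕ) × Noise E => w.1) ⁻¹' {0}ᶜ) :=
    measurable_fst (measurableSet_singleton 0).compl
  rw [push, push, ← integral_sub (hi S) (hi S'), ← Real.norm_eq_abs]
  -- Both states are driven by the same loads and noise, so without loads they have the same
  -- successor.
  have hb : ∀ w : (E → ℕ) × Noise E, ‖h (next π S w) - h (next π S' w)‖ ≤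
      ((fun w : (E → ℕ) × Noise E => w.1) ⁻¹' {0}ᶜ).indicator (fun _ => L) w := by
    rintro ⟨D, ω⟩
    by_cases hD : D = 0
    · subst hD
      simp [next_zero hπ]
    · simp [hD, hL]
  refine (norm_integral_le_of_norm_le ((integrable_const L).indicator hset)
    (Eventually.of_forall hb)).trans ?_
  rw [integral_indicator_const _ hset, smul_eq_mul]
  have h1 : (M.periodLaw π.shipperPrice).real ((fun w : (E → ℕ) × Noise E => w.1) ⁻¹' {0}ᶜ) =
      1 - (M.loadLaw π.shipperPrice).real {0} := by
    rw [← probReal_compl_eq_one_sub (measurableSet_singleton 0)]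
    exact measurePreserving_fst.measureReal_preimage
      (measurableSet_singleton 0).compl.nullMeasurableSet
  rw [h1]

lemma abs_iterate_push_sub_le (hπ : π.IsRegular) {h : (E → ℕ) → ℝ} {C : ℝ}
    (hC : ∀ S, |h S| ≤ C) (t : ℕ) (S S' : E → ℕ) :
    |(M.push π)^[t] h S - (M.push π)^[t] h S'| ≤
      (1 - (M.loadLaw π.shipperPrice).real {0}) ^ t * (2 * C) := by
  induction t generalizing S S' with
  | zero =>
    simp only [Function.iterate_zero, id, pow_zero, one_mul]
    exact (abs_sub _ _).trans (by linarith [hC S, hC S'])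
  | succ t ih =>
    rw [Function.iterate_succ_apply', pow_succ', mul_assoc]
    exact M.abs_push_sub_push_le hπ (M.abs_iterate_push_le hπ hC t) ih S S'

/-- The expected value of a bounded function of the numbers of carriers converges geometrically
fast, uniformly in the initial state. -/
lemma exists_abs_iterate_push_sub_le (hπ : π.IsRegular) {h : (E → ℕ) → ℝ} {C : ℝ}
    (hC : ∀ S, |h S| ≤ C) :
    ∃ γ, ∀ t S, |(M.push π)^[t] h S - γ| ≤
      (1 - (M.loadLaw π.shipperPrice).real {0}) ^ t * (2 * C) := by
  set ρ := 1 - (M.loadLaw π.shipperPrice).real {0} with hρ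
  have hρ1 : ρ < 1 := by linarith [M.loadLaw_zero_pos π.shipperPrice]
  -- Further applications of `push` only average the values of the `t`-th iterate, so they cannot
  -- leave its oscillation band.
  have key : ∀ t k S, |(M.push π)^[t + k] h 0 - (M.push π)^[t] h S| ≤ ρ ^ t * (2 * C) := by
    intro t k S
    have : ∀ S', |(M.push π)^[t + k] h S' - (M.push π)^[t] h S| ≤ ρ ^ t * (2 * C) := by
      induction k with
      | zero => exact fun S' => M.abs_iterate_push_sub_le hπ hC t S' S
      | succ k ih =>
        intro S'
        rw [← add_assoc, Function.iterate_succ_apply']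
        exact M.abs_push_sub_le hπ (M.abs_iterate_push_le hπ hC _) ih S'
    exact this 0
  have hcau : CauchySeq fun t => (M.push π)^[t] h 0 := by
    refine cauchySeq_of_le_geometric ρ (2 * C) hρ1 fun t => ?_
    rw [dist_comm, Real.dist_eq, mul_comm]
    exact key t 1 0
  obtain ⟨γ, hγ⟩ := cauchySeq_tendsto_of_complete hcau
  refine ⟨γ, fun t S => ?_⟩
  have hlim : Tendsto (fun k => |(M.push π)^[t + k] h 0 - (M.push π)^[t] h S|) atTop
      (𝓝 |γ - (M.push π)^[t] h S|) := by
    have h1 : Tendsto (fun k => (M.push π)^[t + k] h 0) atTop (𝓝 γ) := by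
      simpa [add_comm] using (tendsto_add_atTop_iff_nat t).2 hγ
    exact (h1.sub_const _).abs
  rw [abs_sub_comm]
  exact le_of_tendsto hlim (Eventually.of_forall fun k => key t k S)

lemma tendsto_geometric (r : E → ℝ) (C : ℝ) :
    Tendsto (fun t : ℕ => (1 - (M.loadLaw r).real {0}) ^ t * C) atTop (𝓝 0) := by
  have h1 := M.loadLaw_zero_pos r
  have h2 : (M.loadLaw r).real {0} ≤ 1 := measureReal_le_one
  simpa using (tendsto_pow_atTop_nhds_zero_of_lt_one (by linarith : 0 ≤ 1 - (M.loadLaw r).real {0})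
    (by linarith)).mul_const C

lemma exists_tendsto_iterate_push (hπ : π.IsRegular) {h : (E → ℕ) → ℝ} {C : ℝ}
    (hC : ∀ S, |h S| ≤ C) :
    ∃ γ, ∀ S, Tendsto (fun t => (M.push π)^[t] h S) atTop (𝓝 γ) := by
  obtain ⟨γ, hγ⟩ := M.exists_abs_iterate_push_sub_le hπ hC
  refine ⟨γ, fun S => tendsto_iff_dist_tendsto_zero.2 ?_⟩
  exact squeeze_zero (fun _ => dist_nonneg) (fun t => hγ t S) (M.tendsto_geometric _ _)

end Market
end Freight

/-! ### From the law of the state to iterates of `push`. -/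

namespace Freight

variable {N : Type*} [Fintype N] [DecidableEq N] {E : Finset (N × N)}

lemma integrable_profit {α : Type*} [MeasurableSpace α] {μ : Measure α} [IsProbabilityMeasure μ]
    {f g h : α → ℝ} (hf : Integrable f μ) (hg : Integrable g μ) (hh : Integrable h μ) (a b : ℝ) :
    Integrable (fun x => a - b * (f x - g x) - h x) μ :=
  ((integrable_const a).sub ((hf.sub hg).const_mul b)).sub hh

lemma integral_profit {α : Type*} [MeasurableSpace α] {μ : Measure α} [IsProbabilityMeasure μ]
    {f g h : α → ℝ} (hf : Integrable f μ) (hg : Integrable g μ) (hh : Integrable h μ) (a b : ℝ) :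
    ∫ x, (a - b * (f x - g x) - h x) ∂μ = a - b * (∫ x, f x ∂μ - ∫ x, g x ∂μ) - ∫ x, h x ∂μ := by
  have h1 : Integrable (fun x => b * (f x - g x)) μ := (hf.sub hg).const_mul b
  have h2 : Integrable (fun x => a - b * (f x - g x)) μ := (integrable_const a).sub h1
  rw [integral_sub h2 hh, integral_sub (integrable_const a) h1, integral_const_mul,
    integral_sub hf hg]
  simp

namespace Market

variable (M : Market N E) {π : Policy E}

/-! ### The law of the state -/

lemma stateLaw_succ (π : Policy E) (x₀ : State E) (t : ℕ) :
    M.stateLaw π x₀ (t + 1) =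
      ((M.stateLaw π x₀ t).prod (M.noise π.shipperPrice)).map fun z => π.step z.1 z.2 := rfl

lemma isProbabilityMeasure_stateLaw (hπ : π.IsRegular) (x₀ : State E) (t : ℕ) :
    IsProbabilityMeasure (M.stateLaw π x₀ t) := by
  induction t with
  | zero => exact Measure.dirac.isProbabilityMeasure
  | succ t ih =>
    rw [stateLaw_succ]
    exact Measure.isProbabilityMeasure_map (Policy.measurable_step hπ).aemeasurable

/-- The randomness of one period other than the new loads. -/
abbrev Rest (E : Finset (N × N)) : Type _ :=
  ((E → ℕ → ℝ) × (N → ℕ → NextMove E)) × (E → ℕ)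

/-- The randomness of one period, with the new loads `D`. -/
def Rest.toNoise (k : Rest E) (D : E → ℕ) : Noise E := (k.1.1, k.1.2, D, k.2)

lemma measurePreserving_rest (r : E → ℝ) :
    MeasurePreserving (fun ω : Noise E => ((((ω.1, ω.2.1), ω.2.2.2), ω.2.2.1) : Rest E × (E → ℕ)))
      (M.noise r) (((M.costsLaw.prod M.movesLaw).prod M.arrivalLaw).prod (M.loadLaw r)) := by
  have h1 : MeasurePreserving (fun ω : Noise E => (ω.1, (ω.2.1, (ω.2.2.2, ω.2.2.1)))) (M.noise r)
      (M.costsLaw.prod (M.movesLaw.prod (M.arrivalLaw.prod (M.loadLaw r)))) :=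
    (MeasurePreserving.id _).prod ((MeasurePreserving.id _).prod
      (Measure.measurePreserving_swap (μ := M.loadLaw r) (ν := M.arrivalLaw)))
  have h2 := (measurePreserving_prodAssoc M.costsLaw M.movesLaw
    (M.arrivalLaw.prod (M.loadLaw r))).symm
  have h3 := (measurePreserving_prodAssoc (M.costsLaw.prod M.movesLaw) M.arrivalLaw
    (M.loadLaw r)).symm
  exact h3.comp (h2.comp h1)

/-- The loads of a period are independent of the numbers of carriers. -/
lemma exists_stateLaw_succ_eq_prod (hπ : π.IsRegular) (x₀ : State E) (t : ℕ) :
    ∃ κ : Measure (E → ℕ), IsProbabilityMeasure κ ∧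
      M.stateLaw π x₀ (t + 1) = κ.prod (M.loadLaw π.shipperPrice) := by
  have := M.isProbabilityMeasure_stateLaw hπ x₀ t
  set ν := M.stateLaw π x₀ t
  set R := (M.costsLaw.prod M.movesLaw).prod M.arrivalLaw
  -- The next numbers of carriers do not depend on the new loads, so any value, such as `0`, may
  -- stand in for them.
  let g : State E × Rest E → (E → ℕ) := fun z => (π.step z.1 (z.2.toNoise 0)).1
  have hg : Measurable g := by
    have h : Measurable fun z : State E × Rest E => (z.1, z.2.toNoise 0) := by
      unfold Rest.toNoise
      fun_prop
    exact ((Policy.measurable_step hπ).comp h).fst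
  refine ⟨(ν.prod R).map g, Measure.isProbabilityMeasure_map hg.aemeasurable, ?_⟩
  have h1 := ((measurePreserving_prodAssoc ν R (M.loadLaw π.shipperPrice)).symm).comp
    ((MeasurePreserving.id ν).prod (M.measurePreserving_rest π.shipperPrice))
  have h2 : MeasurePreserving (Prod.map g id) ((ν.prod R).prod (M.loadLaw π.shipperPrice))
      (((ν.prod R).map g).prod (M.loadLaw π.shipperPrice)) :=
    MeasurePreserving.prod ⟨hg, rfl⟩ (MeasurePreserving.id _)
  exact (h2.comp h1).map_eq

lemma integral_stateLaw_succ (hπ : π.IsRegular) (x₀ : State E) (t : ℕ) {f : State E → ℝ}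
    (hf : Integrable f (M.stateLaw π x₀ (t + 1))) :
    ∫ x, f x ∂M.stateLaw π x₀ (t + 1) =
      ∫ x, (∫ D, f (x.1, D) ∂M.loadLaw π.shipperPrice) ∂M.stateLaw π x₀ (t + 1) := by
  obtain ⟨κ, hκ, h⟩ := M.exists_stateLaw_succ_eq_prod hπ x₀ t
  rw [h] at hf ⊢
  rw [integral_prod _ hf, integral_fun_fst fun S => ∫ D, f (S, D) ∂M.loadLaw π.shipperPrice]
  simp

lemma integrable_stateLaw_succ (hπ : π.IsRegular) (x₀ : State E) (t : ℕ) {f : State E → ℝ}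
    {g : (E → ℕ) → ℝ} (hg : Integrable g (M.loadLaw π.shipperPrice))
    (hfg : ∀ x, |f x| ≤ g x.2) : Integrable f (M.stateLaw π x₀ (t + 1)) := by
  obtain ⟨κ, hκ, h⟩ := M.exists_stateLaw_succ_eq_prod hπ x₀ t
  rw [h]
  exact (hg.comp_snd κ).mono' Measurable.of_discrete.aestronglyMeasurable
    (Eventually.of_forall hfg)

/-- `push` draws the current loads from `loadLaw`, which is right only after the first transition,
as the initial loads are arbitrary; hence the shifted times. -/
lemma integral_stateLaw_eq_push (hπ : π.IsRegular) (x₀ : State E) (t : ℕ) {h : (E → ℕ) → ℝ}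
    {C : ℝ} (hC : ∀ S, |h S| ≤ C) :
    ∫ x, h x.1 ∂M.stateLaw π x₀ (t + 2) = ∫ x, M.push π h x.1 ∂M.stateLaw π x₀ (t + 1) := by
  obtain ⟨κ, hκ, hκeq⟩ := M.exists_stateLaw_succ_eq_prod hπ x₀ t
  have hm : Measurable fun x : State E => h x.1 := Measurable.of_discrete
  rw [stateLaw_succ, integral_map (Policy.measurable_step hπ).aemeasurable
    hm.aestronglyMeasurable, hκeq]
  have hstep : Measurable fun z : State E × Noise E => h (π.step z.1 z.2).1 :=
    hm.comp (Policy.measurable_step hπ)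
  rw [← integral_comp_of_measurePreserving
    (measurePreserving_prodAssoc κ (M.loadLaw π.shipperPrice) (M.noise π.shipperPrice)).symm
    hstep.aestronglyMeasurable]
  rw [integral_prod, integral_fun_fst]
  · simp only [probReal_univ, one_smul]
    rfl
  · exact Integrable.of_bound (hstep.comp (MeasurableEquiv.measurable _)).aestronglyMeasurable C
      (Eventually.of_forall fun _ => hC _)

lemma integral_stateLaw_eq_iterate_push (hπ : π.IsRegular) (x₀ : State E) (t : ℕ)
    {h : (E → ℕ) → ℝ} {C : ℝ} (hC : ∀ S, |h S| ≤ C) :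
    ∫ x, h x.1 ∂M.stateLaw π x₀ (t + 1) = ∫ x, (M.push π)^[t] h x.1 ∂M.stateLaw π x₀ 1 := by
  induction t generalizing h with
  | zero => rfl
  | succ t ih =>
    rw [M.integral_stateLaw_eq_push hπ x₀ t hC, ih (M.abs_push_le hπ hC),
      Function.iterate_succ_apply]

lemma tendsto_integral_stateLaw (hπ : π.IsRegular) (x₀ : State E) {h : (E → ℕ) → ℝ}
    {C γ : ℝ} (hC : ∀ S, |h S| ≤ C) {S₀ : E → ℕ}
    (hγ : Tendsto (fun t => (M.push π)^[t] h S₀) atTop (𝓝 γ)) :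
    Tendsto (fun t => ∫ x, h x.1 ∂M.stateLaw π x₀ (t + 1)) atTop (𝓝 γ) := by
  obtain ⟨γ', hγ'⟩ := M.exists_abs_iterate_push_sub_le hπ hC
  have hlim : Tendsto (fun t => (M.push π)^[t] h S₀) atTop (𝓝 γ') := by
    refine tendsto_iff_dist_tendsto_zero.2 ?_
    exact squeeze_zero (fun _ => dist_nonneg) (fun t => hγ' t S₀) (M.tendsto_geometric _ _)
  rw [tendsto_nhds_unique hγ hlim]
  refine tendsto_iff_dist_tendsto_zero.2
    (squeeze_zero (fun _ => dist_nonneg) (fun t => ?_) (M.tendsto_geometric π.shipperPrice (2 * C)))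
  have := M.isProbabilityMeasure_stateLaw hπ x₀ 1
  rw [M.integral_stateLaw_eq_iterate_push hπ x₀ t hC, Real.dist_eq]
  have h1 : ∫ x, (M.push π)^[t] h x.1 ∂M.stateLaw π x₀ 1 - γ' =
      ∫ x, ((M.push π)^[t] h x.1 - γ') ∂M.stateLaw π x₀ 1 := by
    rw [integral_sub _ (integrable_const γ')]
    · simp
    · exact Integrable.of_bound Measurable.of_discrete.aestronglyMeasurable C
        (Eventually.of_forall fun x => M.abs_iterate_push_le hπ hC t x.1)
  rw [h1, ← Real.norm_eq_abs]
  refine (norm_integral_le_of_norm_le_const (Eventually.of_forall fun x => hγ' t x.1)).trans ?_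
  simp

/-! ### Expected served loads, payments and profits -/

/-- The expected number of loads served on lane `e`, given the numbers of carriers. -/
noncomputable def meanServed (π : Policy E) (e : E) (S : E → ℕ) : ℝ :=
  ∫ w, (π.served (S, w.1) w.2 e : ℝ) ∂M.periodLaw π.shipperPrice

/-- The expected payment on lane `e`, given the numbers of carriers. -/
noncomputable def meanPayment (π : Policy E) (e : E) (S : E → ℕ) : ℝ :=
  ∫ w, π.payment (S, w.1) w.2 e ∂M.periodLaw π.shipperPrice

/-- The expected profit of a period, given the numbers of carriers. -/
noncomputable def meanProfit (π : Policy E) (S : E → ℕ) : ℝ :=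
  ∑ e, (π.shipperPrice e * M.demand e (π.shipperPrice e)
    - M.penalty e * (M.demand e (π.shipperPrice e) - M.meanServed π e S) - M.meanPayment π e S)

lemma integrable_load_period (r : E → ℝ) (e : E) :
    Integrable (fun w : (E → ℕ) × Noise E => (w.1 e : ℝ)) (M.periodLaw r) :=
  (M.integrable_load r e).comp_fst _

lemma integral_load_period {r : E → ℝ} {e : E} (hd : 0 ≤ M.demand e (r e)) :
    ∫ w, (w.1 e : ℝ) ∂M.periodLaw r = M.demand e (r e) := by
  rw [periodLaw, integral_fun_fst fun D : E → ℕ => (D e : ℝ)]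
  simp [M.integral_load hd]

lemma measurable_served_cast (hπ : π.IsRegular) (x : State E) (e : E) :
    Measurable fun ω => (π.served x ω e : ℝ) :=
  measurable_from_top.comp (Policy.measurable_served hπ x e)

lemma integrable_served (hπ : π.IsRegular) (x : State E) (r : E → ℝ) (e : E) :
    Integrable (fun ω => (π.served x ω e : ℝ)) (M.noise r) := by
  refine Integrable.of_bound (measurable_served_cast hπ x e).aestronglyMeasurable (x.2 e : ℝ)
    (Eventually.of_forall fun ω => ?_)
  rw [Real.norm_eq_abs, Nat.abs_cast]
  exact_mod_cast Policy.served_le hπ x ω e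

lemma integrable_served_period (hπ : π.IsRegular) (S : E → ℕ) (r : E → ℝ) (e : E) :
    Integrable (fun w : (E → ℕ) × Noise E => (π.served (S, w.1) w.2 e : ℝ)) (M.periodLaw r) := by
  refine (M.integrable_load_period r e).mono'
    (measurable_of_state (f := fun x ω => (π.served x ω e : ℝ))
      (fun x => measurable_served_cast hπ x e) S).aestronglyMeasurable
    (Eventually.of_forall fun w => ?_)
  rw [Real.norm_eq_abs, Nat.abs_cast]
  exact_mod_cast Policy.served_le hπ (S, w.1) w.2 e

lemma exists_abs_payment_le (hπ : π.IsRegular) :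
    ∃ B : ℝ, 0 ≤ B ∧ ∀ r : E → ℝ, ∀ᵐ ω ∂M.noise r, ∀ x e, |π.payment x ω e| ≤ B * x.2 e := by
  choose B hB0 hB using fun e => (hπ e).bound
  refine ⟨∑ e, B e, Finset.sum_nonneg fun e _ => hB0 e, fun r => ?_⟩
  have h : ∀ᵐ ω ∂M.noise r, ∀ e s, 0 ≤ ω.1 e s :=
    ae_all_iff.2 fun e => (M.measurePreserving_cost r e).quasiMeasurePreserving.ae
      (M.cost e).ae_costLaw_nonneg
  filter_upwards [h] with ω hω x e
  refine (hB e _ _ _ fun s => hω e s).trans ?_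
  gcongr
  exact Finset.single_le_sum (f := B) (fun e _ => hB0 e) (Finset.mem_univ e)

lemma integrable_payment (hπ : π.IsRegular) (x : State E) (r : E → ℝ) (e : E) :
    Integrable (fun ω => π.payment x ω e) (M.noise r) := by
  obtain ⟨B, _, hB⟩ := M.exists_abs_payment_le hπ
  refine Integrable.of_bound (Policy.measurable_payment hπ x e).aestronglyMeasurable (B * x.2 e) ?_
  filter_upwards [hB r] with ω hω using hω x e

lemma integrable_payment_period (hπ : π.IsRegular) (S : E → ℕ) (r : E → ℝ) (e : E) :
    Integrable (fun w : (E → ℕ) × Noise E => π.payment (S, w.1) w.2 e) (M.periodLaw r) := by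
  obtain ⟨B, _, hB⟩ := M.exists_abs_payment_le hπ
  refine ((M.integrable_load_period r e).const_mul B).mono'
    (measurable_of_state (f := fun x ω => π.payment x ω e)
      (fun x => Policy.measurable_payment hπ x e) S).aestronglyMeasurable ?_
  have h : ∀ᵐ w ∂M.periodLaw r, ∀ x e, |π.payment x w.2 e| ≤ B * x.2 e :=
    (measurePreserving_snd (μ := M.loadLaw r) (ν := M.noise r)).quasiMeasurePreserving.ae (hB r)
  filter_upwards [h] with w hw using hw (S, w.1) e

lemma meanServed_nonneg (e : E) (S : E → ℕ) : 0 ≤ M.meanServed π e S :=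
  integral_nonneg fun _ => Nat.cast_nonneg _

lemma meanServed_le (hπ : π.IsRegular) {e : E} (hd : 0 ≤ M.demand e (π.shipperPrice e))
    (S : E → ℕ) : M.meanServed π e S ≤ M.demand e (π.shipperPrice e) := by
  rw [← M.integral_load_period hd]
  refine integral_mono (M.integrable_served_period hπ S _ e) (M.integrable_load_period _ e)
    fun w => Nat.cast_le.2 (Policy.served_le hπ (S, w.1) w.2 e)

lemma abs_meanServed_le (hπ : π.IsRegular) {e : E} (hd : 0 ≤ M.demand e (π.shipperPrice e))
    (S : E → ℕ) : |M.meanServed π e S| ≤ M.demand e (π.shipperPrice e) := by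
  rw [abs_of_nonneg (M.meanServed_nonneg e S)]
  exact M.meanServed_le hπ hd S

lemma exists_abs_meanPayment_le (hπ : π.IsRegular)
    (hd : ∀ e, 0 ≤ M.demand e (π.shipperPrice e)) :
    ∃ C, ∀ e S, |M.meanPayment π e S| ≤ C * M.demand e (π.shipperPrice e) := by
  obtain ⟨B, _, hB⟩ := M.exists_abs_payment_le hπ
  refine ⟨B, fun e S => ?_⟩
  rw [← M.integral_load_period (hd e), ← integral_const_mul, ← Real.norm_eq_abs]
  refine norm_integral_le_of_norm_le ((M.integrable_load_period _ e).const_mul B) ?_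
  have h : ∀ᵐ w ∂M.periodLaw π.shipperPrice, ∀ x e, |π.payment x w.2 e| ≤ B * x.2 e :=
    (measurePreserving_snd (μ := M.loadLaw π.shipperPrice)
      (ν := M.noise π.shipperPrice)).quasiMeasurePreserving.ae (hB _)
  filter_upwards [h] with w hw using hw (S, w.1) e

lemma exists_abs_meanProfit_le (hπ : π.IsRegular)
    (hd : ∀ e, 0 ≤ M.demand e (π.shipperPrice e)) :
    ∃ C, ∀ S, |M.meanProfit π S| ≤ C := by
  obtain ⟨B, hB⟩ := M.exists_abs_meanPayment_le hπ hd
  refine ⟨∑ e, (|π.shipperPrice e * M.demand e (π.shipperPrice e)|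
    + |M.penalty e| * (M.demand e (π.shipperPrice e) + M.demand e (π.shipperPrice e))
    + B * M.demand e (π.shipperPrice e)), fun S => ?_⟩
  refine (Finset.abs_sum_le_sum_abs _ _).trans (Finset.sum_le_sum fun e _ => ?_)
  refine (abs_sub _ _).trans (add_le_add ((abs_sub _ _).trans (add_le_add le_rfl ?_)) (hB e S))
  rw [abs_mul]
  refine mul_le_mul_of_nonneg_left ((abs_sub _ _).trans ?_) (abs_nonneg _)
  rw [abs_of_nonneg (hd e)]
  exact add_le_add le_rfl (M.abs_meanServed_le hπ (hd e) S)

lemma stageProfit_eq (hπ : π.IsRegular) (x : State E) :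
    M.stageProfit π x = ∑ e, (π.shipperPrice e * M.demand e (π.shipperPrice e)
      - M.penalty e * (x.2 e - ∫ ω, (π.served x ω e : ℝ) ∂M.noise π.shipperPrice)
      - ∫ ω, π.payment x ω e ∂M.noise π.shipperPrice) := by
  have h1 := fun e => M.integrable_served hπ x π.shipperPrice e
  have h2 := fun e => M.integrable_payment hπ x π.shipperPrice e
  have h0 := fun e => integrable_const (μ := M.noise π.shipperPrice) (x.2 e : ℝ)
  rw [stageProfit, integral_finsetSum _ fun e _ => integrable_profit (h0 e) (h1 e) (h2 e) _ _]
  refine Finset.sum_congr rfl fun e _ => ?_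
  rw [integral_profit (h0 e) (h1 e) (h2 e)]
  simp

lemma integrable_stageProfit_aux (hπ : π.IsRegular) :
    ∃ g : (E → ℕ) → ℝ, Integrable g (M.loadLaw π.shipperPrice) ∧
      ∀ x, |M.stageProfit π x| ≤ g x.2 := by
  obtain ⟨B, hB0, hB⟩ := M.exists_abs_payment_le hπ
  refine ⟨fun D => ∑ e, (|π.shipperPrice e * M.demand e (π.shipperPrice e)|
    + M.penalty e * D e + B * D e), integrable_finsetSum _ fun e _ => ?_, fun x => ?_⟩
  · have h := M.integrable_load π.shipperPrice e
    exact ((integrable_const _).add (h.const_mul _)).add (h.const_mul _)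
  · rw [M.stageProfit_eq hπ]
    refine (Finset.abs_sum_le_sum_abs _ _).trans (Finset.sum_le_sum fun e _ => ?_)
    refine (abs_sub _ _).trans (add_le_add ((abs_sub _ _).trans (add_le_add le_rfl ?_)) ?_)
    · have h0 : 0 ≤ ∫ ω, (π.served x ω e : ℝ) ∂M.noise π.shipperPrice :=
        integral_nonneg fun _ => Nat.cast_nonneg _
      have h1 : ∫ ω, (π.served x ω e : ℝ) ∂M.noise π.shipperPrice ≤ x.2 e := by
        refine (integral_mono (M.integrable_served hπ x _ e) (integrable_const (x.2 e : ℝ))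
          fun ω => Nat.cast_le.2 (Policy.served_le hπ x ω e)).trans (by simp)
      rw [abs_of_nonneg (mul_nonneg (M.penalty_nonneg e) (by linarith))]
      exact mul_le_mul_of_nonneg_left (by linarith) (M.penalty_nonneg e)
    · rw [← Real.norm_eq_abs]
      refine (norm_integral_le_of_norm_le_const (C := B * x.2 e) ?_).trans (by simp)
      filter_upwards [hB π.shipperPrice] with ω hω using hω x e

lemma integral_stageProfit (hπ : π.IsRegular) (hd : ∀ e, 0 ≤ M.demand e (π.shipperPrice e))
    (S : E → ℕ) :
    ∫ D, M.stageProfit π (S, D) ∂M.loadLaw π.shipperPrice = M.meanProfit π S := by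
  have h1 := fun e => M.integrable_served_period hπ S π.shipperPrice e
  have h2 := fun e => M.integrable_payment_period hπ S π.shipperPrice e
  have h1' := fun e => (h1 e).integral_prod_left
  have h2' := fun e => (h2 e).integral_prod_left
  have hl := fun e => M.integrable_load π.shipperPrice e
  simp only [M.stageProfit_eq hπ]
  rw [integral_finsetSum _ fun e _ => integrable_profit (hl e) (h1' e) (h2' e) _ _]
  refine Finset.sum_congr rfl fun e _ => ?_
  rw [integral_profit (hl e) (h1' e) (h2' e), M.integral_load (hd e), meanServed, meanPayment,
    periodLaw, integral_prod _ (h1 e), integral_prod _ (h2 e)]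

/-- The long-run average profit is the limit of the expected profit of a period. -/
lemma isLongRunProfit_of_tendsto (hπ : π.IsRegular)
    (hd : ∀ e, 0 ≤ M.demand e (π.shipperPrice e)) {γ : ℝ} {S₀ : E → ℕ}
    (hγ : Tendsto (fun t => (M.push π)^[t] (M.meanProfit π) S₀) atTop (𝓝 γ)) :
    M.IsLongRunProfit π γ := by
  intro x₀
  obtain ⟨C, hC⟩ := M.exists_abs_meanProfit_le hπ hd
  obtain ⟨g, hg, hgf⟩ := M.integrable_stageProfit_aux hπ
  have h1 : Tendsto (fun t => ∫ x, M.stageProfit π x ∂M.stateLaw π x₀ (t + 1)) atTop (𝓝 γ) := by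
    refine (M.tendsto_integral_stateLaw hπ x₀ hC hγ).congr fun t => ?_
    rw [M.integral_stateLaw_succ hπ x₀ t (M.integrable_stateLaw_succ hπ x₀ t hg hgf)]
    simp only [M.integral_stageProfit hπ hd]
  -- Cesàro means inherit the limit, and the first period does not matter.
  have h2 := ((tendsto_add_atTop_iff_nat (f := fun t => ∫ x, M.stageProfit π x ∂M.stateLaw π x₀ t) 1).1
    h1).cesaro
  refine h2.congr fun T => ?_
  rw [div_eq_inv_mul]

end Market
end Freight

/-! ### Monotone comparison of policies, applied to SP, HYB and AUC. -/

namespace Freight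

variable {N : Type*} [Fintype N] [DecidableEq N] {E : Finset (N × N)}

lemma card_accepting_head (p : ℝ) (n : ℕ) (c : ℕ → ℝ) :
    (accepting p (head n c)).card = successes (Set.Iic p) n c := by
  classical
  rw [card_accepting, successes, Finset.card_filter]
  simp only [head, Set.mem_Iic]
  exact Fin.sum_univ_eq_sum_range (fun s => if c s ≤ p then 1 else 0) n

namespace Policy

variable {π π' : Policy E}

lemma step_congr (h : ∀ x ω e, π.served x ω e = π'.served x ω e) (x : State E) (ω : Noise E) :
    π.step x ω = π'.step x ω := by
  simp only [step, staying_eq, h]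

lemma staying_le_staying {x x' : State E} {ω : Noise E}
    (h : ∀ e, π.served x ω e ≤ π'.served x' ω e) (e : E) :
    π.staying x ω e ≤ π'.staying x' ω e := by
  rw [staying_eq, staying_eq]
  exact successes_mono _ _ (Finset.sum_le_sum fun e' _ => h e')

end Policy

namespace Market

variable (M : Market N E) {π π' : Policy E}

/-! ### Monotonicity of the transition operator -/

lemma push_mono (hπ : π.IsRegular) {h h' : (E → ℕ) → ℝ} {C C' : ℝ} (hC : ∀ S, |h S| ≤ C)
    (hC' : ∀ S, |h' S| ≤ C') (hle : ∀ S, h S ≤ h' S) (S : E → ℕ) :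
    M.push π h S ≤ M.push π h' S :=
  integral_mono (M.integrable_comp_next hπ hC S) (M.integrable_comp_next hπ hC' S) fun _ => hle _

lemma iterate_push_mono (hπ : π.IsRegular) {h h' : (E → ℕ) → ℝ} {C C' : ℝ} (hC : ∀ S, |h S| ≤ C)
    (hC' : ∀ S, |h' S| ≤ C') (hle : ∀ S, h S ≤ h' S) (t : ℕ) (S : E → ℕ) :
    (M.push π)^[t] h S ≤ (M.push π)^[t] h' S := by
  induction t generalizing S with
  | zero => exact hle S
  | succ t ih =>
    rw [Function.iterate_succ_apply', Function.iterate_succ_apply']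
    exact M.push_mono hπ (M.abs_iterate_push_le hπ hC t) (M.abs_iterate_push_le hπ hC' t) ih S

/-- If the policy `π'` serves at least as many loads as `π`, also with more carriers, then the
numbers of carriers are ordered too. -/
lemma next_le_next (h : ∀ x x' ω e, x.1 ≤ x'.1 → x.2 = x'.2 →
    π.served x ω e ≤ π'.served x' ω e) {S S' : E → ℕ} (hS : S ≤ S') (w : (E → ℕ) × Noise E) :
    next π S w ≤ next π' S' w := fun e =>
  Nat.add_le_add_right
    (Policy.staying_le_staying (fun e' => h (S, w.1) (S', w.1) w.2 e' hS rfl) e) _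

lemma push_le_push (hπ : π.IsRegular) (hπ' : π'.IsRegular)
    (hr : π.shipperPrice = π'.shipperPrice)
    (h : ∀ x x' ω e, x.1 ≤ x'.1 → x.2 = x'.2 → π.served x ω e ≤ π'.served x' ω e)
    {f : (E → ℕ) → ℝ} {C : ℝ} (hC : ∀ S, |f S| ≤ C) (hf : Monotone f) {S S' : E → ℕ}
    (hS : S ≤ S') : M.push π f S ≤ M.push π' f S' := by
  have h1 := M.integrable_comp_next hπ' hC S'
  rw [← hr] at h1
  rw [push, push, ← hr]
  exact integral_mono (M.integrable_comp_next hπ hC S) h1 fun w => hf (next_le_next h hS w)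

/-- Comparison of two policies: the policy that serves more loads and earns more in each period
earns more in the long run, if more carriers are better for the other one. -/
lemma iterate_push_le_iterate_push (hπ : π.IsRegular) (hπ' : π'.IsRegular)
    (hr : π.shipperPrice = π'.shipperPrice)
    (hm : ∀ x x' ω e, x.1 ≤ x'.1 → x.2 = x'.2 → π.served x ω e ≤ π.served x' ω e)
    (h : ∀ x x' ω e, x.1 ≤ x'.1 → x.2 = x'.2 → π.served x ω e ≤ π'.served x' ω e)
    {f f' : (E → ℕ) → ℝ} {C C' : ℝ} (hC : ∀ S, |f S| ≤ C) (hC' : ∀ S, |f' S| ≤ C')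
    (hf : Monotone f) (hff' : ∀ S, f S ≤ f' S) (t : ℕ) :
    Monotone ((M.push π)^[t] f) ∧ ∀ S, (M.push π)^[t] f S ≤ (M.push π')^[t] f' S := by
  induction t with
  | zero => exact ⟨hf, hff'⟩
  | succ t ih =>
    simp only [Function.iterate_succ_apply']
    have hCt := M.abs_iterate_push_le hπ hC t
    refine ⟨fun S S' hS => M.push_le_push hπ hπ rfl hm hCt ih.1 hS, fun S => ?_⟩
    -- The chain is changed first, which uses that the iterate of `f` is monotone, and the function
    -- second.
    exact (M.push_le_push hπ hπ' hr h hCt ih.1 le_rfl).trans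
      (M.push_mono hπ' hCt (M.abs_iterate_push_le hπ' hC' t) ih.2 S)

/-! ### Expected profits on a lane -/

/-- Conditioning on the loads reduces the comparison of policies to the comparison of mechanisms on
one lane with given numbers of carriers and loads. -/
lemma integral_margin (hπ : π.IsRegular) (b : ℝ) (e : E) (S : E → ℕ) :
    b * M.meanServed π e S - M.meanPayment π e S =
      ∫ D, (∫ c, (b * (((π.carrier e).alloc (S e) (D e) (head (S e) c)).card : ℝ)
        - ∑ s, (π.carrier e).pay (S e) (D e) (head (S e) c) s) ∂(M.cost e).costLaw)
        ∂M.loadLaw π.shipperPrice := by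
  have h1 := (M.integrable_served_period hπ S π.shipperPrice e).const_mul b
  have h2 := M.integrable_payment_period hπ S π.shipperPrice e
  rw [meanServed, meanPayment, ← integral_const_mul, ← integral_sub h1 h2, periodLaw,
    integral_prod (fun w : (E → ℕ) × Noise E => b * (π.served (S, w.1) w.2 e : ℝ)
      - π.payment (S, w.1) w.2 e) (h1.sub h2)]
  refine integral_congr_ae (Eventually.of_forall fun D => ?_)
  refine integral_comp_of_measurePreserving (M.measurePreserving_cost π.shipperPrice e)
    (g := fun c => b * (((π.carrier e).alloc (S e) (D e) (head (S e) c)).card : ℝ)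
        - ∑ s, (π.carrier e).pay (S e) (D e) (head (S e) c) s)
    (Measurable.aestronglyMeasurable ?_)
  have h3 : Measurable fun c => (((π.carrier e).alloc (S e) (D e) (head (S e) c)).card : ℝ) :=
    measurable_from_top.comp (((hπ e).measurable_card _ _).comp (measurable_head _))
  exact (h3.const_mul b).sub (((hπ e).measurable_pay _ _).comp (measurable_head _))

lemma integrable_integral_margin (hπ : π.IsRegular) (b : ℝ) (e : E) (S : E → ℕ) :
    Integrable (fun D => ∫ c, (b * (((π.carrier e).alloc (S e) (D e) (head (S e) c)).card : ℝ)
        - ∑ s, (π.carrier e).pay (S e) (D e) (head (S e) c) s) ∂(M.cost e).costLaw)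
        (M.loadLaw π.shipperPrice) := by
  have h1 := (M.integrable_served_period hπ S π.shipperPrice e).const_mul b
  have h2 := M.integrable_payment_period hπ S π.shipperPrice e
  refine ((h1.sub h2).integral_prod_left).congr (Eventually.of_forall fun D => ?_)
  refine integral_comp_of_measurePreserving (M.measurePreserving_cost π.shipperPrice e)
    (g := fun c => b * (((π.carrier e).alloc (S e) (D e) (head (S e) c)).card : ℝ)
        - ∑ s, (π.carrier e).pay (S e) (D e) (head (S e) c) s)
    (Measurable.aestronglyMeasurable ?_)
  have h3 : Measurable fun c => (((π.carrier e).alloc (S e) (D e) (head (S e) c)).card : ℝ) :=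
    measurable_from_top.comp (((hπ e).measurable_card _ _).comp (measurable_head _))
  exact (h3.const_mul b).sub (((hπ e).measurable_pay _ _).comp (measurable_head _))

/-- Comparison of the expected profits of two policies, given the numbers of carriers. -/
lemma meanProfit_le_meanProfit (hπ : π.IsRegular) (hπ' : π'.IsRegular)
    (hr : π.shipperPrice = π'.shipperPrice)
    (h : ∀ e n D,
      ∫ c, (M.penalty e * (((π.carrier e).alloc n D (head n c)).card : ℝ)
          - ∑ s, (π.carrier e).pay n D (head n c) s) ∂(M.cost e).costLaw ≤
        ∫ c, (M.penalty e * (((π'.carrier e).alloc n D (head n c)).card : ℝ)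
          - ∑ s, (π'.carrier e).pay n D (head n c) s) ∂(M.cost e).costLaw) (S : E → ℕ) :
    M.meanProfit π S ≤ M.meanProfit π' S := by
  refine Finset.sum_le_sum fun e _ => ?_
  have h1 := M.integral_margin hπ (M.penalty e) e S
  have h2 := M.integral_margin hπ' (M.penalty e) e S
  have h3 := M.integrable_integral_margin hπ' (M.penalty e) e S
  rw [← hr] at h2 h3 ⊢
  have h4 := integral_mono (M.integrable_integral_margin hπ (M.penalty e) e S) h3
    fun D => h e (S e) (D e)
  linarith

/-! ### The three mechanisms -/

variable {M} {z : FluidPoint E}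

namespace FluidFeasible

lemma lam_pos (hz : M.FluidFeasible z) (e : E) : 0 < z.lam e := by
  rw [← hz.flow e]
  exact add_pos_of_nonneg_of_pos
    (Finset.sum_nonneg fun e' _ => mul_nonneg (M.stay_nonneg e) (hz.y_nonneg e')) (M.arrival_pos e)

lemma demand_shipperPrice (hz : M.FluidFeasible z) (e : E) :
    M.demand e (M.shipperPrice z e) = z.d e :=
  Function.invFunOn_eq (hz.d_mem e)

lemma F_carrierPrice (hz : M.FluidFeasible z) (e : E) :
    (M.cost e).F (M.carrierPrice z e) = z.y e / z.lam e :=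
  (M.cost e).F_Finv (hz.x_mem e)

lemma demand_nonneg (hz : M.FluidFeasible z) (e : E) :
    0 ≤ M.demand e (M.shipperPrice z e) := by
  rw [hz.demand_shipperPrice]; exact hz.d_nonneg e

end FluidFeasible

lemma carrierPrice_nonneg (M : Market N E) (z : FluidPoint E) (e : E) : 0 ≤ M.carrierPrice z e :=
  (M.cost e).Finv_nonneg _

lemma carrierPrice_le_reservePrice (M : Market N E) (z : FluidPoint E) (e : E) :
    M.carrierPrice z e ≤ M.reservePrice z e := le_max_right _ _

lemma reservePrice_nonneg (M : Market N E) (z : FluidPoint E) (e : E) : 0 ≤ M.reservePrice z e :=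
  (M.carrierPrice_nonneg z e).trans (M.carrierPrice_le_reservePrice z e)

lemma isRegular_SP (M : Market N E) (z : FluidPoint E) : (M.SP z).IsRegular := fun e =>
  isRegular_spMechanism (M.carrierPrice_nonneg z e)

lemma isRegular_AUC (M : Market N E) (z : FluidPoint E) : (M.AUC z).IsRegular := fun e =>
  isRegular_aucMechanism (M.reservePrice_nonneg z e)

lemma isRegular_HYB (M : Market N E) (z : FluidPoint E) : (M.HYB z).IsRegular := fun e =>
  isRegular_hybMechanism (M.carrierPrice_nonneg z e) (M.carrierPrice_le_reservePrice z e)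

lemma served_SP (M : Market N E) (z : FluidPoint E) (x : State E) (ω : Noise E) (e : E) :
    (M.SP z).served x ω e =
      min (x.2 e) (successes (Set.Iic (M.carrierPrice z e)) (x.1 e) (ω.1 e)) := by
  rw [← card_accepting_head]; exact card_spAlloc _ _ _

lemma served_AUC (M : Market N E) (z : FluidPoint E) (x : State E) (ω : Noise E) (e : E) :
    (M.AUC z).served x ω e =
      min (x.2 e) (successes (Set.Iic (M.reservePrice z e)) (x.1 e) (ω.1 e)) := by
  rw [← card_accepting_head]; exact card_aucAlloc _ _ _

lemma served_HYB (M : Market N E) (z : FluidPoint E) (x : State E) (ω : Noise E) (e : E) :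
    (M.HYB z).served x ω e =
      min (x.2 e) (successes (Set.Iic (M.reservePrice z e)) (x.1 e) (ω.1 e)) := by
  rw [← card_accepting_head]; exact card_hybAlloc (M.carrierPrice_le_reservePrice z e) _ _

/-- Next moves depend on how many carriers deliver, not on which ones, so equal numbers of served
loads give the same chain. -/
lemma push_AUC (M : Market N E) (z : FluidPoint E) : M.push (M.AUC z) = M.push (M.HYB z) := by
  have h : ∀ x ω, (M.AUC z).step x ω = (M.HYB z).step x ω :=
    Policy.step_congr fun x ω e => by rw [served_AUC, served_HYB]
  funext f S
  simp only [push, next, h]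
  rfl

lemma served_SP_mono (M : Market N E) (z : FluidPoint E) {x x' : State E} (ω : Noise E) (e : E)
    (h1 : x.1 ≤ x'.1) (h2 : x.2 = x'.2) : (M.SP z).served x ω e ≤ (M.SP z).served x' ω e := by
  rw [served_SP, served_SP, h2]
  exact min_le_min le_rfl (successes_mono _ _ (h1 e))

lemma served_SP_le_served_HYB (M : Market N E) (z : FluidPoint E) {x x' : State E} (ω : Noise E)
    (e : E) (h1 : x.1 ≤ x'.1) (h2 : x.2 = x'.2) :
    (M.SP z).served x ω e ≤ (M.HYB z).served x' ω e := by
  classical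
  rw [served_SP, served_HYB, h2]
  refine min_le_min le_rfl ((successes_mono _ _ (h1 e)).trans (Finset.card_le_card ?_))
  exact Finset.monotone_filter_right _ fun m _ hm =>
    Set.Iic_subset_Iic.2 (M.carrierPrice_le_reservePrice z e) hm

lemma meanProfit_HYB_le_AUC (M : Market N E) (z : FluidPoint E) (S : E → ℕ) :
    M.meanProfit (M.HYB z) S ≤ M.meanProfit (M.AUC z) S := by
  refine Finset.sum_le_sum fun e _ => ?_
  have h1 : M.meanServed (M.HYB z) e S = M.meanServed (M.AUC z) e S := by
    simp only [meanServed, served_AUC, served_HYB]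
    rfl
  have h2 : M.meanPayment (M.AUC z) e S ≤ M.meanPayment (M.HYB z) e S :=
    integral_mono (M.integrable_payment_period (M.isRegular_AUC z) S _ e)
      (M.integrable_payment_period (M.isRegular_HYB z) S _ e)
      fun w => sum_aucPay_le_sum_hybPay (M.carrierPrice_le_reservePrice z e) _ _
  rw [h1]
  exact sub_le_sub_left h2 _

lemma meanProfit_SP_le_HYB (M : Market N E) (z : FluidPoint E) (S : E → ℕ) :
    M.meanProfit (M.SP z) S ≤ M.meanProfit (M.HYB z) S :=
  M.meanProfit_le_meanProfit (M.isRegular_SP z) (M.isRegular_HYB z) rfl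
    (fun e n D => (M.cost e).integral_sp_le_integral_hyb (M.carrierPrice_nonneg z e) rfl n D) S

lemma meanPayment_SP (M : Market N E) (z : FluidPoint E) (e : E) (S : E → ℕ) :
    M.meanPayment (M.SP z) e S = M.carrierPrice z e * M.meanServed (M.SP z) e S := by
  rw [meanPayment, meanServed, ← integral_const_mul]
  refine integral_congr_ae (Eventually.of_forall fun w => ?_)
  exact card_filter_sum_pay _ _ _

lemma meanProfit_SP (M : Market N E) (z : FluidPoint E) (S : E → ℕ) :
    M.meanProfit (M.SP z) S = ∑ e, (M.shipperPrice z e * M.demand e (M.shipperPrice z e)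
      - M.penalty e * M.demand e (M.shipperPrice z e)
      + (M.penalty e - M.carrierPrice z e) * M.meanServed (M.SP z) e S) := by
  refine Finset.sum_congr rfl fun e _ => ?_
  rw [meanPayment_SP]
  simp only [SP]
  ring

lemma measurePreserving_cost_period (M : Market N E) (r : E → ℝ) (e : E) :
    MeasurePreserving (fun w : (E → ℕ) × Noise E => w.2.1 e) (M.periodLaw r) (M.cost e).costLaw :=
  (M.measurePreserving_cost r e).comp measurePreserving_snd

/-- Here `F p* = 0`, so almost surely nobody accepts. This is why `p* ≤ b` is needed only on lanes
that the fluid solution uses. -/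
lemma meanServed_SP_eq_zero (hz : M.FluidFeasible z) {e : E} (he : z.y e = 0) (S : E → ℕ) :
    M.meanServed (M.SP z) e S = 0 := by
  refine le_antisymm ?_ (M.meanServed_nonneg e S)
  have hm : Measurable fun c => (successes (Set.Iic (M.carrierPrice z e)) (S e) c : ℝ) :=
    measurable_from_top.comp (measurable_successes measurableSet_Iic _)
  have hi : Integrable (fun w : (E → ℕ) × Noise E =>
      (successes (Set.Iic (M.carrierPrice z e)) (S e) (w.2.1 e) : ℝ))
      (M.periodLaw (M.shipperPrice z)) := by
    refine Integrable.of_bound (hm.comp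
      (M.measurePreserving_cost_period (M.shipperPrice z) e).measurable).aestronglyMeasurable (S e : ℝ)
      (Eventually.of_forall fun w => ?_)
    rw [Real.norm_eq_abs, Nat.abs_cast]
    exact_mod_cast successes_le _ _ _
  refine (integral_mono (M.integrable_served_period (M.isRegular_SP z) S _ e) hi
    fun w => ?_).trans ?_
  · dsimp only
    rw [served_SP]
    exact_mod_cast min_le_right _ _
  · rw [integral_comp_of_measurePreserving (M.measurePreserving_cost_period (M.shipperPrice z) e)
      (g := fun c => (successes (Set.Iic (M.carrierPrice z e)) (S e) c : ℝ))
      hm.aestronglyMeasurable, CostDistribution.costLaw, integral_successes _ measurableSet_Iic,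
      ← CostDistribution.F_eq, hz.F_carrierPrice, he]
    simp

lemma monotone_meanServed_SP (M : Market N E) (z : FluidPoint E) (e : E) :
    Monotone (M.meanServed (M.SP z) e) := fun S S' hS =>
  integral_mono (M.integrable_served_period (M.isRegular_SP z) S _ e)
    (M.integrable_served_period (M.isRegular_SP z) S' _ e)
    fun w => Nat.cast_le.2 (M.served_SP_mono z (x := (S, w.1)) (x' := (S', w.1)) w.2 e hS rfl)

lemma monotone_meanProfit_SP (hz : M.FluidFeasible z)
    (hp : ∀ e, 0 < z.y e → M.carrierPrice z e ≤ M.penalty e) :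
    Monotone (M.meanProfit (M.SP z)) := by
  intro S S' hS
  rw [meanProfit_SP, meanProfit_SP]
  refine Finset.sum_le_sum fun e _ => ?_
  rcases (hz.y_nonneg e).eq_or_lt with he | he
  · rw [meanServed_SP_eq_zero hz he.symm, meanServed_SP_eq_zero hz he.symm]
  · have := mul_le_mul_of_nonneg_left (M.monotone_meanServed_SP z e hS) (sub_nonneg.2 (hp e he))
    linarith

end Market
end Freight

/-! ### Mean and fluctuation of the flow of carriers. -/

namespace Freight

variable {N : Type*} [Fintype N] [DecidableEq N] {E : Finset (N × N)}

namespace Market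

variable (M : Market N E) {π : Policy E}

/-! ### The flow of carriers -/

lemma moveLaw_take (e : E) : (M.moveLaw e.1.1).real {NextMove.take e} = M.stay e := by
  classical
  have h : ∀ e' : E, (Measure.dirac (NextMove.take e') : Measure (NextMove E))
      {NextMove.take e} = if e' = e then 1 else 0 := fun e' => by
    rw [Measure.dirac_apply' _ MeasurableSpace.measurableSet_top, Set.indicator_apply]
    simp
  have h' : (Measure.dirac NextMove.leave : Measure (NextMove E)) {NextMove.take e} = 0 := by
    rw [Measure.dirac_apply' _ MeasurableSpace.measurableSet_top]
    simp
  rw [measureReal_def, moveLaw]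
  simp only [Measure.coe_add, Pi.add_apply, Measure.coe_finsetSum, Finset.sum_apply,
    Measure.smul_apply, smul_eq_mul, h, h', mul_ite, mul_one, mul_zero, add_zero]
  rw [Finset.sum_ite_eq' _ e, if_pos (by simp), ENNReal.toReal_ofReal (M.stay_nonneg e)]

/-- Loads and costs determine how many carriers deliver at `i`, and the moves from `i` are
independent of them. Given that number, the carriers who go on are thus a count of independent
trials. -/
lemma measurePreserving_moves (r : E → ℝ) (i : N) :
    MeasurePreserving (fun w : (E → ℕ) × Noise E => ((w.1, w.2.1), w.2.2.1 i)) (M.periodLaw r)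
      (((M.loadLaw r).prod M.costsLaw).prod (Measure.infinitePi fun _ : ℕ => M.moveLaw i)) := by
  have h1 := (measurePreserving_prodAssoc (M.loadLaw r) M.costsLaw
    (M.movesLaw.prod ((M.loadLaw r).prod M.arrivalLaw))).symm
  have h2 : MeasurePreserving (fun u : N → ℕ → NextMove E => u i) M.movesLaw
      (Measure.infinitePi fun _ : ℕ => M.moveLaw i) :=
    measurePreserving_eval_infinitePi (fun i => Measure.infinitePi fun _ : ℕ => M.moveLaw i) i
  exact ((MeasurePreserving.id _).prod (h2.comp measurePreserving_fst)).comp h1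

lemma measurePreserving_arrivals (r : E → ℝ) (e : E) :
    MeasurePreserving (fun w : (E → ℕ) × Noise E => w.2.2.2.2 e) (M.periodLaw r)
      (poissonMeasure (M.arrival e).toNNReal) :=
  (M.measurePreserving_arrival e).comp (measurePreserving_snd.comp (measurePreserving_snd.comp
    (measurePreserving_snd.comp measurePreserving_snd)))

/-- The number of carriers who have delivered at the origin of the lane `e`. -/
noncomputable def delivered (π : Policy E) (e : E) (x : State E) (ω : Noise E) : ℕ :=
  ∑ e' : E with e'.1.2 = e.1.1, π.served x ω e'

/-- The number of carriers who have delivered at the origin of the lane `e`, as a function of the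
loads and of the costs. -/
noncomputable def deliveredOf (π : Policy E) (e : E) (S : E → ℕ)
    (v : (E → ℕ) × (E → ℕ → ℝ)) : ℕ :=
  ∑ e' : E with e'.1.2 = e.1.1, ((π.carrier e').alloc (S e') (v.1 e') (head (S e') (v.2 e'))).card

lemma measurable_deliveredOf (hπ : π.IsRegular) (e : E) (S : E → ℕ) :
    Measurable (deliveredOf π e S) := by
  refine measurable_from_prod_countable_right fun D => ?_
  exact Finset.measurable_sum _ fun e' _ =>
    ((hπ e').measurable_card _ _).comp ((measurable_head _).comp (measurable_pi_apply e'))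

lemma integrable_delivered (hπ : π.IsRegular) (r : E → ℝ) (e : E) (S : E → ℕ) :
    Integrable (fun w : (E → ℕ) × Noise E => (delivered π e (S, w.1) w.2 : ℝ)) (M.periodLaw r) := by
  simp only [delivered, Nat.cast_sum]
  exact integrable_finsetSum _ fun e' _ => M.integrable_served_period hπ S r e'

lemma integral_delivered (hπ : π.IsRegular) (e : E) (S : E → ℕ) :
    ∫ w, (delivered π e (S, w.1) w.2 : ℝ) ∂M.periodLaw π.shipperPrice =
      ∑ e' : E with e'.1.2 = e.1.1, M.meanServed π e' S := by
  simp only [delivered, Nat.cast_sum]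
  exact integral_finsetSum _ fun e' _ => M.integrable_served_period hπ S _ e'

lemma measurable_staying_period (hπ : π.IsRegular) (e : E) (S : E → ℕ) :
    Measurable fun w : (E → ℕ) × Noise E => (π.staying (S, w.1) w.2 e : ℝ) :=
  measurable_of_state (f := fun x ω => (π.staying x ω e : ℝ))
    (fun x => measurable_from_top.comp (Policy.measurable_staying hπ x e)) S

lemma integrable_staying (hπ : π.IsRegular) (r : E → ℝ) (e : E) (S : E → ℕ) :
    Integrable (fun w : (E → ℕ) × Noise E => (π.staying (S, w.1) w.2 e : ℝ)) (M.periodLaw r) := by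
  refine (M.integrable_delivered hπ r e S).mono'
    (measurable_staying_period hπ e S).aestronglyMeasurable (Eventually.of_forall fun w => ?_)
  rw [Real.norm_eq_abs, Nat.abs_cast]
  exact Nat.cast_le.2 (π.staying_le _ _ _)

lemma measurable_successes_take (e : E) :
    Measurable fun z : ℕ × (ℕ → NextMove E) => successes {NextMove.take e} z.1 z.2 :=
  measurable_from_prod_countable_right fun n =>
    measurable_successes (MeasurableSpace.measurableSet_top) n

lemma integral_staying (hπ : π.IsRegular) (e : E) (S : E → ℕ) :
    ∫ w, (π.staying (S, w.1) w.2 e : ℝ) ∂M.periodLaw π.shipperPrice =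
      M.stay e * ∑ e' : E with e'.1.2 = e.1.1, M.meanServed π e' S := by
  have hmp := M.measurePreserving_moves π.shipperPrice e.1.1
  let g : ((E → ℕ) × (E → ℕ → ℝ)) × (ℕ → NextMove E) → ℝ := fun v =>
    (successes {NextMove.take e} (deliveredOf π e S v.1) v.2 : ℝ)
  have hg : Measurable g := measurable_from_top.comp ((measurable_successes_take e).comp
    (((measurable_deliveredOf hπ e S).comp measurable_fst).prodMk measurable_snd))
  have hgi : Integrable g _ :=
    (hmp.integrable_comp hg.aestronglyMeasurable).1 (M.integrable_staying hπ π.shipperPrice e S)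
  have hK : Measurable fun v : ((E → ℕ) × (E → ℕ → ℝ)) × (ℕ → NextMove E) =>
      (deliveredOf π e S v.1 : ℝ) :=
    measurable_from_top.comp ((measurable_deliveredOf hπ e S).comp measurable_fst)
  rw [← M.integral_delivered hπ e S, ← integral_const_mul]
  refine (integral_comp_of_measurePreserving hmp hg.aestronglyMeasurable).trans ?_
  refine Eq.trans ?_ (integral_comp_of_measurePreserving hmp
    (hK.const_mul (M.stay e)).aestronglyMeasurable).symm
  have hKi := (hmp.integrable_comp (hK.const_mul (M.stay e)).aestronglyMeasurable).1
    ((M.integrable_delivered hπ π.shipperPrice e S).const_mul (M.stay e))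
  rw [integral_prod _ hgi, integral_prod _ hKi]
  refine integral_congr_ae (Eventually.of_forall fun v => ?_)
  simp only [g]
  rw [integral_successes _ MeasurableSpace.measurableSet_top, moveLaw_take]
  simp [mul_comm]

/-- The conditional bound is linear in the number of deliveries, so averaging it involves only the
mean number served. -/
lemma integral_abs_staying_sub_le (hπ : π.IsRegular) (e : E) (S : E → ℕ) {a : ℝ} (ha : 0 < a) :
    ∫ w, |(π.staying (S, w.1) w.2 e : ℝ) - M.stay e * delivered π e (S, w.1) w.2|
        ∂M.periodLaw π.shipperPrice ≤
      (a + (∑ e' : E with e'.1.2 = e.1.1, M.meanServed π e' S) / a) / 2 := by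
  have hmp := M.measurePreserving_moves π.shipperPrice e.1.1
  let g : ((E → ℕ) × (E → ℕ → ℝ)) × (ℕ → NextMove E) → ℝ := fun v =>
    |(successes {NextMove.take e} (deliveredOf π e S v.1) v.2 : ℝ)
      - M.stay e * deliveredOf π e S v.1|
  have hK : Measurable fun v : ((E → ℕ) × (E → ℕ → ℝ)) × (ℕ → NextMove E) =>
      (deliveredOf π e S v.1 : ℝ) :=
    measurable_from_top.comp ((measurable_deliveredOf hπ e S).comp measurable_fst)
  have hB : Measurable fun v : ((E → ℕ) × (E → ℕ → ℝ)) × (ℕ → NextMove E) =>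
      (successes {NextMove.take e} (deliveredOf π e S v.1) v.2 : ℝ) :=
    measurable_from_top.comp ((measurable_successes_take e).comp
      (((measurable_deliveredOf hπ e S).comp measurable_fst).prodMk measurable_snd))
  have hg : Measurable g := (hB.sub (hK.const_mul (M.stay e))).abs
  have hdi := M.integrable_delivered hπ π.shipperPrice e S
  have hgi : Integrable g _ := (hmp.integrable_comp hg.aestronglyMeasurable).1
    (((M.integrable_staying hπ π.shipperPrice e S).sub (hdi.const_mul (M.stay e))).abs)
  have hKm : Measurable fun v : ((E → ℕ) × (E → ℕ → ℝ)) × (ℕ → NextMove E) =>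
      (a + deliveredOf π e S v.1 / a) / 2 := ((hK.div_const a).const_add a).div_const 2
  have hint : Integrable (fun w : (E → ℕ) × Noise E => (a + delivered π e (S, w.1) w.2 / a) / 2)
      (M.periodLaw π.shipperPrice) :=
    ((integrable_const a).add (hdi.div_const a)).div_const 2
  have hKi := (hmp.integrable_comp hKm.aestronglyMeasurable).1 hint
  have h1 : ∫ w, (a + delivered π e (S, w.1) w.2 / a) / 2 ∂M.periodLaw π.shipperPrice =
      (a + (∑ e' : E with e'.1.2 = e.1.1, M.meanServed π e' S) / a) / 2 := by
    rw [integral_div, integral_add (integrable_const a) (hdi.div_const a), integral_div,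
      M.integral_delivered hπ]
    simp
  rw [← h1]
  refine (integral_comp_of_measurePreserving hmp hg.aestronglyMeasurable).trans_le ?_
  refine le_trans ?_ (integral_comp_of_measurePreserving hmp hKm.aestronglyMeasurable).ge
  rw [integral_prod _ hgi, integral_prod _ hKi]
  refine integral_mono hgi.integral_prod_left hKi.integral_prod_left fun v => ?_
  simp only [g]
  have h2 := integral_abs_successes_sub_le (M.moveLaw e.1.1) (B := {NextMove.take e})
    MeasurableSpace.measurableSet_top (deliveredOf π e S v) ha
  rw [moveLaw_take] at h2
  simpa [mul_comm] using h2

lemma integrable_arrival (r : E → ℝ) (e : E) :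
    Integrable (fun w : (E → ℕ) × Noise E => (w.2.2.2.2 e : ℝ)) (M.periodLaw r) :=
  (M.measurePreserving_arrivals r e).integrable_comp_of_integrable (integrable_poisson_id _)

lemma integral_arrival (r : E → ℝ) (e : E) :
    ∫ w : (E → ℕ) × Noise E, (w.2.2.2.2 e : ℝ) ∂M.periodLaw r = M.arrival e := by
  rw [integral_comp_of_measurePreserving (M.measurePreserving_arrivals r e)
    (g := fun n : ℕ => (n : ℝ)) Measurable.of_discrete.aestronglyMeasurable, integral_poisson_id,
    Real.coe_toNNReal _ (M.arrival_pos e).le]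

lemma integral_abs_arrival_sub_le (r : E → ℝ) (e : E) {a : ℝ} (ha : 0 < a) :
    ∫ w : (E → ℕ) × Noise E, |(w.2.2.2.2 e : ℝ) - M.arrival e| ∂M.periodLaw r ≤
      (a + M.arrival e / a) / 2 := by
  have h := integral_abs_poisson_sub_le (M.arrival e).toNNReal ha
  rw [Real.coe_toNNReal _ (M.arrival_pos e).le] at h
  rw [integral_comp_of_measurePreserving (M.measurePreserving_arrivals r e)
    (g := fun n : ℕ => |(n : ℝ) - M.arrival e|) Measurable.of_discrete.aestronglyMeasurable]
  exact h

lemma integral_abs_load_sub_le {r : E → ℝ} {e : E} (hd : 0 ≤ M.demand e (r e)) {a : ℝ}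
    (ha : 0 < a) :
    ∫ w : (E → ℕ) × Noise E, |(w.1 e : ℝ) - M.demand e (r e)| ∂M.periodLaw r ≤
      (a + M.demand e (r e) / a) / 2 := by
  have h := integral_abs_poisson_sub_le (M.demand e (r e)).toNNReal ha
  rw [Real.coe_toNNReal _ hd] at h
  have hmp : MeasurePreserving (fun w : (E → ℕ) × Noise E => w.1 e) (M.periodLaw r)
      (poissonMeasure (M.demand e (r e)).toNNReal) :=
    (M.measurePreserving_load r e).comp measurePreserving_fst
  rw [integral_comp_of_measurePreserving hmp
    (g := fun n : ℕ => |(n : ℝ) - M.demand e (r e)|) Measurable.of_discrete.aestronglyMeasurable]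
  exact h

lemma next_apply (π : Policy E) (S : E → ℕ) (w : (E → ℕ) × Noise E) (e : E) :
    (next π S w e : ℝ) = π.staying (S, w.1) w.2 e + w.2.2.2.2 e := by
  simp [next, Policy.step]

lemma integrable_next (hπ : π.IsRegular) (r : E → ℝ) (e : E) (S : E → ℕ) :
    Integrable (fun w => (next π S w e : ℝ)) (M.periodLaw r) := by
  simp only [next_apply]
  exact (M.integrable_staying hπ r e S).add (M.integrable_arrival r e)

/-- The expected number of carriers on lane `e` in the next period. -/
lemma integral_next (hπ : π.IsRegular) (e : E) (S : E → ℕ) :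
    ∫ w, (next π S w e : ℝ) ∂M.periodLaw π.shipperPrice =
      M.stay e * ∑ e' : E with e'.1.2 = e.1.1, M.meanServed π e' S + M.arrival e := by
  simp only [next_apply]
  rw [integral_add (M.integrable_staying hπ _ e S) (M.integrable_arrival _ e),
    M.integral_staying hπ, M.integral_arrival]

end Market
end Freight

/-! ### Lower bound for the posted prices. -/

namespace Freight

variable {N : Type*} [Fintype N] [DecidableEq N] {E : Finset (N × N)}

namespace Market

variable (M : Market N E) {π : Policy E}

lemma push_affine (hπ : π.IsRegular) {ι : Type*} (s : Finset ι) {f : ι → (E → ℕ) → ℝ} {C : ℝ}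
    (hC : ∀ i S, |f i S| ≤ C) (k : ι → ℝ) (c : ℝ) (S : E → ℕ) :
    M.push π (fun S => ∑ i ∈ s, k i * f i S + c) S = ∑ i ∈ s, k i * M.push π (f i) S + c := by
  have hi : ∀ i, Integrable (fun w => k i * f i (next π S w)) (M.periodLaw π.shipperPrice) :=
    fun i => (M.integrable_comp_next hπ (hC i) S).const_mul (k i)
  rw [push, integral_add (integrable_finsetSum _ fun i _ => hi i) (integrable_const c),
    integral_finsetSum _ fun i _ => hi i]
  simp [push, integral_const_mul]

lemma iterate_push_affine (hπ : π.IsRegular) {ι : Type*} (s : Finset ι)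
    {f : ι → (E → ℕ) → ℝ} {C : ℝ} (hC : ∀ i S, |f i S| ≤ C) (k : ι → ℝ) (c : ℝ) (t : ℕ)
    (S : E → ℕ) :
    (M.push π)^[t] (fun S => ∑ i ∈ s, k i * f i S + c) S =
      ∑ i ∈ s, k i * (M.push π)^[t] (f i) S + c := by
  induction t generalizing S with
  | zero => rfl
  | succ t ih =>
    simp only [Function.iterate_succ_apply']
    rw [funext ih, M.push_affine hπ s (fun i S => M.abs_iterate_push_le hπ (hC i) t S)]

lemma abs_affine_le {ι : Type*} (s : Finset ι) {f : ι → (E → ℕ) → ℝ} {C : ℝ}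
    (hC : ∀ i S, |f i S| ≤ C) (k : ι → ℝ) (c : ℝ) (S : E → ℕ) :
    |∑ i ∈ s, k i * f i S + c| ≤ ∑ i ∈ s, |k i| * C + |c| := by
  refine (abs_add_le _ _).trans (add_le_add ((Finset.abs_sum_le_sum_abs _ _).trans ?_) le_rfl)
  refine Finset.sum_le_sum fun i _ => ?_
  rw [abs_mul]
  exact mul_le_mul_of_nonneg_left (hC i S) (abs_nonneg _)

/-! ### The shortfall of the posted price mechanism -/

variable {M} {z : FluidPoint E}

/-- The expected shortfall of the number of loads served by the posted prices below its value
in the fluid problem, given the numbers of carriers. -/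
noncomputable def shortfall (M : Market N E) (z : FluidPoint E) (e : E) (S : E → ℕ) : ℝ :=
  ∫ w, max (z.y e - (M.SP z).served (S, w.1) w.2 e) 0 ∂M.periodLaw (M.shipperPrice z)

lemma max_sub_le (hz : M.FluidFeasible z) (e : E) (n : ℕ) : max (z.y e - n) 0 ≤ z.y e :=
  max_le (by linarith [(Nat.cast_nonneg n : (0 : ℝ) ≤ n)]) (hz.y_nonneg e)

lemma integrable_shortfall (hz : M.FluidFeasible z) (e : E) (S : E → ℕ) :
    Integrable (fun w : (E → ℕ) × Noise E => max (z.y e - (M.SP z).served (S, w.1) w.2 e) 0)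
      (M.periodLaw (M.shipperPrice z)) := by
  have hm : Measurable fun w : (E → ℕ) × Noise E => ((M.SP z).served (S, w.1) w.2 e : ℝ) :=
    measurable_of_state (f := fun x ω => ((M.SP z).served x ω e : ℝ))
      (fun x => measurable_served_cast (M.isRegular_SP z) x e) S
  refine Integrable.of_bound ((hm.const_sub _).max measurable_const).aestronglyMeasurable (z.y e)
    (Eventually.of_forall fun w => ?_)
  rw [Real.norm_eq_abs, abs_of_nonneg (le_max_right _ _)]
  exact max_sub_le hz e _

lemma shortfall_nonneg (M : Market N E) (z : FluidPoint E) (e : E) (S : E → ℕ) :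
    0 ≤ M.shortfall z e S := integral_nonneg fun _ => le_max_right _ _

lemma shortfall_le (hz : M.FluidFeasible z) (e : E) (S : E → ℕ) : M.shortfall z e S ≤ z.y e := by
  refine (integral_mono (integrable_shortfall hz e S) (integrable_const (z.y e))
    fun w => max_sub_le hz e _).trans ?_
  simp

lemma abs_shortfall_le (hz : M.FluidFeasible z) (e : E) (S : E → ℕ) :
    |M.shortfall z e S| ≤ ∑ e, z.y e := by
  rw [abs_of_nonneg (M.shortfall_nonneg z e S)]
  exact (shortfall_le hz e S).trans
    (Finset.single_le_sum (fun e _ => hz.y_nonneg e) (Finset.mem_univ e))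

lemma sub_meanServed_le_shortfall (hz : M.FluidFeasible z) (e : E) (S : E → ℕ) :
    z.y e - M.meanServed (M.SP z) e S ≤ M.shortfall z e S := by
  have h := M.integrable_served_period (M.isRegular_SP z) S (M.shipperPrice z) e
  have h1 : z.y e - M.meanServed (M.SP z) e S =
      ∫ w, (z.y e - (M.SP z).served (S, w.1) w.2 e) ∂M.periodLaw (M.shipperPrice z) := by
    rw [integral_sub (integrable_const _) h]
    simp [meanServed, SP]
  rw [h1]
  exact integral_mono ((integrable_const _).sub h) (integrable_shortfall hz e S)
    fun w => le_max_left _ _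

/-- SP serves the minimum of the loads, with mean `z.d e ≥ z.y e`, and of the acceptances, with mean
`S e * (z.y e / z.lam e)`. A shortfall thus comes from too few carriers or from one of these two
fluctuations. -/
lemma shortfall_le_of_carriers (hz : M.FluidFeasible z) (e : E) (S : E → ℕ) {a : ℝ} (ha : 0 < a) :
    M.shortfall z e S ≤ max (z.y e - S e * (z.y e / z.lam e)) 0 + (a + z.d e / a) / 2
      + (a + S e / a) / 2 := by
  set r := M.shipperPrice z
  have hd := hz.demand_nonneg e
  have hA : Measurable fun c => (successes (Set.Iic (M.carrierPrice z e)) (S e) c : ℝ) :=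
    measurable_from_top.comp (measurable_successes measurableSet_Iic _)
  have hmp := M.measurePreserving_cost_period r e
  have h1 := integral_abs_successes_sub_le (M.cost e).law
    (B := Set.Iic (M.carrierPrice z e)) measurableSet_Iic (S e) ha
  rw [← CostDistribution.F_eq, hz.F_carrierPrice, ← CostDistribution.costLaw,
    ← integral_comp_of_measurePreserving hmp (g := fun c =>
      |(successes (Set.Iic (M.carrierPrice z e)) (S e) c : ℝ) - S e * (z.y e / z.lam e)|)
      (hA.sub_const _).abs.aestronglyMeasurable] at h1
  have h2 := M.integral_abs_load_sub_le hd ha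
  rw [hz.demand_shipperPrice] at h2
  have hi1 : Integrable (fun w : (E → ℕ) × Noise E =>
      |(successes (Set.Iic (M.carrierPrice z e)) (S e) (w.2.1 e) : ℝ)
        - S e * (z.y e / z.lam e)|) (M.periodLaw r) := by
    refine ((Integrable.of_bound (hA.comp hmp.measurable).aestronglyMeasurable (S e : ℝ)
      (Eventually.of_forall fun w => ?_)).sub (integrable_const _)).abs
    rw [Function.comp_apply, Real.norm_eq_abs, Nat.abs_cast]
    exact_mod_cast successes_le _ _ _
  have hi2 : Integrable (fun w : (E → ℕ) × Noise E => |(w.1 e : ℝ) - z.d e|) (M.periodLaw r) :=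
    ((M.integrable_load_period r e).sub (integrable_const _)).abs
  have hi3 : Integrable (fun w : (E → ℕ) × Noise E => max (z.y e - S e * (z.y e / z.lam e)) 0
      + |(w.1 e : ℝ) - z.d e|) (M.periodLaw r) := (integrable_const _).add hi2
  have h3 : M.shortfall z e S ≤ ∫ w : (E → ℕ) × Noise E,
      (max (z.y e - S e * (z.y e / z.lam e)) 0 + |(w.1 e : ℝ) - z.d e|
      + |(successes (Set.Iic (M.carrierPrice z e)) (S e) (w.2.1 e) : ℝ)
        - S e * (z.y e / z.lam e)|) ∂M.periodLaw r := by
    refine integral_mono (integrable_shortfall hz e S) (hi3.add hi1) fun w => ?_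
    dsimp only
    rw [served_SP, Nat.cast_min]
    have b1 := neg_abs_le ((w.1 e : ℝ) - z.d e)
    have b2 := neg_abs_le ((successes (Set.Iic (M.carrierPrice z e)) (S e) (w.2.1 e) : ℝ)
        - S e * (z.y e / z.lam e))
    have b3 := le_max_left (z.y e - S e * (z.y e / z.lam e)) 0
    have b4 := le_max_right (z.y e - S e * (z.y e / z.lam e)) 0
    have b5 := abs_nonneg ((w.1 e : ℝ) - z.d e)
    have b6 := abs_nonneg ((successes (Set.Iic (M.carrierPrice z e)) (S e) (w.2.1 e) : ℝ)
        - S e * (z.y e / z.lam e))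
    have b7 := hz.y_le_d e
    refine max_le ?_ (by linarith)
    rcases min_choice (w.1 e : ℝ)
      (successes (Set.Iic (M.carrierPrice z e)) (S e) (w.2.1 e) : ℝ) with h | h <;>
    · rw [h]; linarith
  rw [integral_add hi3 hi1, integral_add (integrable_const _) hi2] at h3
  simp only [integral_const, probReal_univ, one_smul] at h3
  linarith

/-- The total rate of loads and of exogenous carrier arrivals. -/
noncomputable def totalRate (M : Market N E) (z : FluidPoint E) : ℝ :=
  ∑ e, z.d e + ∑ e, M.arrival e

lemma d_le_totalRate (hz : M.FluidFeasible z) (e : E) : z.d e ≤ M.totalRate z := by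
  have h1 := Finset.single_le_sum (f := z.d) (fun e _ => hz.d_nonneg e) (Finset.mem_univ e)
  have h2 : 0 ≤ ∑ e, M.arrival e := Finset.sum_nonneg fun e _ => (M.arrival_pos e).le
  rw [totalRate]; linarith

lemma sum_d_add_arrival_le (hz : M.FluidFeasible z) (e : E) (s : Finset E) :
    ∑ e' ∈ s, z.d e' + M.arrival e ≤ M.totalRate z := by
  have h1 := Finset.single_le_sum (f := M.arrival) (fun e _ => (M.arrival_pos e).le)
    (Finset.mem_univ e)
  have h2 : ∑ e' ∈ s, z.d e' ≤ ∑ e, z.d e :=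
    Finset.sum_le_sum_of_subset_of_nonneg (Finset.subset_univ s) fun e _ _ => hz.d_nonneg e
  rw [totalRate]; linarith

/-- The carriers available in the next period fall short of the fluid solution at most by the
shortfall of the loads served in this period, up to random fluctuations. -/
lemma max_sub_next_le (hz : M.FluidFeasible z) (e : E) (S : E → ℕ) (w : (E → ℕ) × Noise E) :
    max (z.y e - next (M.SP z) S w e * (z.y e / z.lam e)) 0 ≤
      z.y e / z.lam e * M.stay e * (∑ e' : E with e'.1.2 = e.1.1,
        max (z.y e' - (M.SP z).served (S, w.1) w.2 e') 0)
      + |((M.SP z).staying (S, w.1) w.2 e : ℝ)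
        - M.stay e * delivered (M.SP z) e (S, w.1) w.2| + |(w.2.2.2.2 e : ℝ) - M.arrival e| := by
  have hl := hz.lam_pos e
  set x := z.y e / z.lam e with hx
  have hx0 : 0 ≤ x := div_nonneg (hz.y_nonneg e) hl.le
  have hx1 : x ≤ 1 := (div_le_one hl).2 (hz.y_le_lam e)
  have hq := M.stay_nonneg e
  -- The fluid flow balance has the form of the recursion for the carriers, so the two are
  -- subtracted term by term; `x ≤ 1` then drops the factor of the fluctuations.
  have hy : z.y e = x * (M.stay e * ∑ e' : E with e'.1.2 = e.1.1, z.y e' + M.arrival e) := by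
    rw [Finset.mul_sum, hz.flow e, hx, div_mul_cancel₀ _ hl.ne']
  have hsum : ∑ e' : E with e'.1.2 = e.1.1, z.y e' - delivered (M.SP z) e (S, w.1) w.2 ≤
      ∑ e' : E with e'.1.2 = e.1.1, max (z.y e' - (M.SP z).served (S, w.1) w.2 e') 0 := by
    rw [delivered, Nat.cast_sum, ← Finset.sum_sub_distrib]
    exact Finset.sum_le_sum fun e' _ => le_max_left _ _
  have hsum0 : 0 ≤ ∑ e' : E with e'.1.2 = e.1.1,
      max (z.y e' - (M.SP z).served (S, w.1) w.2 e') 0 :=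
    Finset.sum_nonneg fun e' _ => le_max_right _ _
  rw [next_apply]
  set B := ((M.SP z).staying (S, w.1) w.2 e : ℝ)
  set K := (delivered (M.SP z) e (S, w.1) w.2 : ℝ)
  set A := (w.2.2.2.2 e : ℝ)
  set V := ∑ e' : E with e'.1.2 = e.1.1, max (z.y e' - (M.SP z).served (S, w.1) w.2 e') 0
  set Y := ∑ e' : E with e'.1.2 = e.1.1, z.y e'
  have b1 : 0 ≤ x * M.stay e * V := by positivity
  refine max_le ?_ (by positivity)
  have b2 : x * M.stay e * (Y - K) ≤ x * M.stay e * V :=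
    mul_le_mul_of_nonneg_left hsum (by positivity)
  have b3 : x * (M.stay e * K - B) ≤ |B - M.stay e * K| := by
    rw [abs_sub_comm]
    exact (mul_le_mul_of_nonneg_left (le_abs_self _) hx0).trans
      (mul_le_of_le_one_left (abs_nonneg _) hx1)
  have b4 : x * (M.arrival e - A) ≤ |A - M.arrival e| := by
    rw [abs_sub_comm]
    exact (mul_le_mul_of_nonneg_left (le_abs_self _) hx0).trans
      (mul_le_of_le_one_left (abs_nonneg _) hx1)
  rw [hy]
  linarith

/-- There are four sources of noise: loads, acceptances, moves and exogenous arrivals. The relevant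
means are all at most `totalRate`, so each source adds at most `(a + M.totalRate z / a) / 2`. -/
lemma push_shortfall_le (hz : M.FluidFeasible z) (e : E) (S : E → ℕ) {a : ℝ} (ha : 0 < a) :
    M.push (M.SP z) (M.shortfall z e) S ≤
      ∑ e' : E with e'.1.2 = e.1.1, z.y e / z.lam e * M.stay e * M.shortfall z e' S
        + 2 * (a + M.totalRate z / a) := by
  have hπ := M.isRegular_SP z
  have hr : (M.SP z).shipperPrice = M.shipperPrice z := rfl
  have hmean : ∑ e' : E with e'.1.2 = e.1.1, M.meanServed (M.SP z) e' S ≤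
      ∑ e' : E with e'.1.2 = e.1.1, z.d e' := Finset.sum_le_sum fun e' _ => by
    rw [← hz.demand_shipperPrice e']
    exact M.meanServed_le hπ (hz.demand_nonneg e') S
  have hmean0 : 0 ≤ ∑ e' : E with e'.1.2 = e.1.1, M.meanServed (M.SP z) e' S :=
    Finset.sum_nonneg fun e' _ => M.meanServed_nonneg e' S
  have hq1 : M.stay e ≤ 1 := (Finset.single_le_sum (f := M.stay) (fun e _ => M.stay_nonneg e)
    (by simp : e ∈ Finset.univ.filter fun e' : E => e'.1.1 = e.1.1)).trans (M.stay_sum e.1.1)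
  have hnext : ∫ w, (next (M.SP z) S w e : ℝ) ∂M.periodLaw (M.shipperPrice z) ≤
      M.totalRate z := by
    have h := M.integral_next hπ e S
    rw [hr] at h
    rw [h]
    have := mul_le_of_le_one_left hmean0 hq1
    linarith [sum_d_add_arrival_le hz e (Finset.univ.filter fun e' : E => e'.1.2 = e.1.1)]
  have hstay := M.integral_abs_staying_sub_le hπ e S ha
  have harr := M.integral_abs_arrival_sub_le (M.shipperPrice z) e ha
  rw [hr] at hstay
  have i1 := fun e' : E => integrable_shortfall hz e' S
  have i2 : Integrable (fun w : (E → ℕ) × Noise E => |((M.SP z).staying (S, w.1) w.2 e : ℝ)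
        - M.stay e * delivered (M.SP z) e (S, w.1) w.2|) (M.periodLaw (M.shipperPrice z)) :=
    ((M.integrable_staying hπ _ e S).sub ((M.integrable_delivered hπ _ e S).const_mul _)).abs
  have i3 : Integrable (fun w : (E → ℕ) × Noise E => |(w.2.2.2.2 e : ℝ) - M.arrival e|)
      (M.periodLaw (M.shipperPrice z)) :=
    ((M.integrable_arrival _ e).sub (integrable_const _)).abs
  have i4 := M.integrable_next hπ (M.shipperPrice z) e S
  have i1' : Integrable (fun w : (E → ℕ) × Noise E => z.y e / z.lam e * M.stay e *
      ∑ e' : E with e'.1.2 = e.1.1, max (z.y e' - (M.SP z).served (S, w.1) w.2 e') 0)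
      (M.periodLaw (M.shipperPrice z)) := (integrable_finsetSum _ fun e' _ => i1 e').const_mul _
  have i6 : Integrable (fun w : (E → ℕ) × Noise E => (next (M.SP z) S w e : ℝ) / a)
      (M.periodLaw (M.shipperPrice z)) := i4.div_const a
  have i7 : Integrable (fun w : (E → ℕ) × Noise E => (a + (next (M.SP z) S w e : ℝ) / a) / 2)
      (M.periodLaw (M.shipperPrice z)) := ((integrable_const a).add i6).div_const 2
  have i5 : Integrable (fun w : (E → ℕ) × Noise E => (a + z.d e / a) / 2
      + (a + next (M.SP z) S w e / a) / 2) (M.periodLaw (M.shipperPrice z)) :=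
    (integrable_const _).add i7
  have i12 := i1'.add i2
  have i123 := i12.add i3
  have hint : M.push (M.SP z) (M.shortfall z e) S ≤ ∫ w : (E → ℕ) × Noise E,
      (z.y e / z.lam e * M.stay e * (∑ e' : E with e'.1.2 = e.1.1,
        max (z.y e' - (M.SP z).served (S, w.1) w.2 e') 0)
      + |((M.SP z).staying (S, w.1) w.2 e : ℝ) - M.stay e * delivered (M.SP z) e (S, w.1) w.2|
      + |(w.2.2.2.2 e : ℝ) - M.arrival e|
      + ((a + z.d e / a) / 2 + (a + next (M.SP z) S w e / a) / 2))
      ∂M.periodLaw (M.shipperPrice z) := by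
    refine integral_mono (M.integrable_comp_next hπ (abs_shortfall_le hz e) S)
      (i123.add i5) fun w => ?_
    have h1 := shortfall_le_of_carriers hz e (next (M.SP z) S w) ha
    have h2 := max_sub_next_le hz e S w
    dsimp only
    linarith
  have hcalc : ∫ w : (E → ℕ) × Noise E,
      (z.y e / z.lam e * M.stay e * (∑ e' : E with e'.1.2 = e.1.1,
        max (z.y e' - (M.SP z).served (S, w.1) w.2 e') 0)
      + |((M.SP z).staying (S, w.1) w.2 e : ℝ) - M.stay e * delivered (M.SP z) e (S, w.1) w.2|
      + |(w.2.2.2.2 e : ℝ) - M.arrival e|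
      + ((a + z.d e / a) / 2 + (a + next (M.SP z) S w e / a) / 2))
      ∂M.periodLaw (M.shipperPrice z) =
      z.y e / z.lam e * M.stay e * (∑ e' : E with e'.1.2 = e.1.1, M.shortfall z e' S)
      + (∫ w : (E → ℕ) × Noise E, |((M.SP z).staying (S, w.1) w.2 e : ℝ)
          - M.stay e * delivered (M.SP z) e (S, w.1) w.2| ∂M.periodLaw (M.shipperPrice z))
      + (∫ w : (E → ℕ) × Noise E, |(w.2.2.2.2 e : ℝ) - M.arrival e|
          ∂M.periodLaw (M.shipperPrice z))
      + ((a + z.d e / a) / 2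
        + (a + (∫ w, (next (M.SP z) S w e : ℝ) ∂M.periodLaw (M.shipperPrice z)) / a) / 2) := by
    refine (integral_add i123 i5).trans (congrArg₂ (· + ·) ((integral_add i12 i3).trans
      (congrArg₂ (· + ·) ((integral_add i1' i2).trans (congrArg₂ (· + ·) ?_ rfl)) rfl)) ?_)
    · rw [integral_const_mul, integral_finsetSum _ fun e' _ => i1 e']
      rfl
    · have i8 : ∫ w : (E → ℕ) × Noise E, (a + next (M.SP z) S w e / a) / 2
          ∂M.periodLaw (M.shipperPrice z) =
          (a + (∫ w, (next (M.SP z) S w e : ℝ) ∂M.periodLaw (M.shipperPrice z)) / a) / 2 := by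
        rw [integral_div, integral_add (integrable_const a) i6, integral_div]
        simp
      rw [integral_add (integrable_const _) i7, i8]
      simp
  rw [← Finset.mul_sum]
  refine hint.trans (hcalc.trans_le ?_)
  have hT := sum_d_add_arrival_le hz e (Finset.univ.filter fun e' : E => e'.1.2 = e.1.1)
  have hsd : 0 ≤ ∑ e' : E with e'.1.2 = e.1.1, z.d e' :=
    Finset.sum_nonneg fun e' _ => hz.d_nonneg e'
  have hap := (M.arrival_pos e).le
  have c1 : (a + (∑ e' : E with e'.1.2 = e.1.1, M.meanServed (M.SP z) e' S) / a) / 2 ≤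
      (a + M.totalRate z / a) / 2 := by
    gcongr
    linarith
  have c2 : (a + M.arrival e / a) / 2 ≤ (a + M.totalRate z / a) / 2 := by
    gcongr
    linarith
  have c3 : (a + z.d e / a) / 2 ≤ (a + M.totalRate z / a) / 2 := by
    gcongr
    exact d_le_totalRate hz e
  have c4 : (a + (∫ w, (next (M.SP z) S w e : ℝ) ∂M.periodLaw (M.shipperPrice z)) / a) / 2 ≤
      (a + M.totalRate z / a) / 2 := by
    gcongr
  linarith

/-- The shortfalls stay bounded by a fixed multiple of weights `w` for which the flow of carriers
contracts. -/
lemma iterate_push_shortfall_le (hz : M.FluidFeasible z) {w : E → ℝ} {W κ ε a : ℝ} (ha : 0 < a)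
    (hw : ∀ e, 0 ≤ w e) (hW0 : 0 ≤ W) (hκ : 0 ≤ κ) (hε : 0 < ε) (hε1 : ε ≤ 1)
    (hW : ∀ e, z.y e ≤ W * w e)
    (hcontr : ∀ e, 0 < z.y e →
      ∑ e' : E with e'.1.2 = e.1.1, z.y e / z.lam e * M.stay e * w e' ≤ (1 - ε) * w e)
    (hnoise : ∀ e, 0 < z.y e → 2 * (a + M.totalRate z / a) ≤ κ * w e) (t : ℕ) (e : E)
    (S : E → ℕ) :
    (M.push (M.SP z))^[t] (M.shortfall z e) S ≤ ((1 - ε) ^ t * W + κ / ε) * w e := by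
  have hπ := M.isRegular_SP z
  have hA : ∀ t : ℕ, 0 ≤ (1 - ε) ^ t * W + κ / ε := fun t => by
    have : 0 ≤ 1 - ε := by linarith
    positivity
  induction t generalizing e S with
  | zero =>
    refine (shortfall_le hz e S).trans ((hW e).trans ?_)
    refine mul_le_mul_of_nonneg_right ?_ (hw e)
    have : 0 ≤ κ / ε := by positivity
    simpa using this
  | succ t ih =>
    -- A lane with `z.y e = 0` has no shortfall, and its weight may vanish, so the noise could not
    -- be absorbed there.
    rcases (hz.y_nonneg e).eq_or_lt with he | he
    · have h0 : ∀ S, |M.shortfall z e S| ≤ 0 := fun S => by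
        rw [abs_of_nonneg (M.shortfall_nonneg z e S), he]
        exact shortfall_le hz e S
      exact ((le_abs_self _).trans (M.abs_iterate_push_le hπ h0 (t + 1) S)).trans
        (mul_nonneg (hA _) (hw e))
    -- The one-step bound goes inside the `t`-fold iterate, so that the induction hypothesis applies
    -- to the lanes leading to the origin of `e`.
    · rw [Function.iterate_succ_apply]
      refine (M.iterate_push_mono hπ (M.abs_push_le hπ (abs_shortfall_le hz e))
        (abs_affine_le _ (abs_shortfall_le hz) _ _)
        (fun S => push_shortfall_le hz e S ha) t S).trans ?_
      rw [M.iterate_push_affine hπ _ (abs_shortfall_le hz)]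
      have hk : 0 ≤ z.y e / z.lam e * M.stay e :=
        mul_nonneg (div_nonneg he.le (hz.lam_pos e).le) (M.stay_nonneg e)
      have h1 : ∑ e' : E with e'.1.2 = e.1.1, z.y e / z.lam e * M.stay e *
          (M.push (M.SP z))^[t] (M.shortfall z e') S ≤
          ((1 - ε) ^ t * W + κ / ε) * ((1 - ε) * w e) := by
        refine le_trans ?_ (mul_le_mul_of_nonneg_left (hcontr e he) (hA t))
        rw [Finset.mul_sum]
        refine Finset.sum_le_sum fun e' _ => ?_
        refine (mul_le_mul_of_nonneg_left (ih e' S) hk).trans (le_of_eq (by ring))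
      -- `κ / ε` is the fixed point of `A ↦ (1 - ε) * A + κ`.
      refine (add_le_add h1 (hnoise e he)).trans (le_of_eq ?_)
      rw [pow_succ]
      field_simp
      ring

/-- A lower bound on the long-run average profit of the posted prices. -/
lemma fluidObjective_sub_le (hz : M.FluidFeasible z)
    (hp : ∀ e, 0 < z.y e → M.carrierPrice z e ≤ M.penalty e)
    {w : E → ℝ} {W κ ε a : ℝ} (ha : 0 < a)
    (hw : ∀ e, 0 ≤ w e) (hW0 : 0 ≤ W) (hκ : 0 ≤ κ) (hε : 0 < ε) (hε1 : ε ≤ 1)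
    (hW : ∀ e, z.y e ≤ W * w e)
    (hcontr : ∀ e, 0 < z.y e →
      ∑ e' : E with e'.1.2 = e.1.1, z.y e / z.lam e * M.stay e * w e' ≤ (1 - ε) * w e)
    (hnoise : ∀ e, 0 < z.y e → 2 * (a + M.totalRate z / a) ≤ κ * w e) {γ : ℝ} {S : E → ℕ}
    (hγ : Tendsto (fun t => (M.push (M.SP z))^[t] (M.meanProfit (M.SP z)) S) atTop (𝓝 γ)) :
    M.fluidObjective z - κ / ε * ∑ e, |M.penalty e - M.carrierPrice z e| * w e ≤ γ := by
  have hπ := M.isRegular_SP z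
  obtain ⟨C, hC⟩ := M.exists_abs_meanProfit_le hπ hz.demand_nonneg
  -- On each lane the profit differs from the fluid objective by the margin `b - p*` times the mean
  -- served loads minus `z.y e`.
  have hlow : ∀ S, ∑ e, -|M.penalty e - M.carrierPrice z e| * M.shortfall z e S
      + M.fluidObjective z ≤ M.meanProfit (M.SP z) S := by
    intro S
    rw [meanProfit_SP, fluidObjective, ← Finset.sum_add_distrib]
    refine Finset.sum_le_sum fun e _ => ?_
    rw [hz.demand_shipperPrice, shipperPrice, ← carrierPrice]
    have h1 := M.shortfall_nonneg z e S
    have h2 := sub_meanServed_le_shortfall hz e S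
    rcases (hz.y_nonneg e).eq_or_lt with he | he
    · rw [meanServed_SP_eq_zero hz he.symm, ← he]
      have := mul_nonneg (abs_nonneg (M.penalty e - M.carrierPrice z e)) h1
      linarith
    · have h3 : 0 ≤ M.penalty e - M.carrierPrice z e := sub_nonneg.2 (hp e he)
      rw [abs_of_nonneg h3]
      have := mul_le_mul_of_nonneg_left h2 h3
      linarith
  have hbound : ∀ t, M.fluidObjective z - ((1 - ε) ^ t * W + κ / ε) *
      ∑ e, |M.penalty e - M.carrierPrice z e| * w e ≤
      (M.push (M.SP z))^[t] (M.meanProfit (M.SP z)) S := by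
    intro t
    refine le_trans ?_ (M.iterate_push_mono hπ (abs_affine_le _ (abs_shortfall_le hz) _ _) hC
      hlow t S)
    rw [M.iterate_push_affine hπ _ (abs_shortfall_le hz), Finset.mul_sum, sub_eq_add_neg,
      add_comm, ← Finset.sum_neg_distrib]
    refine add_le_add (Finset.sum_le_sum fun e _ => ?_) le_rfl
    have h := mul_le_mul_of_nonneg_left
      (iterate_push_shortfall_le hz ha hw hW0 hκ hε hε1 hW hcontr hnoise t e S)
      (abs_nonneg (M.penalty e - M.carrierPrice z e))
    linarith
  have hlim : Tendsto (fun t : ℕ => M.fluidObjective z - ((1 - ε) ^ t * W + κ / ε) *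
      ∑ e, |M.penalty e - M.carrierPrice z e| * w e) atTop
      (𝓝 (M.fluidObjective z - (0 * W + κ / ε) *
        ∑ e, |M.penalty e - M.carrierPrice z e| * w e)) :=
    ((((tendsto_pow_atTop_nhds_zero_of_lt_one (by linarith) (by linarith)).mul_const W).add_const
      _).mul_const _).const_sub _
  have := le_of_tendsto_of_tendsto' hlim hγ hbound
  simpa using this

end Market
end Freight

/-! ### Existence of the limits and the fluid upper bound. -/

namespace Freight

variable {N : Type*} [Fintype N] [DecidableEq N] {E : Finset (N × N)}

namespace Market

variable (M : Market N E) {π : Policy E}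

/-! ### Existence of the long-run average profits -/

lemma exists_tendsto_meanProfit (hπ : π.IsRegular)
    (hd : ∀ e, 0 ≤ M.demand e (π.shipperPrice e)) :
    ∃ γ, M.IsLongRunProfit π γ ∧
      ∀ S, Tendsto (fun t => (M.push π)^[t] (M.meanProfit π) S) atTop (𝓝 γ) := by
  obtain ⟨C, hC⟩ := M.exists_abs_meanProfit_le hπ hd
  obtain ⟨γ, hγ⟩ := M.exists_tendsto_iterate_push hπ hC
  exact ⟨γ, M.isLongRunProfit_of_tendsto hπ hd (hγ 0), hγ⟩

/-! ### The fluid problem bounds the profit of the auction -/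

lemma iterate_push_linear (hπ : π.IsRegular) {f g : (E → ℕ) → ℝ} {C C' : ℝ}
    (hC : ∀ S, |f S| ≤ C) (hC' : ∀ S, |g S| ≤ C') (a b : ℝ) (t : ℕ) (S : E → ℕ) :
    (M.push π)^[t] (fun S => a * f S + b * g S) S =
      a * (M.push π)^[t] f S + b * (M.push π)^[t] g S := by
  have h := M.iterate_push_affine hπ Finset.univ (f := fun i : Bool => if i then f else g)
    (C := max C C') (fun i S => by
      cases i
      · exact (hC' S).trans (le_max_right _ _)
      · exact (hC S).trans (le_max_left _ _)) (fun i => if i then a else b) 0 t S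
  simpa using h

/-- No load is transported in a period without loads. -/
lemma meanServed_le_mul_carriers (hπ : π.IsRegular) (e : E) (S : E → ℕ) :
    M.meanServed π e S ≤ (1 - (M.loadLaw π.shipperPrice).real {0}) * S e := by
  have hset : MeasurableSet ((fun w : (E → ℕ) × Noise E => w.1) ⁻¹' {0}ᶜ) :=
    measurable_fst (measurableSet_singleton 0).compl
  have h1 : (M.periodLaw π.shipperPrice).real ((fun w : (E → ℕ) × Noise E => w.1) ⁻¹' {0}ᶜ) =
      1 - (M.loadLaw π.shipperPrice).real {0} := by
    rw [← probReal_compl_eq_one_sub (measurableSet_singleton 0)]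
    exact measurePreserving_fst.measureReal_preimage
      (measurableSet_singleton 0).compl.nullMeasurableSet
  rw [← h1, ← smul_eq_mul, ← integral_indicator_const _ hset]
  refine integral_mono (M.integrable_served_period hπ S _ e)
    ((integrable_const (S e : ℝ)).indicator hset) ?_
  rintro ⟨D, ω⟩
  by_cases hD : D = 0
  · subst hD
    have : π.served (S, 0) ω e = 0 := Nat.le_zero.1 (Policy.served_le hπ (S, 0) ω e)
    simp [this]
  · have : π.served (S, D) ω e ≤ S e := (Finset.card_le_univ _).trans (by simp)
    simpa [hD] using this

/-- The expected number of carriers on lane `e` in the next period. -/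
noncomputable def meanCarriers (π : Policy E) (e : E) (S : E → ℕ) : ℝ :=
  ∑ e' : E with e'.1.2 = e.1.1, M.stay e * M.meanServed π e' S + M.arrival e

lemma integral_next_eq_meanCarriers (hπ : π.IsRegular) (e : E) (S : E → ℕ) :
    ∫ w, (next π S w e : ℝ) ∂M.periodLaw π.shipperPrice = M.meanCarriers π e S := by
  rw [M.integral_next hπ, meanCarriers, Finset.mul_sum]

lemma push_meanServed_le (hπ : π.IsRegular) (hd : ∀ e, 0 ≤ M.demand e (π.shipperPrice e)) (e : E)
    (S : E → ℕ) : M.push π (M.meanServed π e) S ≤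
      (1 - (M.loadLaw π.shipperPrice).real {0}) * M.meanCarriers π e S := by
  rw [← M.integral_next_eq_meanCarriers hπ, ← integral_const_mul]
  exact integral_mono (M.integrable_comp_next hπ (M.abs_meanServed_le hπ (hd e)) S)
    ((M.integrable_next hπ _ e S).const_mul _) fun w => M.meanServed_le_mul_carriers hπ e _

variable {M} {z : FluidPoint E}

/-- Linearity in carriers and served loads lets the bound pass through averages over loads, states
and time; it takes the place of Jensen's inequality. -/
lemma le_meanPayment_AUC (M : Market N E) (z : FluidPoint E) {κ m : ℝ} {e : E} (hκ : κ ≤ 0)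
    (hm : ∀ τ, κ ≤ (τ - m) * (M.cost e).F τ) (S : E → ℕ) :
    κ * S e + m * M.meanServed (M.AUC z) e S ≤ M.meanPayment (M.AUC z) e S := by
  have hπ := M.isRegular_AUC z
  have h1 := M.integral_margin hπ m e S
  have hξ := M.reservePrice_nonneg z e
  have h2 : m * M.meanServed (M.AUC z) e S - M.meanPayment (M.AUC z) e S ≤ -(κ * S e) := by
    rw [h1]
    have h3 : ∫ _D : E → ℕ, -(κ * (S e : ℝ)) ∂M.loadLaw (M.AUC z).shipperPrice = -(κ * S e) := by
      simp
    rw [← h3]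
    refine integral_mono (M.integrable_integral_margin hπ m e S) (integrable_const _) fun D => ?_
    have h4 := (M.cost e).le_integral_aucPay hξ hκ hm (S e) (D e)
    have h5 : Integrable (fun c => ((aucAlloc (M.reservePrice z e) (D e) (head (S e) c)).card : ℝ))
        (M.cost e).costLaw := by
      refine Integrable.of_bound (measurable_from_top.comp
        (((hπ e).measurable_card _ _).comp (measurable_head _))).aestronglyMeasurable (D e : ℝ)
        (Eventually.of_forall fun c => ?_)
      rw [Real.norm_eq_abs, Nat.abs_cast]
      exact_mod_cast (hπ e).card_le _ _ _
    have h6 : Integrable (fun c => ∑ s, aucPay (M.reservePrice z e) (D e) (head (S e) c) s)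
        (M.cost e).costLaw := integrable_finsetSum _ fun s _ =>
      (M.cost e).integrable_aucPay hξ (D e) s
    refine (integral_sub (h5.const_mul m) h6).trans_le ?_
    rw [integral_const_mul]
    linarith
  linarith

lemma le_push_meanPayment_AUC (hz : M.FluidFeasible z) {κ m : ℝ} {e : E} (hκ : κ ≤ 0)
    (hm : ∀ τ, κ ≤ (τ - m) * (M.cost e).F τ) (S : E → ℕ) :
    κ * M.meanCarriers (M.AUC z) e S + m * M.push (M.AUC z) (M.meanServed (M.AUC z) e) S ≤
      M.push (M.AUC z) (M.meanPayment (M.AUC z) e) S := by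
  have hπ := M.isRegular_AUC z
  obtain ⟨C, hC⟩ := M.exists_abs_meanPayment_le hπ hz.demand_nonneg
  have h1 := (M.integrable_next hπ (M.AUC z).shipperPrice e S).const_mul κ
  have h2 := (M.integrable_comp_next hπ (M.abs_meanServed_le hπ (hz.demand_nonneg e)) S).const_mul m
  rw [← M.integral_next_eq_meanCarriers hπ, push, push, ← integral_const_mul, ← integral_const_mul,
    ← integral_add h1 h2]
  exact integral_mono (h1.add h2) (M.integrable_comp_next hπ (hC e) S)
    fun w => M.le_meanPayment_AUC z hκ hm _

/-- The long-run averages of the auction are a feasible point of the fluid problem, at which the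
objective is at least the profit of the auction. -/
lemma le_fluidObjective_of_tendsto (hz : M.IsFluidOptimal z) {γ : ℝ}
    (hγ : ∀ S, Tendsto (fun t => (M.push (M.AUC z))^[t] (M.meanProfit (M.AUC z)) S) atTop (𝓝 γ)) :
    γ ≤ M.fluidObjective z := by
  obtain ⟨hz, hopt⟩ := hz
  have hπ := M.isRegular_AUC z
  have hd : ∀ e, 0 ≤ M.demand e ((M.AUC z).shipperPrice e) := hz.demand_nonneg
  set A := M.AUC z with hA
  obtain ⟨B, hB⟩ := M.exists_abs_meanPayment_le hπ hd
  have hserved := fun e => M.abs_meanServed_le hπ (hd e)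
  have hserved' : ∀ e S, |M.meanServed A e S| ≤ ∑ e, M.demand e (A.shipperPrice e) := fun e S =>
    (hserved e S).trans (Finset.single_le_sum (f := fun e => M.demand e (A.shipperPrice e))
      (fun e _ => hd e) (Finset.mem_univ e))
  -- The limits `Y` and `P` play the role of stationary means of served loads and payments.
  choose Y hY using fun e => M.exists_tendsto_iterate_push hπ (hserved e)
  choose P hP using fun e => M.exists_tendsto_iterate_push hπ (hB e)
  set lam : E → ℝ := fun e => ∑ e' : E with e'.1.2 = e.1.1, M.stay e * Y e' + M.arrival e with hlam
  set ρ := 1 - (M.loadLaw A.shipperPrice).real {0} with hρ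
  have hρ1 : ρ < 1 := by linarith [M.loadLaw_zero_pos A.shipperPrice]
  have hρ0 : 0 ≤ ρ := sub_nonneg.2 measureReal_le_one
  have hcar' : ∀ e, ∃ C, ∀ S, |M.meanCarriers A e S| ≤ C := fun e =>
    ⟨_, abs_affine_le (Finset.univ.filter fun e' : E => e'.1.2 = e.1.1) hserved'
      (fun _ => M.stay e) (M.arrival e)⟩
  choose C hcar using hcar'
  have hcarlim : ∀ e, Tendsto (fun t => (M.push A)^[t] (M.meanCarriers A e) 0) atTop
      (𝓝 (lam e)) := fun e => by
    have h : ∀ t, (M.push A)^[t] (M.meanCarriers A e) 0 =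
        ∑ e' : E with e'.1.2 = e.1.1, M.stay e * (M.push A)^[t] (M.meanServed A e') 0
          + M.arrival e := fun t =>
      M.iterate_push_affine hπ _ hserved' (fun _ => M.stay e) (M.arrival e) t 0
    simp only [h]
    exact (tendsto_finsetSum _ fun e' _ => (hY e' 0).const_mul _).add_const _
  -- `meanCarriers` counts the carriers of the next period, so it is matched with the loads and
  -- payments one step later.
  have hYsucc := fun e => (tendsto_add_atTop_iff_nat 1).2 (hY e 0)
  have hPsucc := fun e => (tendsto_add_atTop_iff_nat 1).2 (hP e 0)
  have hY0 : ∀ e, 0 ≤ Y e := fun e => by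
    refine ge_of_tendsto' (hY e 0) fun t => ?_
    have h0 : ∀ S : E → ℕ, |(0 : ℝ)| ≤ 0 := fun S => by simp
    have h := M.iterate_push_mono hπ (h := fun _ => 0) h0 (hserved e)
      (fun S => M.meanServed_nonneg e S) t 0
    refine le_trans ?_ h
    have := M.abs_iterate_push_le hπ (h := fun _ => 0) h0 t 0
    linarith [neg_abs_le ((M.push A)^[t] (fun _ => 0) 0)]
  have hYd : ∀ e, Y e ≤ z.d e := fun e => by
    rw [← hz.demand_shipperPrice e]
    exact le_of_tendsto' (hY e 0) fun t =>
      (le_abs_self _).trans (M.abs_iterate_push_le hπ (hserved e) t 0)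
  have hlam0 : ∀ e, 0 < lam e := fun e =>
    add_pos_of_nonneg_of_pos (Finset.sum_nonneg fun e' _ => mul_nonneg (M.stay_nonneg e) (hY0 e'))
      (M.arrival_pos e)
  -- The factor `ρ < 1` keeps the ratio `Y e / lam e` strictly below one. At one, `F` may not attain
  -- the value, and `exists_supporting_slope` does not apply.
  have hYlam : ∀ e, Y e ≤ ρ * lam e := fun e => by
    refine le_of_tendsto_of_tendsto' (hYsucc e) ((hcarlim e).const_mul ρ) fun t => ?_
    rw [Function.iterate_succ_apply]
    have h1 := M.iterate_push_mono hπ (M.abs_push_le hπ (hserved e))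
      (h' := fun S => ρ * M.meanCarriers A e S + 0 * M.meanCarriers A e S)
      (C' := ρ * C e) (fun S => by
          rw [zero_mul, add_zero, abs_mul, abs_of_nonneg hρ0]
          exact mul_le_mul_of_nonneg_left (hcar e S) hρ0)
      (fun S => by
        rw [zero_mul, add_zero]
        exact M.push_meanServed_le hπ hd e S) t 0
    refine h1.trans (le_of_eq ?_)
    rw [M.iterate_push_linear hπ (hcar e) (hcar e)]
    ring
  have hx0 : ∀ e, 0 ≤ Y e / lam e := fun e => div_nonneg (hY0 e) (hlam0 e).le
  have hx1 : ∀ e, Y e / lam e < 1 := fun e => by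
    rw [div_lt_one (hlam0 e)]
    nlinarith [hYlam e, hlam0 e]
  have hPY : ∀ e, (M.cost e).Finv (Y e / lam e) * Y e ≤ P e := fun e => by
    -- The supporting line touches at the long-run acceptance ratio, so `κ * lam e + m * Y e` is
    -- exactly the fluid payment `Finv (Y e / lam e) * Y e`.
    obtain ⟨m, hκ, hm⟩ := (M.cost e).exists_supporting_slope (hx0 e) (hx1 e)
    set κ := ((M.cost e).Finv (Y e / lam e) - m) * (Y e / lam e) with hκdef
    have h : κ * lam e + m * Y e ≤ P e := by
      refine le_of_tendsto_of_tendsto' (((hcarlim e).const_mul κ).add ((hYsucc e).const_mul m))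
        (hPsucc e) fun t => ?_
      rw [Function.iterate_succ_apply, Function.iterate_succ_apply]
      have hpush := M.abs_push_le hπ (hserved e)
      rw [← M.iterate_push_linear hπ (hcar e) hpush]
      refine M.iterate_push_mono hπ (C := |κ| * C e + |m| * M.demand e (A.shipperPrice e)) (fun S => ?_)
        (M.abs_push_le hπ (hB e)) (fun S => le_push_meanPayment_AUC hz hκ hm S) t 0
      refine (abs_add_le _ _).trans (add_le_add ?_ ?_)
      · rw [abs_mul]
        exact mul_le_mul_of_nonneg_left (hcar e S) (abs_nonneg _)
      · rw [abs_mul]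
        exact mul_le_mul_of_nonneg_left (hpush S) (abs_nonneg _)
    have h2 : κ * lam e = ((M.cost e).Finv (Y e / lam e) - m) * Y e := by
      rw [hκdef, mul_assoc, div_mul_cancel₀ _ (hlam0 e).ne']
    linarith
  have hfeas : M.FluidFeasible ⟨z.d, Y, lam⟩ :=
    { flow := fun e => rfl
      y_le_d := hYd
      y_le_lam := fun e => ((div_lt_one (hlam0 e)).1 (hx1 e)).le
      y_nonneg := hY0
      lam_nonneg := fun e => (hlam0 e).le
      d_nonneg := hz.d_nonneg
      d_mem := hz.d_mem
      x_mem := fun e => (M.cost e).mem_range_F (hx0 e) (hx1 e) }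
  refine le_trans ?_ (hopt _ hfeas)
  have hlim : Tendsto (fun t => (M.push A)^[t] (M.meanProfit A) 0) atTop
      (𝓝 (∑ e, 1 * (M.penalty e * Y e + (-1) * P e)
        + ∑ e, (M.shipperPrice z e * z.d e - M.penalty e * z.d e))) := by
    have h1 : M.meanProfit A = fun S => ∑ e, 1 * (M.penalty e * M.meanServed A e S
        + (-1) * M.meanPayment A e S)
        + ∑ e, (M.shipperPrice z e * z.d e - M.penalty e * z.d e) := by
      funext S
      rw [meanProfit, ← Finset.sum_add_distrib]
      refine Finset.sum_congr rfl fun e _ => ?_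
      have h2 : A.shipperPrice e = M.shipperPrice z e := rfl
      rw [h2, hz.demand_shipperPrice]
      ring
    have hb : ∀ e S, |M.penalty e * M.meanServed A e S + (-1) * M.meanPayment A e S| ≤
        ∑ e, (M.penalty e * M.demand e (A.shipperPrice e)
          + B * M.demand e (A.shipperPrice e)) := fun e S => by
      have h3 : ∀ e, |M.penalty e * M.meanServed A e S + (-1) * M.meanPayment A e S| ≤
          M.penalty e * M.demand e (A.shipperPrice e) + B * M.demand e (A.shipperPrice e) :=
        fun e => by
          refine (abs_add_le _ _).trans (add_le_add ?_ ?_)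
          · rw [abs_mul, abs_of_nonneg (M.penalty_nonneg e)]
            exact mul_le_mul_of_nonneg_left (hserved e S) (M.penalty_nonneg e)
          · simpa using hB e S
      exact (h3 e).trans (Finset.single_le_sum (f := fun e =>
        M.penalty e * M.demand e (A.shipperPrice e) + B * M.demand e (A.shipperPrice e))
        (fun e _ => (abs_nonneg _).trans (h3 e)) (Finset.mem_univ e))
    rw [h1]
    simp only [M.iterate_push_affine hπ _ hb]
    refine (tendsto_finsetSum _ fun e _ => Tendsto.const_mul _ ?_).add_const _
    simp only [M.iterate_push_linear hπ (hserved e) (hB e)]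
    exact ((hY e 0).const_mul _).add ((hP e 0).const_mul _)
  rw [tendsto_nhds_unique (hγ 0) hlim, fluidObjective, ← Finset.sum_add_distrib]
  refine Finset.sum_le_sum fun e _ => ?_
  have := hPY e
  simp only [shipperPrice]
  linarith

end Market
end Freight

/-! ### Scaling of the market and the final estimates. -/

namespace Freight

variable {N : Type*} [Fintype N] [DecidableEq N] {E : Finset (N × N)}

/-! ### Scaling -/

/-- The fluid point with all rates multiplied by `θ`. -/
def FluidPoint.scale (z : FluidPoint E) (θ : ℝ) : FluidPoint E :=
  ⟨fun e => θ * z.d e, fun e => θ * z.y e, fun e => θ * z.lam e⟩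

lemma FluidPoint.scale_inv_scale (z : FluidPoint E) {θ : ℝ} (hθ : θ ≠ 0) :
    (z.scale θ⁻¹).scale θ = z := by
  simp [FluidPoint.scale, mul_inv_cancel_left₀ hθ]

namespace Market

variable {M : Market N E} {z : FluidPoint E} {θ : ℕ+}

lemma fluidFeasible_scale (hz : M.FluidFeasible z) (θ : ℕ+) :
    (M.scale θ).FluidFeasible (z.scale θ) := by
  have hθ : (0 : ℝ) < θ := by exact_mod_cast θ.pos
  constructor
  · intro e
    simp only [FluidPoint.scale, scale, ← hz.flow e, mul_add, Finset.mul_sum]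
    congr 1
    exact Finset.sum_congr rfl fun e' _ => by ring
  · exact fun e => mul_le_mul_of_nonneg_left (hz.y_le_d e) hθ.le
  · exact fun e => mul_le_mul_of_nonneg_left (hz.y_le_lam e) hθ.le
  · exact fun e => mul_nonneg hθ.le (hz.y_nonneg e)
  · exact fun e => mul_nonneg hθ.le (hz.lam_nonneg e)
  · exact fun e => mul_nonneg hθ.le (hz.d_nonneg e)
  · intro e
    obtain ⟨r, hr, h⟩ := hz.d_mem e
    exact ⟨r, hr, congrArg (fun d => (θ : ℝ) * d) h⟩
  · intro e
    simp only [FluidPoint.scale, mul_div_mul_left _ _ hθ.ne']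
    exact hz.x_mem e

lemma fluidFeasible_scale_inv (hz : (M.scale θ).FluidFeasible z) :
    M.FluidFeasible (z.scale (θ : ℝ)⁻¹) := by
  have hθ : (0 : ℝ) < (θ : ℝ)⁻¹ := inv_pos.2 (by exact_mod_cast θ.pos)
  have hθ' : (θ : ℝ) ≠ 0 := by exact_mod_cast θ.ne_zero
  constructor
  · intro e
    have h : (M.scale θ).arrival e = θ * M.arrival e := rfl
    simp only [FluidPoint.scale, ← hz.flow e, mul_add, Finset.mul_sum, h,
      inv_mul_cancel_left₀ hθ']
    congr 1
    exact Finset.sum_congr rfl fun e' _ => by simp only [scale]; ring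
  · exact fun e => mul_le_mul_of_nonneg_left (hz.y_le_d e) hθ.le
  · exact fun e => mul_le_mul_of_nonneg_left (hz.y_le_lam e) hθ.le
  · exact fun e => mul_nonneg hθ.le (hz.y_nonneg e)
  · exact fun e => mul_nonneg hθ.le (hz.lam_nonneg e)
  · exact fun e => mul_nonneg hθ.le (hz.d_nonneg e)
  · intro e
    obtain ⟨r, hr, h⟩ := hz.d_mem e
    refine ⟨r, hr, ?_⟩
    simp only [FluidPoint.scale, ← h, scale, inv_mul_cancel_left₀ hθ']
  · intro e
    simp only [FluidPoint.scale, mul_div_mul_left _ _ hθ.ne']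
    exact hz.x_mem e

lemma invDemand_demand {e : E} {r : ℝ} (hr : r ∈ M.prices e) :
    M.invDemand e (M.demand e r) = r :=
  (M.demand_strictAnti e).injOn.leftInvOn_invFunOn hr

lemma shipperPrice_scale (hz : M.FluidFeasible z) (θ : ℕ+) :
    (M.scale θ).shipperPrice (z.scale θ) = M.shipperPrice z := by
  funext e
  obtain ⟨r, hr, h⟩ := hz.d_mem e
  have h1 : (z.scale θ).d e = (M.scale θ).demand e r := congrArg (fun d => (θ : ℝ) * d) h.symm
  rw [shipperPrice, shipperPrice, h1, ← h, invDemand_demand hr]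
  exact invDemand_demand (M := M.scale θ) hr

lemma carrierPrice_scale (M : Market N E) (z : FluidPoint E) (θ : ℕ+) :
    (M.scale θ).carrierPrice (z.scale θ) = M.carrierPrice z := by
  have hθ : (θ : ℝ) ≠ 0 := by exact_mod_cast θ.ne_zero
  funext e
  simp only [carrierPrice, FluidPoint.scale, mul_div_mul_left _ _ hθ]
  rfl

/-- The prices depend on `θ` neither through `y / lam` nor through the inverse demand, so results
for a single market apply directly to `M.scale θ` with the mechanism of `M`. -/
lemma HYB_scale (hz : M.FluidFeasible z) (θ : ℕ+) :
    (M.scale θ).HYB (z.scale θ) = M.HYB z := by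
  unfold HYB reservePrice
  rw [shipperPrice_scale hz, carrierPrice_scale]
  rfl

lemma fluidObjective_scale (hz : M.FluidFeasible z) (θ : ℕ+) :
    (M.scale θ).fluidObjective (z.scale θ) = θ * M.fluidObjective z := by
  rw [fluidObjective, fluidObjective, Finset.mul_sum]
  refine Finset.sum_congr rfl fun e _ => ?_
  have h1 := congrFun (shipperPrice_scale hz θ) e
  have h2 := congrFun (M.carrierPrice_scale z θ) e
  simp only [shipperPrice] at h1
  simp only [carrierPrice] at h2
  rw [h1, h2]
  simp only [FluidPoint.scale, scale]
  ring

lemma isFluidOptimal_scale (hz : M.IsFluidOptimal z) (θ : ℕ+) :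
    (M.scale θ).IsFluidOptimal (z.scale θ) := by
  have hθ : (0 : ℝ) < θ := by exact_mod_cast θ.pos
  refine ⟨fluidFeasible_scale hz.1 θ, fun z' hz' => ?_⟩
  have h := fluidFeasible_scale_inv hz'
  rw [← z'.scale_inv_scale hθ.ne', fluidObjective_scale h, fluidObjective_scale hz.1]
  exact mul_le_mul_of_nonneg_left (hz.2 _ h) hθ.le

lemma fluidValue_eq (hz : M.IsFluidOptimal z) : M.fluidValue = M.fluidObjective z :=
  IsGreatest.csSup_eq ⟨⟨z, hz.1, rfl⟩, by rintro _ ⟨z', hz', rfl⟩; exact hz.2 z' hz'⟩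

lemma fluidValue_scale (hz : M.IsFluidOptimal z) (θ : ℕ+) :
    (M.scale θ).fluidValue = θ * M.fluidValue := by
  rw [fluidValue_eq (isFluidOptimal_scale hz θ), fluidObjective_scale hz.1, fluidValue_eq hz]

/-! ### Comparison of the long-run average profits -/

lemma exists_longRunProfits (hz : M.FluidFeasible z) :
    ∃ γSP γHYB γAUC : ℝ, M.IsLongRunProfit (M.SP z) γSP ∧ M.IsLongRunProfit (M.HYB z) γHYB ∧
      M.IsLongRunProfit (M.AUC z) γAUC ∧ γHYB ≤ γAUC ∧
      ((∀ e, 0 < z.y e → M.carrierPrice z e ≤ M.penalty e) → γSP ≤ γHYB) ∧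
      (∀ S, Tendsto (fun t => (M.push (M.SP z))^[t] (M.meanProfit (M.SP z)) S) atTop (𝓝 γSP)) ∧
      ∀ S, Tendsto (fun t => (M.push (M.AUC z))^[t] (M.meanProfit (M.AUC z)) S) atTop
        (𝓝 γAUC) := by
  obtain ⟨γSP, hSP, tSP⟩ := M.exists_tendsto_meanProfit (M.isRegular_SP z) hz.demand_nonneg
  obtain ⟨γHYB, hHYB, tHYB⟩ := M.exists_tendsto_meanProfit (M.isRegular_HYB z) hz.demand_nonneg
  obtain ⟨γAUC, hAUC, tAUC⟩ := M.exists_tendsto_meanProfit (M.isRegular_AUC z) hz.demand_nonneg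
  obtain ⟨C₁, hC₁⟩ := M.exists_abs_meanProfit_le (M.isRegular_SP z) hz.demand_nonneg
  obtain ⟨C₂, hC₂⟩ := M.exists_abs_meanProfit_le (M.isRegular_HYB z) hz.demand_nonneg
  obtain ⟨C₃, hC₃⟩ := M.exists_abs_meanProfit_le (M.isRegular_AUC z) hz.demand_nonneg
  refine ⟨γSP, γHYB, γAUC, hSP, hHYB, hAUC, ?_, fun hp => ?_, tSP, tAUC⟩
  · refine le_of_tendsto_of_tendsto' (tHYB 0) (tAUC 0) fun t => ?_
    rw [push_AUC]
    exact M.iterate_push_mono (M.isRegular_HYB z) hC₂ hC₃ (M.meanProfit_HYB_le_AUC z) t 0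
  · refine le_of_tendsto_of_tendsto' (tSP 0) (tHYB 0) fun t => ?_
    exact (M.iterate_push_le_iterate_push (M.isRegular_SP z) (M.isRegular_HYB z) rfl
      (fun x x' ω e h1 h2 => M.served_SP_mono z ω e h1 h2)
      (fun x x' ω e h1 h2 => M.served_SP_le_served_HYB z ω e h1 h2) hC₁ hC₂
      (monotone_meanProfit_SP hz hp) (M.meanProfit_SP_le_HYB z) t).2 0

/-- The flow of carriers contracts at a feasible point of the fluid problem. -/
lemma exists_contraction (hz : M.FluidFeasible z) :
    ∃ ε : ℝ, 0 < ε ∧ ε ≤ 1 ∧ ∀ e,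
      ∑ e' : E with e'.1.2 = e.1.1, z.y e / z.lam e * M.stay e * z.y e' ≤ (1 - ε) * z.y e := by
  have hnn : ∀ e, 0 ≤ z.lam e / M.arrival e := fun e =>
    div_nonneg (hz.lam_nonneg e) (M.arrival_pos e).le
  have hs : 0 ≤ ∑ e, z.lam e / M.arrival e := Finset.sum_nonneg fun e _ => hnn e
  -- With weights `z.y`, flow balance makes the factor on lane `e` equal to `1 - M.arrival e / z.lam
  -- e`. This `ε` is below every `M.arrival e / z.lam e`, and the summand `1` gives `ε ≤ 1`.
  refine ⟨(1 + ∑ e, z.lam e / M.arrival e)⁻¹, by positivity, inv_le_one_of_one_le₀ (by linarith),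
    fun e => ?_⟩
  have hl := hz.lam_pos e
  have ha := M.arrival_pos e
  have h1 : (1 + ∑ e, z.lam e / M.arrival e)⁻¹ ≤ M.arrival e / z.lam e := by
    rw [← inv_div]
    refine inv_anti₀ (div_pos hl ha) ?_
    linarith [Finset.single_le_sum (f := fun e => z.lam e / M.arrival e) (fun e _ => hnn e)
      (Finset.mem_univ e)]
  have h2 : ∑ e' : E with e'.1.2 = e.1.1, z.y e / z.lam e * M.stay e * z.y e' =
      z.y e - M.arrival e / z.lam e * z.y e := by
    have h3 : ∑ e' : E with e'.1.2 = e.1.1, M.stay e * z.y e' = z.lam e - M.arrival e := by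
      linarith [hz.flow e]
    simp only [mul_assoc]
    rw [← Finset.mul_sum, h3]
    field_simp
  rw [h2]
  linarith [mul_le_mul_of_nonneg_right h1 (hz.y_nonneg e)]

/-- The profit of the posted prices in the scaled market falls short of the fluid optimum at most
by a multiple of `√θ`. -/
lemma exists_scale_fluidObjective_sub_le (hz : M.FluidFeasible z)
    (hp : ∀ e, 0 < z.y e → M.carrierPrice z e ≤ M.penalty e) :
    ∃ K : ℝ, ∀ (θ : ℕ+) (γ : ℝ), (∀ S, Tendsto (fun t => ((M.scale θ).push
        ((M.scale θ).SP (z.scale θ)))^[t]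
          ((M.scale θ).meanProfit ((M.scale θ).SP (z.scale θ))) S) atTop (𝓝 γ)) →
      θ * M.fluidObjective z - γ ≤ K * √(θ : ℝ) := by
  obtain ⟨ε, hε, hε1, hcontr⟩ := exists_contraction hz
  have hΛ : 0 ≤ M.totalRate z := add_nonneg (Finset.sum_nonneg fun e _ => hz.d_nonneg e)
    (Finset.sum_nonneg fun e _ => (M.arrival_pos e).le)
  -- It serves to have `1 ≤ k * z.y e` on all lanes in use; the other lanes contribute `0⁻¹ = 0`.
  set k : ℝ := ∑ e, (z.y e)⁻¹ with hk
  have hk0 : 0 ≤ k := Finset.sum_nonneg fun e _ => inv_nonneg.2 (hz.y_nonneg e)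
  refine ⟨2 * (1 + M.totalRate z) * k / ε * ∑ e, |M.penalty e - M.carrierPrice z e| * z.y e,
    fun θ γ hγ => ?_⟩
  have hθ : (0 : ℝ) < θ := by exact_mod_cast θ.pos
  have hsq : 0 < √(θ : ℝ) := Real.sqrt_pos.2 hθ
  have hss : √(θ : ℝ) * √(θ : ℝ) = θ := Real.mul_self_sqrt hθ.le
  have hrate : (M.scale θ).totalRate (z.scale θ) = θ * M.totalRate z := by
    simp only [totalRate, FluidPoint.scale, scale, mul_add, Finset.mul_sum]
  -- The weights stay unscaled and `ε` is free of `θ`, because the contraction involves only ratios.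
  -- With `a = √θ` the noise is `2 * √θ * (1 + M.totalRate z)`, so `κ`, and with it the loss, is of
  -- order `√θ`.
  have h := fluidObjective_sub_le (fluidFeasible_scale hz θ) (w := z.y) (W := θ) (a := √(θ : ℝ))
    (κ := 2 * √(θ : ℝ) * (1 + M.totalRate z) * k) (ε := ε)
    (fun e he => by
      rw [carrierPrice_scale]
      exact hp e (pos_of_mul_pos_right he hθ.le)) hsq hz.y_nonneg hθ.le (by positivity) hε hε1
    (fun e => le_rfl)
    (fun e _ => by
      simp only [FluidPoint.scale, mul_div_mul_left _ _ hθ.ne']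
      exact hcontr e)
    (fun e he => by
      have he' : 0 < z.y e := pos_of_mul_pos_right he hθ.le
      have h1 : 1 ≤ k * z.y e := by
        rw [← inv_mul_cancel₀ he'.ne']
        exact mul_le_mul_of_nonneg_right (Finset.single_le_sum (f := fun e => (z.y e)⁻¹)
          (fun e _ => inv_nonneg.2 (hz.y_nonneg e)) (Finset.mem_univ e)) he'.le
      have h2 : θ * M.totalRate z / √(θ : ℝ) = √(θ : ℝ) * M.totalRate z := by
        rw [div_eq_iff hsq.ne']
        linear_combination -(M.totalRate z) * hss
      rw [hrate, h2]
      have h3 := mul_le_mul_of_nonneg_left h1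
        (by positivity : 0 ≤ 2 * √(θ : ℝ) * (1 + M.totalRate z))
      linarith) (hγ 0)
  rw [fluidObjective_scale hz, carrierPrice_scale] at h
  refine (sub_le_comm.1 h).trans (le_of_eq ?_)
  simp only [scale]
  ring

end Market
end Freight

theorem theorem5 {N : Type*} [Fintype N] [DecidableEq N] {E : Finset (N × N)}
    (M : Freight.Market N E) (z : Freight.FluidPoint E) (hz : M.IsFluidOptimal z) :
    (∃ γSP γHYB γAUC : ℝ,
      M.IsLongRunProfit (M.SP z) γSP ∧
      M.IsLongRunProfit (M.HYB z) γHYB ∧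
      M.IsLongRunProfit (M.AUC z) γAUC ∧
      γHYB ≤ γAUC ∧
      ((∀ e, 0 < z.y e → M.carrierPrice z e ≤ M.penalty e) → γSP ≤ γHYB)) ∧
    ((∀ e, 0 < z.y e → M.carrierPrice z e ≤ M.penalty e) →
      ∃ γ : ℕ+ → ℝ,
        (∀ θ, (M.scale θ).IsLongRunProfit (M.HYB z) (γ θ)) ∧
        (∃ K : ℝ, ∀ θ : ℕ+, (M.scale θ).fluidValue - γ θ ≤ K * √(θ : ℝ)) ∧
        (0 < M.fluidValue →
          Tendsto (fun θ => γ θ / (M.scale θ).fluidValue) atTop (𝓝 1))) := by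
  refine ⟨?_, fun hp => ?_⟩
  · obtain ⟨γSP, γHYB, γAUC, h1, h2, h3, h4, h5, -⟩ :=
      Freight.Market.exists_longRunProfits hz.1
    exact ⟨γSP, γHYB, γAUC, h1, h2, h3, h4, h5⟩
  choose γSP γHYB γAUC _ hHYB _ hHA hSH tSP tAUC using fun θ : ℕ+ =>
    Freight.Market.exists_longRunProfits (Freight.Market.fluidFeasible_scale hz.1 θ)
  obtain ⟨K, hK⟩ := Freight.Market.exists_scale_fluidObjective_sub_le hz.1 hp
  have hpos : ∀ θ : ℕ+, (0 : ℝ) < θ := fun θ => by exact_mod_cast θ.pos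
  have hlow : ∀ θ : ℕ+, θ * M.fluidValue - γHYB θ ≤ K * √(θ : ℝ) := fun θ => by
    have h1 := hSH θ fun e he => by
      rw [Freight.Market.carrierPrice_scale]
      exact hp e (pos_of_mul_pos_right he (hpos θ).le)
    have h2 := hK θ (γSP θ) (tSP θ)
    rw [Freight.Market.fluidValue_eq hz]
    linarith
  -- The upper bound for HYB is inherited from AUC; only the convergence of the ratio needs it.
  have hupp : ∀ θ : ℕ+, γHYB θ ≤ θ * M.fluidValue := fun θ => by
    have h := Freight.Market.le_fluidObjective_of_tendsto
      (Freight.Market.isFluidOptimal_scale hz θ) (tAUC θ)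
    rw [Freight.Market.fluidObjective_scale hz.1, ← Freight.Market.fluidValue_eq hz] at h
    exact (hHA θ).trans h
  refine ⟨γHYB, fun θ => ?_, ⟨K, fun θ => ?_⟩, fun hF => ?_⟩
  · rw [← Freight.Market.HYB_scale hz.1 θ]
    exact hHYB θ
  · rw [Freight.Market.fluidValue_scale hz]
    exact hlow θ
  · have hlim : Tendsto (fun θ : ℕ+ => 1 - K / M.fluidValue / √(θ : ℝ)) atTop (𝓝 1) := by
      have h1 : Tendsto (fun θ : ℕ+ => √(θ : ℝ)) atTop atTop :=
        Real.tendsto_sqrt_atTop.comp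
          (tendsto_natCast_atTop_atTop.comp tendsto_PNat_val_atTop_atTop)
      simpa using (h1.const_div_atTop (K / M.fluidValue)).const_sub 1
    refine tendsto_of_tendsto_of_tendsto_of_le_of_le hlim tendsto_const_nhds (fun θ => ?_)
      fun θ => ?_
    · have hsq : 0 < √(θ : ℝ) := Real.sqrt_pos.2 (hpos θ)
      have hss : √(θ : ℝ) * √(θ : ℝ) = θ := Real.mul_self_sqrt (hpos θ).le
      dsimp only
      rw [Freight.Market.fluidValue_scale hz, le_div_iff₀ (mul_pos (hpos θ) hF)]
      have h2 : (1 - K / M.fluidValue / √(θ : ℝ)) * (θ * M.fluidValue) =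
          θ * M.fluidValue - K * √(θ : ℝ) := by
        field_simp
        linear_combination K * hss
      linarith [hlow θ]
    · dsimp only
      rw [Freight.Market.fluidValue_scale hz, div_le_one (mul_pos (hpos θ) hF)]
      exact hupp θ
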